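/- Let $n\ge 6$, $d=\lfloor\frac{n-2}{2}\rfloor$, $\mathbb{R}^n_+=\{x\in\mathbb{R}^n: x_n\ge 0\}$, and let $B_r$ be the Euclidean ball of radius $r$ centered at $0$. There is a constant $C(n)>0$ depending only on $n$ with the following property. Let $g=\exp(h)$ be a metric in conformal Fermi coordinates on a half ball $B_\rho\cap\mathbb{R}^n_+$, $\rho>0$, with totally geodesic boundary; that is, $h=(h_{ij})$ is a symmetric two-tensor, smooth up to the boundary on $B_\rho\cap\mathbb{R}^n_+$, such that $\operatorname{tr}h(x)=O(|x|^{2d+2})$ as $x\to 0$; $h_{in}(x)=0$ for $x\in B_\rho\cap\mathbb{R}^n_+$ and $1\le i\le n$; and $\partial_n h_{ab}(x)=0$ and $\sum_{i=1}^n h_{ai}(x)x_i=0$ for $x\in B_\rho\cap\partial\mathbb{R}^n_+$ and $1\le a,b\le n-1$. Let $h_{ij,\alpha}=\frac{1}{\alpha!}\partial^\alpha h_{ij}(0)$ and let $$H_{ij}(x)=\sum_{2\le|\alpha|\le d}h_{ij,\alpha}\,x^\alpha$$ be the Taylor expansion of $h_{ij}$ at $0$ up to order $d$. For $\epsilon>0$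 put $$v_\epsilon(x)=\epsilon^{\frac{n-2}{2}}\Big((\epsilon+x_n)^2+\sum_{a=1}^{n-1}x_a^2\Big)^{-\frac{n-2}{2}},\qquad x\in\mathbb{R}^n_+ .$$ For a vector field $V$ on $\mathbb{R}^n_+$ that is smooth up to the boundary, put $$S_{ik}=\partial_iV_k+\partial_kV_i-\tfrac2n(\operatorname{div}V)\,\delta_{ik},\qquad T_{ik}=H_{ik}-S_{ik},$$ $$P_{ik,l}=v_\epsilon\partial_lT_{ik}-\tfrac{2}{n-2}\partial_iv_\epsilon T_{kl}-\tfrac{2}{n-2}\partial_kv_\epsilon T_{il}+\tfrac{2}{n-2}\sum_{p=1}^n\partial_pv_\epsilon T_{ip}\,\delta_{kl}+\tfrac{2}{n-2}\sum_{p=1}^n\partial_pv_\epsilon T_{kp}\,\delta_{il},$$ and $|P|^2=\sum_{i,k,l=1}^n P_{ik,l}^2$. Then, for every such $g=\exp(h)$, every such vector field $V$, and all $\epsilon,\delta$ with $\delta\ge 2\epsilon>0$, $$\sum_{i,j=1}^n\ \sum_{2\le|\alpha|\le d}|h_{ij,\alpha}|^2\,\epsilon^{n-2}\int_{B_\delta\cap\mathbb{R}^n_+}(\epsilon+|x|)^{2|\alpha|+2-2n}\,dx\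 \le\ C(n)\int_{B_\delta\cap\mathbb{R}^n_+}|P|^2\,dx .$$ -/

import Mathlib

open scoped ContDiff Topology

noncomputable section

namespace HalfSpace

/-- Euclidean space `ℝⁿ`. -/
abbrev E (n : ℕ) : Type := EuclideanSpace ℝ (Fin n)

/-- The index of the normal coordinate, i.e. the last coordinate `x_n`. -/
def nrm (n : ℕ) [NeZero n] : Fin n := ⟨n - 1, Nat.sub_lt (NeZero.pos n) one_pos⟩

/-- The closed half space `ℝⁿ₊ = {x : x_n ≥ 0}`. -/
def half (n : ℕ) [NeZero n] : Set (E n) := {x | 0 ≤ x (nrm n)}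

/-- The order `d = ⌊(n - 2) / 2⌋` of the Taylor expansion. -/
def dOrd (n : ℕ) : ℕ := (n - 2) / 2

/-- The partial derivative `∂_i f` of a function on the closed half space
(one-sided in the normal direction at boundary points). -/
def pd {n : ℕ} [NeZero n] (i : Fin n) (f : E n → ℝ) (x : E n) : ℝ :=
  fderivWithin ℝ f (half n) x (EuclideanSpace.single i 1)

/-- The iterated partial derivative `∂^α f = ∂_1^{α_1} ⋯ ∂_n^{α_n} f` on the half space. -/
def multiPd {n : ℕ} [NeZero n] (α : Fin n → ℕ) (f : E n → ℝ) : E n → ℝ :=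
  (List.finRange n).foldr (fun i φ => (pd i)^[α i] φ) f

/-- The order `|α|` of a multi-index. -/
def order {n : ℕ} (α : Fin n → ℕ) : ℕ := ∑ i, α i

/-- The finite set of multi-indices with `2 ≤ |α| ≤ d`. -/
def multiIdx (n : ℕ) : Finset (Fin n → ℕ) :=
  (Finset.Icc 2 (dOrd n)).biUnion fun k => Finset.piAntidiag Finset.univ k

theorem mem_multiIdx {n : ℕ} (α : Fin n → ℕ) :
    α ∈ multiIdx n ↔ 2 ≤ order α ∧ order α ≤ dOrd n := by
  simp [multiIdx, order, Finset.mem_piAntidiag]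

/-- Fields of real `n × n` matrices on `ℝⁿ` (only their values on the half space matter). -/
abbrev MatField (n : ℕ) : Type := E n → Matrix (Fin n) (Fin n) ℝ

/-- `g = exp h` is a metric in conformal Fermi coordinates on the half ball
`B_ρ ∩ ℝⁿ₊`, around a boundary point at the origin, the boundary being totally geodesic:
* `h` is a symmetric two-tensor, smooth up to the boundary, and `g = exp h`;
* `h_{in} = 0` (that is, `g_{in} = δ_{in}`: the last coordinate is the distance to the boundary);
* `∂_n h_{ab} = 0` on the boundary (the boundary is totally geodesic);
* `∑_i h_{ai} x_i = 0` on the boundary (normal coordinates of the boundary at the origin);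
* `tr h = O(|x|^{2d+2})` (that is, `det g = 1 + O(|x|^{2d+2})`: the conformal normalization). -/
structure IsConformalFermi {n : ℕ} [NeZero n] (ρ : ℝ) (g h : MatField n) : Prop where
  radius_pos : 0 < ρ
  smooth : ∀ i j, ContDiffOn ℝ ∞ (fun x => h x i j) (half n ∩ Metric.ball 0 ρ)
  symm : ∀ x ∈ half n ∩ Metric.ball 0 ρ, (h x).IsSymm
  metric_eq : ∀ x ∈ half n ∩ Metric.ball 0 ρ, g x = NormedSpace.exp (h x)
  trace_isBigO :
    (fun x => (h x).trace) =O[𝓝[half n] 0] fun x => ‖x‖ ^ (2 * dOrd n + 2)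
  normal : ∀ x ∈ half n ∩ Metric.ball 0 ρ, ∀ i, h x i (nrm n) = 0
  totally_geodesic : ∀ x ∈ half n ∩ Metric.ball 0 ρ, x (nrm n) = 0 →
    ∀ a b, a ≠ nrm n → b ≠ nrm n → pd (nrm n) (fun y => h y a b) x = 0
  boundary_normal : ∀ x ∈ half n ∩ Metric.ball 0 ρ, x (nrm n) = 0 →
    ∀ a, a ≠ nrm n → ∑ i, h x a i * x i = 0

/-- The Taylor coefficient `h_{ij,α} = ∂^α h_{ij}(0) / α!`. -/
def coef {n : ℕ} [NeZero n] (h : MatField n) (i j : Fin n) (α : Fin n → ℕ) : ℝ :=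
  multiPd α (fun x => h x i j) 0 / ((∏ k, (α k).factorial : ℕ) : ℝ)

/-- The Taylor polynomial `H_{ij}(x) = ∑_{2 ≤ |α| ≤ d} h_{ij,α} x^α`. -/
def taylorH {n : ℕ} [NeZero n] (h : MatField n) (i j : Fin n) (x : E n) : ℝ :=
  ∑ α ∈ multiIdx n, coef h i j α * ∏ k, x k ^ α k

/-- `v_ε(x) = ε^{(n-2)/2} ((ε + x_n)² + ∑_{a<n} x_a²)^{-(n-2)/2}`. -/
def vEps {n : ℕ} [NeZero n] (ε : ℝ) (x : E n) : ℝ :=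
  ε ^ (((n : ℝ) - 2) / 2) *
    ((ε + x (nrm n)) ^ 2 + ∑ a ∈ Finset.univ.erase (nrm n), x a ^ 2) ^ (-(((n : ℝ) - 2) / 2))

/-- The divergence of a vector field. -/
def divV {n : ℕ} [NeZero n] (V : E n → E n) (x : E n) : ℝ :=
  ∑ i, pd i (fun y => V y i) x

/-- The Kronecker symbol. -/
def kron {n : ℕ} (i j : Fin n) : ℝ := if i = j then 1 else 0

/-- `S_{ik} = ∂_i V_k + ∂_k V_i - (2/n) div V δ_{ik}`. -/
def tensorS {n : ℕ} [NeZero n] (V : E n → E n) (i k : Fin n) (x : E n) : ℝ :=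
  pd i (fun y => V y k) x + pd k (fun y => V y i) x - 2 / (n : ℝ) * divV V x * kron i k

/-- `T_{ik} = H_{ik} - S_{ik}`. -/
def tensorT {n : ℕ} [NeZero n] (h : MatField n) (V : E n → E n) (i k : Fin n) (x : E n) : ℝ :=
  taylorH h i k x - tensorS V i k x

/-- `P_{ik,l} = v ∂_l T_{ik} - 2/(n-2) ∂_i v T_{kl} - 2/(n-2) ∂_k v T_{il}
  + 2/(n-2) ∑_p ∂_p v T_{ip} δ_{kl} + 2/(n-2) ∑_p ∂_p v T_{kp} δ_{il}`, where `v = v_ε`. -/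
def tensorP {n : ℕ} [NeZero n] (ε : ℝ) (h : MatField n) (V : E n → E n)
    (i k l : Fin n) (x : E n) : ℝ :=
  vEps ε x * pd l (tensorT h V i k) x
    - 2 / ((n : ℝ) - 2) * pd i (vEps ε) x * tensorT h V k l x
    - 2 / ((n : ℝ) - 2) * pd k (vEps ε) x * tensorT h V i l x
    + 2 / ((n : ℝ) - 2) * (∑ p, pd p (vEps ε) x * tensorT h V i p x) * kron k l
    + 2 / ((n : ℝ) - 2) * (∑ p, pd p (vEps ε) x * tensorT h V k p x) * kron i l

/-- `|P|² = ∑_{i,k,l} P_{ik,l}²`. -/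
def normSqP {n : ℕ} [NeZero n] (ε : ℝ) (h : MatField n) (V : E n → E n) (x : E n) : ℝ :=
  ∑ i, ∑ k, ∑ l, tensorP ε h V i k l x ^ 2

end HalfSpace

end

open HalfSpace

/-! ### Polynomial tensors in normal gauge with pure-trace linearised curvature. -/

namespace MvPolynomial

variable {σ : Type*}

/-! The linearised Weyl tensor annihilates every $S$, so it sees $H$ and not $V$. It is also
conformally invariant. With $u=\frac{2}{n-2}\log v_\epsilon$ the metric $e^{2u}\delta$ is flat, and
$P=v_\epsilon e^{-2u}\nabla(e^{2u}T)$, where $\nabla$ is its Levi-Civita connection. Hence the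
linearised Weyl tensor $W$ of $H$ is a first-order expression in $P$; `IsWeylLike.sum_pd_reducedP`
states this after pairing with a tensor having the antisymmetries and trace of a Weyl tensor.

Pair with $\chi W$, where $\chi$ is a cut-off supported at scale $r\ge\epsilon$ inside the open half
space, and move the derivative from $P$ to $\chi W$. No boundary term appears, so $V$ needs no
boundary condition. By Young's inequality $\int\chi|W|^2$ is then bounded by a small multiple of the
squared coefficients of $H$ plus a multiple of $\int|P|^2$ (`integral_density`, `density_le`).

For the converse bound, $\int\chi|W|^2$ is a quadratic form on the finite-dimensional space of
coefficients. It is positive definite on the coefficients satisfying the Fermi conditions, so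
compactness gives a lower bound (`exists_lower_bound_pairing`). Definiteness is algebra: if $W=0$ on
an open set, the linearised curvature of $H$ is identically pure trace. On the boundary hyperplane
the gauge $\sum_j x_jH_{ij}=0$ together with Euler's identity forces $H=0$
(`eq_zero_of_linearised_curvature_pure_trace`). The totally geodesic condition removes the first
power of $x_n$, and the curvature equations express $\partial_n^2H$ through tangential derivatives,
which removes all other powers (`eq_zero_of_fermi`).

Replacing $h_{ij,\alpha}$ by $r^{|\alpha|}h_{ij,\alpha}$ transfers the estimate to scale $r$ with a
constant independent of $r$ and $\epsilon$ (`exists_scale_estimate`). The half ball is finally cut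
into a core of radius comparable to $\epsilon$ and dyadic half annuli. On each of these
$\epsilon+|x|$ is bounded below by a fixed multiple of the radius, and the estimates add up. -/

theorem pderiv_pderiv_comm [DecidableEq σ] (i j : σ) (p : MvPolynomial σ ℝ) :
    pderiv i (pderiv j p) = pderiv j (pderiv i p) := by
  ext m
  simp only [coeff_pderiv, Finsupp.add_apply]
  rw [add_right_comm]
  by_cases h : i = j
  · subst h; rfl
  · simp [h, Ne.symm h]; ring

/-- The squared length `∑ X_i²`. -/
noncomputable def radSq (σ : Type*) [Fintype σ] : MvPolynomial σ ℝ := ∑ i, X i * X i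

/-- The Laplacian of a polynomial. -/
noncomputable def laplacian [Fintype σ] (p : MvPolynomial σ ℝ) : MvPolynomial σ ℝ := ∑ i, pderiv i (pderiv i p)

/-- The Kronecker symbol with polynomial values. -/
noncomputable def kr [DecidableEq σ] (i j : σ) : MvPolynomial σ ℝ := if i = j then 1 else 0

theorem kr_comm [DecidableEq σ] (i j : σ) : kr i j = kr j i := by simp [kr, eq_comm]

theorem pderiv_radSq [Fintype σ] [DecidableEq σ] (i : σ) : pderiv i (radSq σ) = 2 * X i := by
  simp only [radSq, map_sum, pderiv_mul, pderiv_X, Pi.single_apply]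
  simp [Finset.sum_add_distrib, two_mul]

theorem IsHomogeneous.euler [Fintype σ] {k : ℕ} {p : MvPolynomial σ ℝ} (h : p.IsHomogeneous k) :
    ∑ j, X j * pderiv j p = k * p := by
  rw [h.sum_X_mul_pderiv, nsmul_eq_mul]

/-- The cross term of the product rule is $4\,x\cdot\nabla p$, which Euler's identity turns into
$4qp$. -/
theorem laplacian_radSq_mul [Fintype σ] [DecidableEq σ] {q : ℕ} {p : MvPolynomial σ ℝ} (h : p.IsHomogeneous q) :
    laplacian (radSq σ * p) =
      (2 * (Fintype.card σ : MvPolynomial σ ℝ) + 4 * q) * p + radSq σ * laplacian p := by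
  have h2 : ∀ i : σ, pderiv i (2 : MvPolynomial σ ℝ) = 0 := fun i => by
    simpa using (pderiv i).map_natCast 2
  have : ∀ i, pderiv i (pderiv i (radSq σ * p)) =
      2 * p + 4 * (X i * pderiv i p) + radSq σ * pderiv i (pderiv i p) := by
    intro i
    simp only [pderiv_mul, map_add, pderiv_radSq, h2, pderiv_X_self]
    ring
  simp only [laplacian, this, Finset.sum_add_distrib, ← Finset.mul_sum, h.euler]
  simp
  ring

theorem laplacian_C_mul [Fintype σ] (c : ℝ) (p : MvPolynomial σ ℝ) :
    laplacian (C c * p) = C c * laplacian p := by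
  simp [laplacian, Finset.mul_sum]

theorem IsHomogeneous.laplacian [Fintype σ] {q : ℕ} {p : MvPolynomial σ ℝ} (h : p.IsHomogeneous (q + 2)) :
    (laplacian p).IsHomogeneous q :=
  IsHomogeneous.sum _ _ _ fun i _ => (h.pderiv (i := i)).pderiv

theorem laplacian_eq_zero_of_degree_lt [Fintype σ] {q : ℕ} (hq : q < 2) {p : MvPolynomial σ ℝ}
    (h : p.IsHomogeneous q) : laplacian p = 0 := by
  refine Finset.sum_eq_zero fun i _ => ?_
  have h1 : (pderiv i p).IsHomogeneous 0 := by
    have := h.pderiv (i := i)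
    rwa [show q - 1 = 0 by omega] at this
  rw [← totalDegree_zero_iff_isHomogeneous, totalDegree_eq_zero_iff_eq_C] at h1
  rw [h1, pderiv_C]

/-- The eigenvalues of `|x|² Δ` on homogeneous polynomials of degree `q` lie between
`0` and `q (q + m - 2)`. -/
theorem eq_zero_of_radSq_mul_laplacian [Fintype σ] [DecidableEq σ]
    (hσ : 2 ≤ Fintype.card σ) (q : ℕ) : ∀ (l : ℝ) (p : MvPolynomial σ ℝ),
    p.IsHomogeneous q → radSq σ * laplacian p = C l * p →
    (l < 0 ∨ (q : ℝ) * (q + Fintype.card σ - 2) < l) → p = 0 := by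
  have hc : (2 : ℝ) ≤ Fintype.card σ := by exact_mod_cast hσ
  induction q using Nat.strong_induction_on with
  | _ q ih =>
    intro l p hp h hl
    have hq0 : (0 : ℝ) ≤ q := q.cast_nonneg
    have hl0 : l ≠ 0 := by
      rcases hl with h | h
      · exact h.ne
      · have : (0 : ℝ) ≤ q * (q + Fintype.card σ - 2) := mul_nonneg hq0 (by linarith)
        linarith
    have hp1 : p = C l⁻¹ * (radSq σ * laplacian p) := by
      rw [h, ← mul_assoc, ← C_mul, inv_mul_cancel₀ hl0, C_1, one_mul]
    by_cases hq : q < 2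
    · rw [hp1, laplacian_eq_zero_of_degree_lt hq hp]; simp
    obtain ⟨r, rfl⟩ : ∃ r, q = r + 2 := ⟨q - 2, by omega⟩
    -- Applying the Laplacian to the eigenvalue equation shows that $\Delta p$ satisfies the same
    -- equation in degree $r=q-2$ with $l$ lowered by $2m+4r$. Since $q(q+m-2)-2m-4r=r(r+m-2)$, both
    -- alternatives for $l$ are inherited.
    have key : laplacian p = 0 := by
      refine ih r (by omega) (l - 2 * Fintype.card σ - 4 * r) _ hp.laplacian ?_ ?_
      · have h1 := congrArg laplacian h
        rw [laplacian_radSq_mul hp.laplacian, laplacian_C_mul] at h1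
        simp only [C_sub, C_mul]
        simp only [map_natCast, map_ofNat]
        linear_combination h1
      · push_cast at hl
        have hr : (0 : ℝ) ≤ r := r.cast_nonneg
        rcases hl with hl | hl
        · left; nlinarith
        · right; nlinarith
    rw [hp1, key]; simp

/-- A homogeneous trace-free symmetric tensor field with `B x = 0` whose linearised
curvature is pure trace vanishes. -/
theorem eq_zero_of_linearised_curvature_pure_trace [Fintype σ] [DecidableEq σ]
    (hσ : 4 ≤ Fintype.card σ) (q : ℕ) (B A : σ → σ → MvPolynomial σ ℝ)
    (hB : ∀ i j, (B i j).IsHomogeneous (q + 2)) (hA : ∀ i j, (A i j).IsHomogeneous q)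
    (hBs : ∀ i j, B i j = B j i) (hAs : ∀ i j, A i j = A j i) (htr : ∑ i, B i i = 0)
    (hX : ∀ i, ∑ j, X j * B i j = 0)
    (hR : ∀ i j k l, pderiv i (pderiv k (B j l)) + pderiv j (pderiv l (B i k))
      - pderiv j (pderiv k (B i l)) - pderiv i (pderiv l (B j k)) =
      kr i k * A j l + kr j l * A i k - kr j k * A i l - kr i l * A j k) (i j : σ) :
    B i j = 0 := by
  set m : MvPolynomial σ ℝ := (Fintype.card σ : MvPolynomial σ ℝ) with hm
  set a := ∑ i, A i i with ha
  set α : σ → MvPolynomial σ ℝ := fun l => ∑ j, X j * A j l with hα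
  set β := ∑ l, X l * α l with hβ
  set b : σ → MvPolynomial σ ℝ := fun l => ∑ i, pderiv i (B i l) with hb
  have dB : ∀ i j l, (pderiv l (B i j)).IsHomogeneous (q + 1) := fun i j l => (hB i j).pderiv
  -- Differentiating the gauge condition $\sum_j x_jB_{ij}=0$ once, and then twice in `E2`,
  -- evaluates the contractions with $x$ that Euler's identity does not.
  have E1 : ∀ i k, ∑ j, X j * pderiv k (B i j) = - B i k := by
    intro i k
    have := congrArg (pderiv k) (hX i)
    simp only [map_sum, pderiv_mul, pderiv_X, Pi.single_apply, map_zero] at this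
    simp [Finset.sum_add_distrib] at this
    linear_combination this
  have E2 : ∀ i k l, ∑ j, X j * pderiv l (pderiv k (B i j)) =
      - pderiv l (B i k) - pderiv k (B i l) := by
    intro i k l
    have := congrArg (pderiv l) (E1 i k)
    simp only [map_sum, pderiv_mul, pderiv_X, Pi.single_apply, map_neg] at this
    simp [Finset.sum_add_distrib] at this
    linear_combination this
  -- Contraction of the curvature equation with $x_j$. The trace over $i=k$ gives `hiii`, and a
  -- second contraction, with $x_l$, gives `hi`.
  have hii : ∀ i k l, ((q : MvPolynomial σ ℝ) + 2) * (pderiv l (B i k) - pderiv k (B i l)) =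
      kr i k * α l + X l * A i k - X k * A i l - kr i l * α k := by
    intro i k l
    have h1 := Finset.sum_congr rfl fun j (_ : j ∈ Finset.univ) => congrArg (X j * ·) (hR i j k l)
    simp only [mul_add, mul_sub, Finset.sum_add_distrib, Finset.sum_sub_distrib] at h1
    have e1 : ∑ j, X j * pderiv i (pderiv k (B j l)) = - pderiv i (B l k) - pderiv k (B l i) := by
      rw [← E2]; exact Finset.sum_congr rfl fun j _ => by rw [hBs]
    have e2 : ∑ j, X j * pderiv i (pderiv l (B j k)) = - pderiv i (B k l) - pderiv l (B k i) := by
      rw [← E2]; exact Finset.sum_congr rfl fun j _ => by rw [hBs]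
    have e3 : ∑ j, X j * (kr i k * A j l) = kr i k * α l := by
      rw [hα, Finset.mul_sum]; exact Finset.sum_congr rfl fun j _ => by ring
    have e4 : ∑ j, X j * (kr i l * A j k) = kr i l * α k := by
      rw [hα, Finset.mul_sum]; exact Finset.sum_congr rfl fun j _ => by ring
    have e5 : ∑ j, X j * (kr j l * A i k) = X l * A i k := by
      simp [kr]
    have e6 : ∑ j, X j * (kr j k * A i l) = X k * A i l := by
      simp [kr]
    rw [e1, e2, e3, e4, e5, e6, (dB i k l).euler, (dB i l k).euler] at h1
    rw [hBs l k, hBs l i, hBs k i] at h1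
    push_cast at h1
    linear_combination h1
  have hiii : ∀ l, -((q : MvPolynomial σ ℝ) + 2) * b l = (m - 2) * α l + X l * a := by
    intro l
    have h1 := Finset.sum_congr rfl fun i (_ : i ∈ Finset.univ) => hii i i l
    simp only [← Finset.mul_sum, Finset.sum_add_distrib, Finset.sum_sub_distrib] at h1
    have e1 : ∑ i, kr i i * α l = m * α l := by simp [kr, hm]
    have e2 : ∑ i, kr i l * α i = α l := by simp [kr]
    have e3 : ∑ i, pderiv l (B i i) = 0 := by rw [← map_sum, htr, map_zero]
    rw [e1, e2, e3] at h1
    change _ = m * α l + X l * a - α l - α l at h1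
    linear_combination h1
  have hi : ∀ i k, ((q : MvPolynomial σ ℝ) + 2) * ((q : MvPolynomial σ ℝ) + 3) * B i k =
      kr i k * β + radSq σ * A i k - X k * α i - X i * α k := by
    intro i k
    have h1 := Finset.sum_congr rfl fun l (_ : l ∈ Finset.univ) => congrArg (X l * ·) (hii i k l)
    have e0 : ∑ l, X l * (((q : MvPolynomial σ ℝ) + 2) * (pderiv l (B i k) - pderiv k (B i l))) =
        ((q : MvPolynomial σ ℝ) + 2) * (∑ l, X l * pderiv l (B i k) - ∑ l, X l * pderiv k (B i l)) := by
      rw [← Finset.sum_sub_distrib, Finset.mul_sum]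
      exact Finset.sum_congr rfl fun l _ => by ring
    rw [e0, (hB i k).euler, E1] at h1
    simp only [mul_add, mul_sub, Finset.sum_add_distrib, Finset.sum_sub_distrib] at h1
    have e3 : ∑ l, X l * (kr i k * α l) = kr i k * β := by
      rw [hβ, Finset.mul_sum]; exact Finset.sum_congr rfl fun j _ => by ring
    have e4 : ∑ l, X l * (X l * A i k) = radSq σ * A i k := by
      rw [radSq, Finset.sum_mul]; exact Finset.sum_congr rfl fun j _ => by ring
    have e5 : ∑ l, X l * (X k * A i l) = X k * α i := by
      simp only [hα, Finset.mul_sum]; exact Finset.sum_congr rfl fun j _ => by rw [hAs]; ring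
    have e6 : ∑ l, X l * (kr i l * α k) = X i * α k := by
      simp [kr]
    rw [e3, e4, e5, e6] at h1
    push_cast at h1
    linear_combination h1
  -- Ricci contraction ($j=l$) of the curvature equation; the trace of $B$ drops out.
  have hiv : ∀ i k, laplacian (B i k) - pderiv k (b i) - pderiv i (b k) =
      kr i k * a + (m - 2) * A i k := by
    intro i k
    have h1 := Finset.sum_congr rfl fun j (_ : j ∈ Finset.univ) => hR i j k j
    simp only [Finset.sum_add_distrib, Finset.sum_sub_distrib, ← Finset.mul_sum] at h1
    have e1 : ∑ j, pderiv i (pderiv k (B j j)) = 0 := by simp only [← map_sum, htr, map_zero]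
    have e2 : ∑ j, pderiv j (pderiv k (B i j)) = pderiv k (b i) := by
      simp only [hb, map_sum]
      exact Finset.sum_congr rfl fun j _ => by rw [pderiv_pderiv_comm, hBs]
    have e3 : ∑ j, pderiv i (pderiv j (B j k)) = pderiv i (b k) := by simp only [hb, map_sum]
    have e4 : ∑ j, kr j j * A i k = m * A i k := by simp [kr, hm]
    have e5 : ∑ j, kr j k * A i j = A i k := by simp [kr]
    have e6 : ∑ j, kr i j * A j k = A i k := by simp [kr]
    rw [e1, e2, e3, e4, e5, e6] at h1
    change 0 + laplacian (B i k) - _ - _ = kr i k * a + _ - _ - _ at h1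
    linear_combination h1
  -- Writing $m=c+4$ makes the factors $m-2$ and $m-3$, cancelled below, visibly nonzero. The second
  -- one reflects that in dimension three every curvature tensor is pure trace.
  obtain ⟨c, hc⟩ : ∃ c, Fintype.card σ = c + 4 := ⟨Fintype.card σ - 4, by omega⟩
  have hmc : m = (c : MvPolynomial σ ℝ) + 4 := by rw [hm, hc]; push_cast; ring
  have nz : ∀ k : ℕ, k ≠ 0 → (k : MvPolynomial σ ℝ) ≠ 0 := fun k hk => Nat.cast_ne_zero.2 hk
  have dnat : ∀ (i : σ) (k : ℕ), pderiv i (k : MvPolynomial σ ℝ) = 0 := fun i k =>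
    (pderiv i).map_natCast k
  have dm : ∀ i : σ, pderiv i m = 0 := fun i => dnat i _
  have d2 : ∀ i : σ, pderiv i (2 : MvPolynomial σ ℝ) = 0 := fun i => by simpa using dnat i 2
  have d3 : ∀ i : σ, pderiv i (3 : MvPolynomial σ ℝ) = 0 := fun i => by simpa using dnat i 3
  have dkr : ∀ i j k : σ, pderiv i (kr j k) = 0 := fun i j k => by
    unfold kr; split_ifs <;> simp
  have hdivb : ∑ i, pderiv i (b i) = -(m - 1) * a := by
    have h1 := Finset.sum_congr rfl fun i (_ : i ∈ Finset.univ) => hiv i i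
    simp only [Finset.sum_add_distrib, Finset.sum_sub_distrib, ← Finset.mul_sum,
      ← Finset.sum_mul] at h1
    have e1 : ∑ i, laplacian (B i i) = 0 := by
      simp only [laplacian]
      rw [Finset.sum_comm]
      simp only [← map_sum, htr, map_zero, Finset.sum_const_zero]
    have e2 : ∑ i : σ, kr i i = m := by simp [kr, hm]
    rw [e1, e2] at h1
    refine mul_left_cancel₀ (nz 2 two_ne_zero) ?_
    push_cast
    linear_combination -h1
  -- This is the linearised contracted Bianchi identity: the divergence of `hiv`, simplified by
  -- `hdivb`.
  have hdivA : ∀ i, ∑ k, pderiv k (A i k) = pderiv i a := by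
    intro i
    have h1 := Finset.sum_congr rfl fun k (_ : k ∈ Finset.univ) => congrArg (pderiv k) (hiv i k)
    simp only [map_sub, map_add, pderiv_mul, dkr, dm, d2, zero_mul, zero_add, sub_zero,
      Finset.sum_add_distrib, Finset.sum_sub_distrib, ← Finset.mul_sum] at h1
    have e1 : ∑ k, pderiv k (laplacian (B i k)) = ∑ k, pderiv k (pderiv k (b i)) := by
      simp only [laplacian, hb, map_sum]
      rw [Finset.sum_comm]
      refine Finset.sum_congr rfl fun j _ => Finset.sum_congr rfl fun k _ => ?_
      rw [pderiv_pderiv_comm k j, pderiv_pderiv_comm k j, hBs]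
    have e2 : ∑ k, pderiv k (pderiv i (b k)) = -(m - 1) * pderiv i a := by
      have := congrArg (pderiv i) hdivb
      simp only [pderiv_mul, map_neg, map_sub, dm, map_sum, pderiv_one] at this
      rw [Finset.sum_congr rfl fun j _ => pderiv_pderiv_comm j i (b j)]
      linear_combination this
    have e3 : ∑ k, kr i k * pderiv k a = pderiv i a := by simp [kr]
    rw [e1, e2, e3] at h1
    refine mul_left_cancel₀ (nz (c + 2) (by omega)) ?_
    push_cast
    linear_combination -h1 + (∑ k, pderiv k (A i k) - pderiv i a) * (-hmc)
  have hXb : ∑ l, X l * b l = 0 := by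
    simp only [hb, Finset.mul_sum]
    rw [Finset.sum_comm]
    have : ∀ i, ∑ l, X l * pderiv i (B i l) = - B i i := fun i => E1 i i
    simp only [this, Finset.sum_neg_distrib, htr, neg_zero]
  have hvii : (m - 2) * β + radSq σ * a = 0 := by
    have h1 := Finset.sum_congr rfl fun l (_ : l ∈ Finset.univ) => congrArg (X l * ·) (hiii l)
    have e0 : ∑ l, X l * (-((q : MvPolynomial σ ℝ) + 2) * b l) = -((q : MvPolynomial σ ℝ) + 2) * ∑ l, X l * b l := by
      rw [Finset.mul_sum]; exact Finset.sum_congr rfl fun l _ => by ring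
    have e1 : ∑ l, X l * ((m - 2) * α l + X l * a) = (m - 2) * β + radSq σ * a := by
      simp only [hβ, radSq, Finset.mul_sum, Finset.sum_mul, ← Finset.sum_add_distrib]
      exact Finset.sum_congr rfl fun l _ => by ring
    rw [e0, e1, hXb] at h1
    linear_combination -h1
  have aHom : a.IsHomogeneous q := IsHomogeneous.sum _ _ _ fun i _ => hA i i
  have αHom : ∀ i, (α i).IsHomogeneous (q + 1) := fun i =>
    IsHomogeneous.sum _ _ _ fun j _ => by
      have := (isHomogeneous_X ℝ j).mul (hA j i)
      rwa [add_comm 1 q] at this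
  have hdivα : ∑ k, pderiv k (α k) = ((q : MvPolynomial σ ℝ) + 1) * a := by
    simp only [hα, map_sum, pderiv_mul, pderiv_X, Pi.single_apply, Finset.sum_add_distrib]
    rw [Finset.sum_comm (f := fun k j => X j * pderiv k (A j k))]
    simp only [← Finset.mul_sum, hdivA, aHom.euler]
    simp [ha]; ring
  have hviii : ∀ i, ((q : MvPolynomial σ ℝ) + 2) * ((q : MvPolynomial σ ℝ) + 3) * b i =
      pderiv i β + (2 * α i + radSq σ * pderiv i a) - (m + ((q : MvPolynomial σ ℝ) + 1)) * α i
        - (α i + X i * (((q : MvPolynomial σ ℝ) + 1) * a)) := by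
    intro i
    have h1 := Finset.sum_congr rfl fun k (_ : k ∈ Finset.univ) => congrArg (pderiv k) (hi i k)
    simp only [map_sub, map_add, pderiv_mul, dkr, dnat, d2, d3, zero_mul, zero_add, mul_zero,
      pderiv_radSq, Finset.sum_add_distrib, Finset.sum_sub_distrib, ← Finset.mul_sum, hdivA,
      hdivα, pderiv_X_self, (αHom i).euler, one_mul] at h1
    have e1 : ∑ k, pderiv k (B i k) = b i := by
      simp only [hb]; exact Finset.sum_congr rfl fun j _ => by rw [hBs]
    have e2 : ∑ k, kr i k * pderiv k β = pderiv i β := by simp [kr]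
    have e3 : ∑ k, 2 * X k * A i k = 2 * α i := by
      simp only [hα, Finset.mul_sum]; exact Finset.sum_congr rfl fun j _ => by rw [hAs]; ring
    have e4 : ∑ k, pderiv k (X i) * α k = α i := by simp [pderiv_X, Pi.single_apply]
    have e5 : ∑ k : σ, α i = m * α i := by simp [hm]
    rw [e1, e2, e3, e4, e5] at h1
    push_cast at h1
    linear_combination h1
  -- Eliminating $\nabla\beta$ through the gradient of `hvii` and $\alpha$ through `hiii` leaves an
  -- equation in $b$ and $a$ alone, with overall factor $m-3$.
  have hix : ∀ i, ((q : MvPolynomial σ ℝ) + 2) * ((q : MvPolynomial σ ℝ) + 2) * b i =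
      radSq σ * pderiv i a - (q : MvPolynomial σ ℝ) * (X i * a) := by
    intro i
    have h1 := congrArg (pderiv i) hvii
    simp only [map_add, pderiv_mul, map_sub, dm, d2, pderiv_radSq, map_zero] at h1
    refine mul_left_cancel₀ (nz (c + 1) (by omega)) ?_
    push_cast
    have h2 := hviii i
    have h3 := hiii i
    rw [hmc] at h1 h2 h3
    linear_combination ((c : MvPolynomial σ ℝ) + 2) * h2 + h1 +
      ((c : MvPolynomial σ ℝ) + (q : MvPolynomial σ ℝ) + 4) * h3
  have hx : radSq σ * laplacian a =
      ((q : MvPolynomial σ ℝ) * (m + (q : MvPolynomial σ ℝ) - 2) - ((q : MvPolynomial σ ℝ) + 2) * ((q : MvPolynomial σ ℝ) + 2) * (m - 1)) * a := by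
    have h1 := Finset.sum_congr rfl fun i (_ : i ∈ Finset.univ) => congrArg (pderiv i) (hix i)
    simp only [map_sub, map_add, pderiv_mul, dnat, d2, zero_mul, zero_add, add_zero,
      pderiv_radSq, Finset.sum_add_distrib, Finset.sum_sub_distrib, ← Finset.mul_sum, hdivb,
      pderiv_X_self, aHom.euler, one_mul, mul_assoc] at h1
    have e1 : ∑ i : σ, a = m * a := by simp [hm]
    rw [e1] at h1
    change _ = _ + radSq σ * laplacian a - _ at h1
    linear_combination -h1
  have hq0 : (0 : ℝ) ≤ q := q.cast_nonneg
  have hc0 : (0 : ℝ) ≤ c := c.cast_nonneg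
  -- The divergence of `hix` makes $a$ an eigenfunction of $|x|^2\Delta$ with negative eigenvalue.
  have ha0 : a = 0 := by
    refine eq_zero_of_radSq_mul_laplacian (by omega) q
      (q * (c + 4 + q - 2) - (q + 2) * (q + 2) * (c + 3)) a aHom ?_ (Or.inl ?_)
    · rw [hx, hmc]
      simp only [C_sub, C_mul, C_add, map_natCast, map_ofNat]
      ring
    · nlinarith [mul_nonneg hq0 hc0, mul_nonneg hq0 hq0, mul_nonneg (mul_nonneg hq0 hq0) hc0]
  have hb0 : ∀ i, b i = 0 := by
    intro i
    have h1 := hix i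
    rw [ha0] at h1
    refine mul_left_cancel₀ (nz ((q + 2) * (q + 2)) (by positivity)) ?_
    push_cast
    rw [h1]; simp
  have hα0 : ∀ i, α i = 0 := by
    intro i
    have h1 := hiii i
    rw [hb0, ha0, hmc] at h1
    refine mul_left_cancel₀ (nz (c + 2) (by omega)) ?_
    push_cast
    linear_combination -h1
  have hβ0 : β = 0 := by simp [hβ, hα0]
  -- With $a,b,\alpha,\beta$ gone, $\Delta B=(m-2)A$ and $|x|^2A=(q+2)(q+3)B$. So $B$ has eigenvalue
  -- $(m-2)(q+2)(q+3)$, above the maximum $(q+2)(q+m)$ for degree $q+2$.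
  refine eq_zero_of_radSq_mul_laplacian (by omega) (q + 2) ((c + 2) * ((q + 2) * (q + 3)))
    (B i j) (hB i j) ?_ (Or.inr ?_)
  · have h1 := hi i j
    have h2 := hiv i j
    rw [hb0, hb0, ha0, hmc] at h2
    rw [hα0, hα0, hβ0] at h1
    simp only [map_zero, mul_zero, sub_zero, zero_add] at h1 h2
    simp only [C_mul, C_add, map_natCast, map_ofNat]
    linear_combination radSq σ * h2 - ((c : MvPolynomial σ ℝ) + 2) * h1
  · rw [hc]
    push_cast
    nlinarith [mul_nonneg hq0 hc0, mul_nonneg hq0 hq0, mul_nonneg (mul_nonneg hq0 hq0) hc0]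

end MvPolynomial

/-! ### Extension from the boundary: tensors in Fermi gauge. -/

namespace MvPolynomial

/-- Restriction of a polynomial to the hyperplane where the last variable vanishes. -/
noncomputable def restrictLast (m : ℕ) :
    MvPolynomial (Fin (m + 1)) ℝ →ₐ[ℝ] MvPolynomial (Fin m) ℝ :=
  aeval (Fin.lastCases 0 X)

variable {m : ℕ}

@[simp]
theorem restrictLast_X_castSucc (a : Fin m) : restrictLast m (X a.castSucc) = X a := by
  simp [restrictLast]

@[simp]
theorem restrictLast_X_last : restrictLast m (X (Fin.last m)) = 0 := by
  simp [restrictLast]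

theorem restrictLast_pderiv (a : Fin m) (p : MvPolynomial (Fin (m + 1)) ℝ) :
    restrictLast m (pderiv a.castSucc p) = pderiv a (restrictLast m p) := by
  induction p using MvPolynomial.induction_on with
  | C r => simp [restrictLast]
  | add p q hp hq => simp [hp, hq]
  | mul_X p i hp =>
    rw [pderiv_mul, map_add, map_mul, map_mul, map_mul, pderiv_mul, hp]
    congr 2
    refine Fin.lastCases ?_ (fun b => ?_) i
    · simp [pderiv_X]
    · simp [pderiv_X, Pi.single_apply, apply_ite (restrictLast m)]

theorem restrictLast_kr (a b : Fin m) :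
    restrictLast m (kr a.castSucc b.castSucc) = kr a b := by
  simp [kr, apply_ite (restrictLast m)]

theorem IsHomogeneous.restrictLast {q : ℕ} {p : MvPolynomial (Fin (m + 1)) ℝ}
    (h : p.IsHomogeneous q) : (restrictLast m p).IsHomogeneous q := by
  have := h.aeval (R := ℝ) (φ := p) (fun i => (Fin.lastCases 0 X i : MvPolynomial (Fin m) ℝ))
    (n := 1) fun i => ?_
  · rwa [one_mul] at this
  · refine Fin.lastCases ?_ (fun b => ?_) i
    · simpa using isHomogeneous_zero _ _ _
    · simpa using isHomogeneous_X ℝ b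

theorem coeff_restrictLast (p : MvPolynomial (Fin (m + 1)) ℝ) (β : Fin m →₀ ℕ) :
    coeff β (restrictLast m p) = coeff (β.embDomain Fin.castSuccEmb) p := by
  induction p using MvPolynomial.induction_on generalizing β with
  | C r =>
    have : restrictLast m (C r) = C r := by simp [restrictLast]
    rw [this, coeff_C, coeff_C]
    congr 1
    rw [eq_iff_iff, eq_comm, eq_comm (a := (0 : Fin (m+1) →₀ ℕ)), Finsupp.embDomain_eq_zero]
  | add p q hp hq => simp [hp, hq]
  | mul_X p i hp =>
    rw [map_mul, coeff_mul_X']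
    have hl : (β.embDomain Fin.castSuccEmb) (Fin.last m) = 0 :=
      Finsupp.embDomain_of_notMem_range _ _ _ (by simp)
    have hc : ∀ b : Fin m, (β.embDomain Fin.castSuccEmb) b.castSucc = β b := fun b =>
      Finsupp.embDomain_apply_self Fin.castSuccEmb β b
    refine Fin.lastCases ?_ (fun b => ?_) i
    · simp
    · rw [restrictLast_X_castSucc, coeff_mul_X', hp]
      simp only [Finsupp.mem_support_iff, hc]
      congr 2
      ext j
      refine Fin.lastCases ?_ (fun d => ?_) j
      · rw [Finsupp.embDomain_of_notMem_range _ _ _ (by simp)]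
        simp [hl]
      · rw [show d.castSucc = Fin.castSuccEmb d from rfl, Finsupp.embDomain_apply_self]
        simp [hc, Finsupp.single_apply]

/-- Polynomials in which the last variable does not occur with exponent `j`. -/
def noLastPow (m j : ℕ) : Submodule ℝ (MvPolynomial (Fin (m + 1)) ℝ) where
  carrier := {p | ∀ α : Fin (m + 1) →₀ ℕ, α (Fin.last m) = j → coeff α p = 0}
  add_mem' hp hq α h := by rw [coeff_add, hp α h, hq α h, add_zero]
  zero_mem' α h := coeff_zero α
  smul_mem' r p hp α h := by rw [coeff_smul, hp α h, smul_zero]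

theorem mem_noLastPow_zero {p : MvPolynomial (Fin (m + 1)) ℝ} (h : restrictLast m p = 0) :
    p ∈ noLastPow m 0 := by
  intro α hα
  have h1 := coeff_restrictLast p (α.comapDomain Fin.castSucc (Fin.castSucc_injective m).injOn)
  rw [h, coeff_zero] at h1
  rw [h1]
  congr 1
  ext j
  refine Fin.lastCases ?_ (fun d => ?_) j
  · rw [Finsupp.embDomain_of_notMem_range _ _ _ (by simp), hα]
  · rw [show d.castSucc = Fin.castSuccEmb d from rfl, Finsupp.embDomain_apply_self]
    simp

theorem pderiv_mem_noLastPow {j : ℕ} (a : Fin m) {p : MvPolynomial (Fin (m + 1)) ℝ}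
    (h : p ∈ noLastPow m j) : pderiv a.castSucc p ∈ noLastPow m j := by
  intro α hα
  rw [coeff_pderiv, h _ (by simp [hα]), zero_mul]

/-- Two normal derivatives multiply the relevant coefficients by $(j+2)(j+1)\ne0$. -/
theorem mem_noLastPow_add_two {j : ℕ} {p : MvPolynomial (Fin (m + 1)) ℝ}
    (h : pderiv (Fin.last m) (pderiv (Fin.last m) p) ∈ noLastPow m j) :
    p ∈ noLastPow m (j + 2) := by
  intro α hα
  have h1 := h (α - Finsupp.single (Fin.last m) 2) (by simp [hα])
  rw [coeff_pderiv, coeff_pderiv, add_assoc, ← Finsupp.single_add,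
    tsub_add_cancel_of_le (by simp [hα])] at h1
  simp only [Finsupp.coe_add, Pi.add_apply, Finsupp.coe_tsub, Pi.sub_apply,
    Finsupp.single_eq_same, hα] at h1
  have h2 : (((j + 2 - 2 + 1 : ℕ) : ℝ) + 1) ≠ 0 := by positivity
  have h3 : (((j + 2 - 2 : ℕ) : ℝ) + 1) ≠ 0 := by positivity
  exact (mul_eq_zero.1 ((mul_eq_zero.1 h1).resolve_right h3)).resolve_right h2

theorem eq_zero_of_forall_mem_noLastPow {p : MvPolynomial (Fin (m + 1)) ℝ}
    (h : ∀ j, p ∈ noLastPow m j) : p = 0 := by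
  ext α
  rw [h _ α rfl, coeff_zero]

/-- A homogeneous trace-free symmetric tensor field in Fermi gauge over a totally geodesic
boundary in normal gauge vanishes if its linearised curvature is pure trace. -/
theorem eq_zero_of_fermi_of_isHomogeneous (hm : 4 ≤ m) (q : ℕ)
    (H A : Fin (m + 1) → Fin (m + 1) → MvPolynomial (Fin (m + 1)) ℝ)
    (hH : ∀ i j, (H i j).IsHomogeneous (q + 2)) (hA : ∀ i j, (A i j).IsHomogeneous q)
    (hHs : ∀ i j, H i j = H j i) (hAs : ∀ i j, A i j = A j i)
    (hn : ∀ i, H i (Fin.last m) = 0) (htr : ∑ i, H i i = 0)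
    (h1 : ∀ i j, H i j ∈ noLastPow m 1)
    (hX : ∀ a : Fin m, ∑ b : Fin m, X b * restrictLast m (H a.castSucc b.castSucc) = 0)
    (hR : ∀ i j k l, pderiv i (pderiv k (H j l)) + pderiv j (pderiv l (H i k))
      - pderiv j (pderiv k (H i l)) - pderiv i (pderiv l (H j k)) =
      kr i k * A j l + kr j l * A i k - kr j k * A i l - kr i l * A j k) (i j : Fin (m + 1)) :
    H i j = 0 := by
  have hn' : ∀ i, H (Fin.last m) i = 0 := fun i => by rw [hHs, hn]
  have htr' : ∑ a : Fin m, H a.castSucc a.castSucc = 0 := by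
    rw [Fin.sum_univ_castSucc, hn, add_zero] at htr; exact htr
  have hB : ∀ a b : Fin m, restrictLast m (H a.castSucc b.castSucc) = 0 := by
    refine eq_zero_of_linearised_curvature_pure_trace (by simpa using hm) q
      (fun a b => restrictLast m (H a.castSucc b.castSucc))
      (fun a b => restrictLast m (A a.castSucc b.castSucc))
      (fun a b => (hH _ _).restrictLast) (fun a b => (hA _ _).restrictLast)
      (fun a b => by rw [hHs]) (fun a b => by rw [hAs]) ?_ hX ?_
    · rw [← map_sum, htr', map_zero]
    · intro a b c d
      have := congrArg (restrictLast m) (hR a.castSucc b.castSucc c.castSucc d.castSucc)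
      simpa only [map_add, map_sub, map_mul, restrictLast_pderiv, restrictLast_kr] using this
  set L : Fin m → Fin m → MvPolynomial (Fin (m + 1)) ℝ := fun a b =>
    ∑ c : Fin m, pderiv c.castSucc (pderiv c.castSucc (H a.castSucc b.castSucc))
    - ∑ c : Fin m, pderiv c.castSucc (pderiv b.castSucc (H a.castSucc c.castSucc))
    - ∑ c : Fin m, pderiv a.castSucc (pderiv c.castSucc (H c.castSucc b.castSucc)) with hL
  set N := A (Fin.last m) (Fin.last m) with hN
  set D : Fin m → Fin m → MvPolynomial (Fin (m + 1)) ℝ := fun a b =>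
    pderiv (Fin.last m) (pderiv (Fin.last m) (H a.castSucc b.castSucc)) with hD
  have krl : ∀ a : Fin m, kr a.castSucc (Fin.last m) = 0 := fun a => by
    simp [kr, Fin.castSucc_ne_last]
  have krl' : ∀ a : Fin m, kr (Fin.last m) a.castSucc = 0 := fun a => by
    rw [kr_comm, krl]
  have krs : ∀ a b : Fin m, kr a.castSucc b.castSucc = if a = b then 1 else 0 := fun a b => by
    simp [kr]
  -- The components $R_{anbn}$: in Fermi gauge only $\partial_n^2H_{ab}$ survives on the left.
  have e1 : ∀ a b : Fin m, D a b = (if a = b then N else 0) + A a.castSucc b.castSucc := by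
    intro a b
    have := hR a.castSucc (Fin.last m) b.castSucc (Fin.last m)
    have h1 : kr (Fin.last m) (Fin.last m) = 1 := if_pos rfl
    rw [hn, hn, hn', krl, krl', krs, h1] at this
    simp only [map_zero, ite_mul, one_mul, zero_mul, sub_zero, zero_add] at this
    exact this
  have trD : ∑ a, D a a = 0 := by
    simp only [hD, ← map_sum, htr', map_zero]
  have trA : ∑ a : Fin m, A a.castSucc a.castSucc = - m * N := by
    have := trD
    simp only [e1, Finset.sum_add_distrib] at this
    simp at this
    linear_combination this
  have e2 : ∀ a b : Fin m, L a b =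
      (if a = b then - m * N else 0) + (m - 2) * A a.castSucc b.castSucc := by
    intro a b
    have := Finset.sum_congr rfl fun c (_ : c ∈ Finset.univ) =>
      hR a.castSucc (Fin.castSucc c) b.castSucc c.castSucc
    simp only [Finset.sum_add_distrib, Finset.sum_sub_distrib, ← Finset.mul_sum, trA, krs] at this
    have e0 : ∑ c : Fin m, pderiv a.castSucc (pderiv b.castSucc (H c.castSucc c.castSucc)) = 0 := by
      simp only [← map_sum, htr', map_zero]
    rw [e0] at this
    simp at this
    simp only [hL]
    rw [this]
    split_ifs <;> ring
  -- Eliminating $A_{ab}$ between the normal components and the tangential Ricci contraction, and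
  -- then $N$ by a trace in `e4`, writes $\partial_n^2H_{ab}$ in terms of tangential second
  -- derivatives only.
  have e3 : ∀ a b : Fin m, ((m : MvPolynomial (Fin (m + 1)) ℝ) - 2) * D a b =
      L a b + (2 * m - 2) * (if a = b then N else 0) := by
    intro a b
    rw [e1, e2]
    split_ifs <;> ring
  have e4 : (2 * (m : MvPolynomial (Fin (m + 1)) ℝ) - 2) * m * N = - ∑ a, L a a := by
    have := Finset.sum_congr rfl fun a (_ : a ∈ Finset.univ) => e3 a a
    simp only [Finset.sum_add_distrib, ← Finset.mul_sum, trD] at this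
    simp at this
    linear_combination -this
  have cancel : ∀ (r : ℝ) (p : MvPolynomial (Fin (m + 1)) ℝ) (j : ℕ), r ≠ 0 →
      C r * p ∈ noLastPow m j → p ∈ noLastPow m j := by
    intro r p j hr h
    have := (noLastPow m j).smul_mem r⁻¹ h
    rwa [C_mul', smul_smul, inv_mul_cancel₀ hr, one_smul] at this
  have hm' : (4 : ℝ) ≤ m := by exact_mod_cast hm
  -- Tangential derivatives preserve the power of $x_n$, so absence of $x_n^j$ forces absence of
  -- $x_n^{j+2}$. The induction carries two consecutive powers; it starts from the boundary values
  -- ($j=0$) and the totally geodesic condition ($j=1$).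
  have all : ∀ j, (∀ a b : Fin m, H a.castSucc b.castSucc ∈ noLastPow m j) ∧
      ∀ a b : Fin m, H a.castSucc b.castSucc ∈ noLastPow m (j + 1) := by
    intro j
    induction j with
    | zero => exact ⟨fun a b => mem_noLastPow_zero (hB a b), fun a b => h1 _ _⟩
    | succ j ih =>
      refine ⟨ih.2, fun a b => mem_noLastPow_add_two ?_⟩
      have hLj : ∀ a b, L a b ∈ noLastPow m j := fun a b =>
        Submodule.sub_mem _ (Submodule.sub_mem _
          (Submodule.sum_mem _ fun c _ => pderiv_mem_noLastPow _ (pderiv_mem_noLastPow _ (ih.1 _ _)))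
          (Submodule.sum_mem _ fun c _ => pderiv_mem_noLastPow _ (pderiv_mem_noLastPow _ (ih.1 _ _))))
          (Submodule.sum_mem _ fun c _ => pderiv_mem_noLastPow _ (pderiv_mem_noLastPow _ (ih.1 _ _)))
      have hNj : N ∈ noLastPow m j := by
        refine cancel ((2 * (m : ℝ) - 2) * m) _ _ (by nlinarith) ?_
        have : C ((2 * (m : ℝ) - 2) * m) * N = - ∑ a, L a a := by
          rw [← e4]; simp only [C_mul, C_sub, map_natCast, map_ofNat]
        rw [this]
        exact Submodule.neg_mem _ (Submodule.sum_mem _ fun c _ => hLj _ _)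
      refine cancel (m - 2) _ _ (by linarith) ?_
      have : C ((m : ℝ) - 2) * D a b = L a b + (2 * (m : ℝ) - 2) • (if a = b then N else 0) := by
        rw [← C_mul']
        simp only [C_mul, C_sub, map_natCast, map_ofNat]
        exact e3 a b
      rw [this]
      refine Submodule.add_mem _ (hLj _ _) (Submodule.smul_mem _ _ ?_)
      split_ifs
      · exact hNj
      · exact Submodule.zero_mem _
  refine Fin.lastCases (hn' j) (fun a => ?_) i
  refine Fin.lastCases (hn _) (fun b => ?_) j
  exact eq_zero_of_forall_mem_noLastPow fun k => (all k).1 a b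

theorem homogeneousComponent_pderiv {σ : Type*} [DecidableEq σ] (k : ℕ) (i : σ)
    (p : MvPolynomial σ ℝ) :
    homogeneousComponent k (pderiv i p) = pderiv i (homogeneousComponent (k + 1) p) := by
  ext α
  simp only [coeff_homogeneousComponent, coeff_pderiv]
  have : (α + Finsupp.single i 1).degree = α.degree + 1 := by simp
  rw [this]
  simp only [add_left_inj]
  split_ifs <;> simp

theorem homogeneousComponent_kr_mul {σ : Type*} [DecidableEq σ] (k : ℕ) (i j : σ)
    (p : MvPolynomial σ ℝ) :
    homogeneousComponent k (kr i j * p) = kr i j * homogeneousComponent k p := by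
  unfold kr; split_ifs <;> simp

/-- A trace-free symmetric polynomial tensor field without terms of degree less than two, in
Fermi gauge over a totally geodesic boundary in normal gauge, vanishes if its linearised
curvature is pure trace. -/
theorem eq_zero_of_fermi (hm : 4 ≤ m)
    (H A : Fin (m + 1) → Fin (m + 1) → MvPolynomial (Fin (m + 1)) ℝ)
    (hH : ∀ i j (α : Fin (m + 1) →₀ ℕ), α.degree < 2 → coeff α (H i j) = 0)
    (hHs : ∀ i j, H i j = H j i) (hAs : ∀ i j, A i j = A j i)
    (hn : ∀ i, H i (Fin.last m) = 0) (htr : ∑ i, H i i = 0)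
    (h1 : ∀ i j, H i j ∈ noLastPow m 1)
    (hX : ∀ (k : ℕ) (a : Fin m), ∑ b : Fin m,
      X b * restrictLast m (homogeneousComponent k (H a.castSucc b.castSucc)) = 0)
    (hR : ∀ i j k l, pderiv i (pderiv k (H j l)) + pderiv j (pderiv l (H i k))
      - pderiv j (pderiv k (H i l)) - pderiv i (pderiv l (H j k)) =
      kr i k * A j l + kr j l * A i k - kr j k * A i l - kr i l * A j k) (i j : Fin (m + 1)) :
    H i j = 0 := by
  -- All conditions are graded, the curvature equation lowering degree by two, so each homogeneous
  -- component is treated alone.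
  have key : ∀ q i j, homogeneousComponent (q + 2) (H i j) = 0 := by
    intro q
    refine eq_zero_of_fermi_of_isHomogeneous hm q _ (fun i j => homogeneousComponent q (A i j))
      (fun i j => homogeneousComponent_isHomogeneous _ _)
      (fun i j => homogeneousComponent_isHomogeneous _ _) (fun i j => by rw [hHs])
      (fun i j => by rw [hAs]) (fun i => by rw [hn, map_zero])
      (by rw [← map_sum, htr, map_zero]) ?_ (hX _) ?_
    · intro i j α hα
      rw [coeff_homogeneousComponent, h1 i j α hα, ite_self]
    · intro i j k l
      have := congrArg (homogeneousComponent q) (hR i j k l)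
      simpa only [map_add, map_sub, homogeneousComponent_pderiv, homogeneousComponent_kr_mul]
        using this
  ext α
  rw [coeff_zero]
  by_cases h : α.degree < 2
  · exact hH i j α h
  · have := congrArg (coeff α) (key (α.degree - 2) i j)
    rw [coeff_homogeneousComponent, if_pos (by omega)] at this
    simpa using this

end MvPolynomial

/-! ### Calculus on the closed half space. -/

namespace HalfSpace

variable {n : ℕ} [NeZero n]

/-- Smoothness up to the boundary at a point of the half space. -/
abbrev SmoothAt (f : E n → ℝ) (x : E n) : Prop := ContDiffWithinAt ℝ ∞ f (half n) x

/-- The open half space. -/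
def openHalf (n : ℕ) [NeZero n] : Set (E n) := {x | 0 < x (nrm n)}

theorem isOpen_openHalf : IsOpen (openHalf n) :=
  isOpen_lt continuous_const (by fun_prop)

theorem openHalf_subset_half : openHalf n ⊆ half n := fun x (hx : 0 < x (nrm n)) => hx.le

theorem isClosed_half : IsClosed (half n) := isClosed_le continuous_const (by fun_prop)

theorem convex_half : Convex ℝ (half n) := by
  intro x hx y hy a b ha hb _
  have hx' : 0 ≤ x (nrm n) := hx
  have hy' : 0 ≤ y (nrm n) := hy
  change 0 ≤ (a • x + b • y) (nrm n)
  simp only [PiLp.add_apply, PiLp.smul_apply, smul_eq_mul]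
  positivity

theorem openHalf_subset_interior : openHalf n ⊆ interior (half n) :=
  interior_maximal openHalf_subset_half isOpen_openHalf

theorem interior_half_nonempty : (interior (half n)).Nonempty :=
  ⟨EuclideanSpace.single (nrm n) 1, openHalf_subset_interior (by simp [openHalf])⟩

theorem uniqueDiffOn_half : UniqueDiffOn ℝ (half n) :=
  uniqueDiffOn_convex convex_half interior_half_nonempty

theorem half_subset_closure_interior : half n ⊆ closure (interior (half n)) := by
  rw [convex_half.closure_interior_eq_closure_of_nonempty_interior interior_half_nonempty]
  exact subset_closure

theorem zero_mem_half : (0 : E n) ∈ half n := by simp [half]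

theorem half_mem_nhds {x : E n} (hx : x ∈ openHalf n) : half n ∈ 𝓝 x :=
  Filter.mem_of_superset (isOpen_openHalf.mem_nhds hx) openHalf_subset_half

section calculus

variable {f g : E n → ℝ} {x : E n} {i : Fin n}

theorem SmoothAt.differentiable (hf : SmoothAt f x) : DifferentiableWithinAt ℝ f (half n) x :=
  ContDiffWithinAt.differentiableWithinAt hf (by simp)

theorem pd_eq_fderiv (hx : x ∈ openHalf n) (f : E n → ℝ) :
    pd i f x = fderiv ℝ f x (EuclideanSpace.single i 1) := by
  rw [pd, fderivWithin_of_mem_nhds (half_mem_nhds hx)]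

theorem SmoothAt.pd (hf : SmoothAt f x) (hx : x ∈ half n) : SmoothAt (pd i f) x :=
  ContDiffWithinAt.fderivWithin_right_apply hf contDiffWithinAt_const uniqueDiffOn_half
    (by simp) hx

theorem pd_congr (h : f =ᶠ[𝓝[half n] x] g) (hx : x ∈ half n) : pd i f x = pd i g x := by
  rw [pd, pd, h.fderivWithin_eq (h.self_of_nhdsWithin hx)]

theorem pd_add (hf : SmoothAt f x) (hg : SmoothAt g x) (hx : x ∈ half n) :
    pd i (fun y => f y + g y) x = pd i f x + pd i g x := by
  rw [pd, fderivWithin_fun_add (uniqueDiffOn_half x hx) hf.differentiable hg.differentiable]; rfl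

theorem pd_sub (hf : SmoothAt f x) (hg : SmoothAt g x) (hx : x ∈ half n) :
    pd i (fun y => f y - g y) x = pd i f x - pd i g x := by
  rw [pd, fderivWithin_fun_sub (uniqueDiffOn_half x hx) hf.differentiable hg.differentiable]; rfl

theorem pd_mul (hf : SmoothAt f x) (hg : SmoothAt g x) (hx : x ∈ half n) :
    pd i (fun y => f y * g y) x = f x * pd i g x + g x * pd i f x := by
  rw [pd, fderivWithin_fun_mul (uniqueDiffOn_half x hx) hf.differentiable hg.differentiable]; rfl

@[simp]
theorem pd_const (c : ℝ) : pd i (fun _ => c) x = 0 := by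
  simp [pd]

theorem pd_const_mul (c : ℝ) (hf : SmoothAt f x) (hx : x ∈ half n) :
    pd i (fun y => c * f y) x = c * pd i f x := by
  rw [pd_mul contDiffWithinAt_const hf hx, pd_const]; ring

theorem pd_mul_const (c : ℝ) (hf : SmoothAt f x) (hx : x ∈ half n) :
    pd i (fun y => f y * c) x = pd i f x * c := by
  rw [pd_mul hf contDiffWithinAt_const hx, pd_const]; ring

theorem SmoothAt.fun_sum {ι : Type*} {s : Finset ι} {F : ι → E n → ℝ}
    (h : ∀ j ∈ s, SmoothAt (F j) x) : SmoothAt (fun y => ∑ j ∈ s, F j y) x :=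
  ContDiffWithinAt.sum h

theorem pd_sum {ι : Type*} {s : Finset ι} {F : ι → E n → ℝ} (h : ∀ j ∈ s, SmoothAt (F j) x)
    (hx : x ∈ half n) : pd i (fun y => ∑ j ∈ s, F j y) x = ∑ j ∈ s, pd i (F j) x := by
  rw [pd, fderivWithin_fun_sum (uniqueDiffOn_half x hx) fun j hj => (h j hj).differentiable]
  simp [pd]

/-- Symmetry of second derivatives holds up to the boundary because the half space lies in the
closure of its interior. -/
theorem pd_comm (hf : SmoothAt f x) (hx : x ∈ half n) (i j : Fin n) :
    pd i (pd j f) x = pd j (pd i f) x := by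
  have hs := ContDiffWithinAt.isSymmSndFDerivWithinAt hf (by simpa using ENat.LEInfty.out) uniqueDiffOn_half
    (half_subset_closure_interior hx) hx
  have hd : DifferentiableWithinAt ℝ (fderivWithin ℝ f (half n)) (half n) x :=
    (ContDiffWithinAt.fderivWithin_right hf uniqueDiffOn_half (m := ∞) (by simp)
      hx).differentiableWithinAt (by simp)
  have key : ∀ i j, pd i (pd j f) x = fderivWithin ℝ (fderivWithin ℝ f (half n)) (half n) x
      (EuclideanSpace.single i 1) (EuclideanSpace.single j 1) := by
    intro i j
    rw [pd]
    unfold pd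
    rw [fderivWithin_clm_apply (uniqueDiffOn_half x hx) hd (by fun_prop)]
    simp
  rw [key, key, hs]

theorem smoothAt_coord (j : Fin n) : SmoothAt (fun y => y j) x :=
  ContDiff.contDiffWithinAt (by fun_prop)

theorem pd_coord (j : Fin n) (hx : x ∈ half n) : pd i (fun y => y j) x = kron j i := by
  have : HasFDerivWithinAt (fun y : E n => y j) (EuclideanSpace.proj j : E n →L[ℝ] ℝ) (half n) x :=
    (EuclideanSpace.proj j : E n →L[ℝ] ℝ).hasFDerivWithinAt
  rw [pd, this.fderivWithin (uniqueDiffOn_half x hx)]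
  simp [kron]

open MvPolynomial in
theorem contDiff_eval {n : ℕ} (p : MvPolynomial (Fin n) ℝ) :
    ContDiff ℝ ∞ fun y : E n => eval (fun j => y j) p := by
  induction p using MvPolynomial.induction_on with
  | C r => simpa using contDiff_const
  | add p q hp hq => simpa using hp.add hq
  | mul_X p j hp =>
    simp only [map_mul, eval_X]
    exact hp.mul (by fun_prop)

open MvPolynomial in
theorem pd_eval (p : MvPolynomial (Fin n) ℝ) (hx : x ∈ half n) :
    pd i (fun y : E n => eval (fun j => y j) p) x = eval (fun j => x j) (pderiv i p) := by
  induction p using MvPolynomial.induction_on with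
  | C r => simp
  | add p q hp hq =>
    simp only [map_add]
    rw [pd_add (contDiff_eval p).contDiffWithinAt (contDiff_eval q).contDiffWithinAt hx, hp, hq]
  | mul_X p j hp =>
    simp only [map_mul, eval_X, pderiv_mul, map_add]
    rw [pd_mul (contDiff_eval p).contDiffWithinAt (smoothAt_coord j) hx, hp, pd_coord j hx]
    simp [pderiv_X, kron, Pi.single_apply, apply_ite (eval _), eq_comm]
    ring

end calculus

end HalfSpace

/-! ### Derivative chains along rays, and jets at the boundary. -/

namespace HalfSpace

section line

/-- All derivatives vanish in the open interval, hence at its endpoint by one-sided continuity. -/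
theorem hasDerivWithinAt_chain_eq_zero {F : ℕ → ℝ → ℝ} {τ : ℝ} (hτ : 0 < τ)
    (hF : ∀ k, ∀ t ∈ Set.Icc 0 τ, HasDerivWithinAt (F k) (F (k + 1) t) (Set.Icc 0 τ) t)
    (h0 : ∀ t ∈ Set.Ioo 0 τ, F 0 t = 0) (k : ℕ) : F k 0 = 0 := by
  have key : ∀ k, ∀ t ∈ Set.Ioo 0 τ, F k t = 0 := by
    intro k
    induction k with
    | zero => exact h0
    | succ k ih =>
      intro t ht
      have h1 : HasDerivAt (F k) (F (k + 1) t) t :=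
        (hF k t (Set.Ioo_subset_Icc_self ht)).hasDerivAt (Icc_mem_nhds ht.1 ht.2)
      have h2 : F k =ᶠ[𝓝 t] fun _ => 0 := by
        filter_upwards [isOpen_Ioo.mem_nhds ht] with s hs using ih s hs
      exact h1.unique ((hasDerivAt_const t (0 : ℝ)).congr_of_eventuallyEq h2)
  have hc : ContinuousWithinAt (F k) (Set.Icc 0 τ) 0 :=
    (hF k 0 (Set.left_mem_Icc.2 hτ.le)).continuousWithinAt
  have h1 : Filter.Tendsto (F k) (𝓝[Set.Ioo 0 τ] 0) (𝓝 (F k 0)) :=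
    hc.mono_left (nhdsWithin_mono _ Set.Ioo_subset_Icc_self)
  have h2 : Filter.Tendsto (F k) (𝓝[Set.Ioo 0 τ] 0) (𝓝 0) := by
    refine tendsto_const_nhds.congr' ?_
    filter_upwards [self_mem_nhdsWithin] with t ht using (key k t ht).symm
  have : (𝓝[Set.Ioo 0 τ] (0 : ℝ)).NeBot := by
    rw [← mem_closure_iff_nhdsWithin_neBot, closure_Ioo hτ.ne]
    exact Set.left_mem_Icc.2 hτ.le
  exact tendsto_nhds_unique h1 h2

theorem hasDerivWithinAt_chain_eq_zero_of_le {F : ℕ → ℝ → ℝ} {τ K : ℝ} (hτ : 0 < τ)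
    (hF : ∀ k, ∀ t ∈ Set.Icc 0 τ, HasDerivWithinAt (F k) (F (k + 1) t) (Set.Icc 0 τ) t)
    {m : ℕ} (h0 : ∀ t ∈ Set.Icc 0 τ, |F 0 t| ≤ K * t ^ (m + 1)) (k : ℕ) (hk : k ≤ m) :
    F k 0 = 0 := by
  have hcont : ∀ k, ContinuousOn (F k) (Set.Icc 0 τ) := fun k t ht =>
    (hF k t ht).continuousWithinAt
  have mvt : ∀ (G G' : ℝ → ℝ) (B t : ℝ), t ∈ Set.Icc 0 τ →
      (∀ s ∈ Set.Icc 0 τ, HasDerivWithinAt G (G' s) (Set.Icc 0 τ) s) →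
      (∀ s ∈ Set.Icc 0 t, ‖G' s‖ ≤ B) → |G t - G 0| ≤ B * t := by
    intro G G' B t ht hG hB
    have := norm_image_sub_le_of_norm_deriv_le_segment' (f := G) (f' := G') (a := 0) (b := t)
      (C := B) (fun s hs => (hG s ⟨hs.1, hs.2.trans ht.2⟩).mono (Set.Icc_subset_Icc_right ht.2))
      (fun s hs => hB s ⟨hs.1, hs.2.le⟩) t ⟨ht.1, le_rfl⟩
    simpa using this
  induction k using Nat.strong_induction_on with
  | _ k ih =>
    have ih' : ∀ j < k, F j 0 = 0 := fun j hj => ih j hj (by omega)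
    obtain ⟨M, hM⟩ := isCompact_Icc.exists_bound_of_continuousOn (hcont (k + 1))
    have hM0 : 0 ≤ M := (norm_nonneg _).trans (hM 0 (Set.left_mem_Icc.2 hτ.le))
    -- A Taylor expansion with remainder, built by applying the mean value inequality from the
    -- $k$-th derivative down to $F_0$. The lower derivatives at $0$ vanish by induction, so only
    -- the term $F_k(0)t^j/j!$ appears.
    have P : ∀ j ≤ k, ∀ t ∈ Set.Icc 0 τ,
        |F (k - j) t - F k 0 * t ^ j / j.factorial| ≤ M * t ^ (j + 1) := by
      intro j
      induction j with
      | zero =>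
        intro _ t ht
        simpa using mvt (F k) (F (k + 1)) M t ht (hF k)
          fun s hs => hM s ⟨hs.1, hs.2.trans ht.2⟩
      | succ j ihj =>
        intro hj t ht
        have hG : ∀ s ∈ Set.Icc 0 τ, HasDerivWithinAt
            (fun s => F (k - (j + 1)) s - F k 0 * s ^ (j + 1) / (j + 1).factorial)
            (F (k - j) s - F k 0 * s ^ j / j.factorial) (Set.Icc 0 τ) s := by
          intro s hs
          have h1 := hF (k - (j + 1)) s hs
          rw [show k - (j + 1) + 1 = k - j by omega] at h1
          have h2 := (((hasDerivAt_pow (j + 1) s).const_mul (F k 0)).div_const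
            ((j + 1).factorial : ℝ)).hasDerivWithinAt (s := Set.Icc 0 τ)
          convert! h1.sub h2 using 2
          rw [Nat.factorial_succ]
          push_cast
          field_simp
        have h3 := mvt _ _ (M * t ^ (j + 1)) t ht hG fun s hs => by
          refine (ihj (by omega) s ⟨hs.1, hs.2.trans ht.2⟩).trans ?_
          have := pow_le_pow_left₀ hs.1 hs.2 (j + 1)
          gcongr
        simp only [ih' (k - (j + 1)) (by omega), zero_pow (Nat.succ_ne_zero j), mul_zero,
          zero_div, sub_zero] at h3
        rwa [mul_assoc, ← pow_succ] at h3
    have hfac : (0 : ℝ) < k.factorial := by exact_mod_cast k.factorial_pos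
    set L := M + |K| * τ ^ (m - k) with hL
    have hL0 : 0 ≤ L := by positivity
    have bound : ∀ t ∈ Set.Ioc 0 τ, |F k 0| / k.factorial ≤ L * t := by
      intro t ht
      have ht' : t ∈ Set.Icc 0 τ := Set.Ioc_subset_Icc_self ht
      have h1 := P k le_rfl t ht'
      rw [Nat.sub_self] at h1
      have h2 := h0 t ht'
      have h3 : K * t ^ (m + 1) ≤ |K| * τ ^ (m - k) * t ^ (k + 1) := by
        calc K * t ^ (m + 1) ≤ |K| * t ^ (m + 1) := by
              gcongr
              · exact pow_nonneg ht'.1 _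
              · exact le_abs_self K
          _ = |K| * t ^ (m - k) * t ^ (k + 1) := by
              rw [mul_assoc, ← pow_add]; congr 2; omega
          _ ≤ _ := by
              have := pow_le_pow_left₀ ht'.1 ht'.2 (m - k)
              have := pow_nonneg ht'.1 (k + 1)
              gcongr
      have h4 : |F k 0 * t ^ k / k.factorial| ≤ L * t ^ (k + 1) := by
        have h5 := abs_sub_abs_le_abs_sub (F k 0 * t ^ k / k.factorial) (F 0 t)
        rw [abs_sub_comm] at h5
        rw [hL, add_mul]
        linarith
      rw [abs_div, abs_mul, abs_of_pos (pow_pos ht.1 k), abs_of_pos hfac] at h4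
      have h5 : |F k 0| / k.factorial * t ^ k ≤ L * t * t ^ k := by
        calc _ = |F k 0| * t ^ k / k.factorial := by ring
          _ ≤ _ := h4
          _ = _ := by ring
      exact le_of_mul_le_mul_right h5 (pow_pos ht.1 k)
    by_contra hne
    have hpos : 0 < |F k 0| / k.factorial := div_pos (abs_pos.2 hne) hfac
    set c := |F k 0| / k.factorial
    -- The inequality $c\le Lt$ for all small $t>0$ fails at this $t$, where $Lt\le c/2$.
    have h1 := bound (min τ (c / (2 * (L + 1)))) ⟨by positivity, min_le_left _ _⟩
    have h2 : L * min τ (c / (2 * (L + 1))) ≤ L * (c / (2 * (L + 1))) := by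
      gcongr; exact min_le_right _ _
    have h3 : L * (c / (2 * (L + 1))) ≤ c / 2 := by
      rw [mul_div_assoc', div_le_div_iff₀ (by positivity) (by positivity)]
      nlinarith
    linarith

end line

section jet

variable {n : ℕ} [NeZero n] {f g : E n → ℝ} {ρ : ℝ}

theorem smoothAt_of_contDiffOn {x : E n} (hf : ContDiffOn ℝ ∞ f (half n ∩ Metric.ball 0 ρ))
    (hx : x ∈ half n ∩ Metric.ball 0 ρ) : SmoothAt f x :=
  (contDiffWithinAt_inter (Metric.isOpen_ball.mem_nhds hx.2)).1 (hf x hx)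

theorem eventuallyEq_of_eqOn {x : E n} (h : Set.EqOn f g (half n ∩ Metric.ball 0 ρ))
    (hx : x ∈ half n ∩ Metric.ball 0 ρ) : f =ᶠ[𝓝[half n] x] g := by
  filter_upwards [self_mem_nhdsWithin, mem_nhdsWithin_of_mem_nhds
    (Metric.isOpen_ball.mem_nhds hx.2)] with y hy hy' using h ⟨hy, hy'⟩

theorem eqOn_pd (h : Set.EqOn f g (half n ∩ Metric.ball 0 ρ)) (i : Fin n) :
    Set.EqOn (pd i f) (pd i g) (half n ∩ Metric.ball 0 ρ) := fun _ hx =>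
  pd_congr (eventuallyEq_of_eqOn h hx) hx.1

theorem eqOn_iterate_pd (h : Set.EqOn f g (half n ∩ Metric.ball 0 ρ)) (i : Fin n) (k : ℕ) :
    Set.EqOn ((pd i)^[k] f) ((pd i)^[k] g) (half n ∩ Metric.ball 0 ρ) := by
  induction k with
  | zero => exact h
  | succ k ih =>
    rw [Function.iterate_succ_apply', Function.iterate_succ_apply']
    exact eqOn_pd ih i

/-- The partial derivatives of multiplicities `α`, taken along a list of indices. -/
noncomputable def listPd (l : List (Fin n)) (α : Fin n → ℕ) (f : E n → ℝ) : E n → ℝ :=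
  l.foldr (fun i φ => (pd i)^[α i] φ) f

theorem eqOn_listPd (h : Set.EqOn f g (half n ∩ Metric.ball 0 ρ)) (l : List (Fin n))
    (α : Fin n → ℕ) :
    Set.EqOn (listPd l α f) (listPd l α g) (half n ∩ Metric.ball 0 ρ) := by
  induction l with
  | nil => exact h
  | cons i l ih => exact eqOn_iterate_pd ih i _

theorem smoothAt_iterate_pd (h : ∀ x ∈ half n ∩ Metric.ball 0 ρ, SmoothAt f x) (i : Fin n)
    (k : ℕ) : ∀ x ∈ half n ∩ Metric.ball 0 ρ, SmoothAt ((pd i)^[k] f) x := by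
  induction k with
  | zero => exact h
  | succ k ih =>
    rw [Function.iterate_succ_apply']
    exact fun x hx => (ih x hx).pd hx.1

theorem smoothAt_listPd (h : ∀ x ∈ half n ∩ Metric.ball 0 ρ, SmoothAt f x) (l : List (Fin n))
    (α : Fin n → ℕ) : ∀ x ∈ half n ∩ Metric.ball 0 ρ, SmoothAt (listPd l α f) x := by
  induction l with
  | nil => exact h
  | cons i l ih => exact smoothAt_iterate_pd ih i _

theorem iterate_pd_zero (i : Fin n) (k : ℕ) : (pd i)^[k] (fun _ : E n => (0 : ℝ)) = fun _ => 0 := by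
  induction k with
  | zero => rfl
  | succ k ih => rw [Function.iterate_succ_apply', ih]; funext x; simp

theorem listPd_zero (l : List (Fin n)) (α : Fin n → ℕ) :
    listPd l α (fun _ : E n => (0 : ℝ)) = fun _ => 0 := by
  induction l with
  | nil => rfl
  | cons i l ih =>
    change (pd i)^[α i] (listPd l α fun _ => 0) = _
    rw [ih, iterate_pd_zero]

theorem eqOn_iterate_pd_pd (h : ∀ x ∈ half n ∩ Metric.ball 0 ρ, SmoothAt f x) (i j : Fin n)
    (k : ℕ) : Set.EqOn ((pd j)^[k] (pd i f)) (pd i ((pd j)^[k] f)) (half n ∩ Metric.ball 0 ρ) := by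
  induction k with
  | zero => exact fun _ _ => rfl
  | succ k ih =>
    rw [Function.iterate_succ_apply', Function.iterate_succ_apply']
    exact (eqOn_pd ih j).trans fun x hx => pd_comm (smoothAt_iterate_pd h j k x hx) hx.1 j i

theorem listPd_congr {l : List (Fin n)} {α β : Fin n → ℕ} (h : ∀ i ∈ l, α i = β i) :
    listPd l α f = listPd l β f := by
  induction l with
  | nil => rfl
  | cons j l ih =>
    change (pd j)^[α j] (listPd l α f) = (pd j)^[β j] (listPd l β f)
    rw [ih fun i hi => h i (List.mem_cons_of_mem _ hi), h j List.mem_cons_self]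

/-- The extra $\partial_i$ enters at the place of $i$ in the prescribed order and is then commuted
to the front. -/
theorem listPd_add_single (h : ∀ x ∈ half n ∩ Metric.ball 0 ρ, SmoothAt f x)
    (α : Fin n → ℕ) (i : Fin n) (l : List (Fin n)) (hl : l.Nodup) (hi : i ∈ l) :
    Set.EqOn (listPd l (α + Pi.single i 1) f) (pd i (listPd l α f))
      (half n ∩ Metric.ball 0 ρ) := by
  induction l with
  | nil => simp at hi
  | cons j l ih =>
    rw [List.nodup_cons] at hl
    change Set.EqOn ((pd j)^[(α + Pi.single i 1 : Fin n → ℕ) j] (listPd l (α + Pi.single i 1) f))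
      (pd i ((pd j)^[α j] (listPd l α f))) _
    by_cases hij : j = i
    · subst hij
      rw [listPd_congr (β := α) fun k hk => by
        have : k ≠ j := fun e => hl.1 (e ▸ hk)
        simp [this]]
      simp only [Pi.add_apply, Pi.single_eq_same, Function.iterate_succ_apply']
      exact fun _ _ => rfl
    · have hil : i ∈ l := (List.mem_cons.1 hi).resolve_left (Ne.symm hij)
      simp only [Pi.add_apply, Pi.single_eq_of_ne hij, add_zero]
      exact (eqOn_iterate_pd (ih hl.2 hil) j _).trans
        (eqOn_iterate_pd_pd (smoothAt_listPd h l α) i j _)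

theorem multiPd_eq_listPd (α : Fin n → ℕ) (f : E n → ℝ) :
    multiPd α f = listPd (List.finRange n) α f := rfl

theorem smoothAt_multiPd (h : ∀ x ∈ half n ∩ Metric.ball 0 ρ, SmoothAt f x) (α : Fin n → ℕ) :
    ∀ x ∈ half n ∩ Metric.ball 0 ρ, SmoothAt (multiPd α f) x :=
  smoothAt_listPd h _ α

open MvPolynomial in
/-- The functional `p ↦ p(∂) f (y)`. -/
noncomputable def jet (f : E n → ℝ) (y : E n) : MvPolynomial (Fin n) ℝ →ₗ[ℝ] ℝ :=
  (basisMonomials (Fin n) ℝ).constr ℝ fun α => multiPd α f y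

open MvPolynomial in
theorem jet_monomial (α : Fin n →₀ ℕ) (c : ℝ) (y : E n) :
    jet f y (monomial α c) = c * multiPd α f y := by
  have h : monomial α c = c • (basisMonomials (Fin n) ℝ) α := by
    rw [coe_basisMonomials, smul_monomial, smul_eq_mul, mul_one]
  rw [h, map_smul, jet, Module.Basis.constr_basis, smul_eq_mul]

open MvPolynomial in
theorem smoothAt_jet (h : ∀ x ∈ half n ∩ Metric.ball 0 ρ, SmoothAt f x)
    (p : MvPolynomial (Fin n) ℝ) :
    ∀ x ∈ half n ∩ Metric.ball 0 ρ, SmoothAt (fun y => jet f y p) x := by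
  intro x hx
  induction p using MvPolynomial.induction_on' with
  | monomial α c =>
    simp only [jet_monomial]
    exact contDiffWithinAt_const.mul (smoothAt_listPd h _ _ x hx)
  | add p q hp hq => simpa only [map_add] using hp.add hq

open MvPolynomial in
theorem jet_X_mul (h : ∀ x ∈ half n ∩ Metric.ball 0 ρ, SmoothAt f x) (i : Fin n)
    (p : MvPolynomial (Fin n) ℝ) (x : E n) (hx : x ∈ half n ∩ Metric.ball 0 ρ) :
    jet f x (X i * p) = pd i (fun y => jet f y p) x := by
  induction p using MvPolynomial.induction_on' with
  | monomial α c =>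
    rw [X, monomial_mul, one_mul, jet_monomial]
    simp only [jet_monomial]
    rw [pd_const_mul _ (smoothAt_multiPd h _ x hx) hx.1]
    congr 1
    have := listPd_add_single h α i _ (List.nodup_finRange n) (List.mem_finRange i) hx
    rw [multiPd_eq_listPd, multiPd_eq_listPd, ← this]
    congr 1
    ext k
    simp [Pi.single_apply, Finsupp.single_apply, eq_comm, add_comm]
  | add p q hp hq =>
    rw [mul_add, map_add, hp, hq]
    simp only [map_add]
    rw [pd_add (smoothAt_jet h p x hx) (smoothAt_jet h q x hx) hx.1]

-- Differentiating along the ray through $x$ multiplies the symbol by $\sum_ix_iX_i$. The powers of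
-- this linear form therefore give a derivative chain in the sense used above.
open MvPolynomial in
theorem hasDerivWithinAt_jet (h : ∀ x ∈ half n ∩ Metric.ball 0 ρ, SmoothAt f x) {x : E n}
    (hx : x ∈ half n) {τ : ℝ} (hτ : τ * ‖x‖ < ρ) (p : MvPolynomial (Fin n) ℝ) (t : ℝ)
    (ht : t ∈ Set.Icc 0 τ) :
    HasDerivWithinAt (fun s : ℝ => jet f (s • x) p)
      (jet f (t • x) ((∑ i, C (x i) * X i) * p)) (Set.Icc 0 τ) t := by
  have hmem : ∀ s ∈ Set.Icc 0 τ, s • x ∈ half n := by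
    intro s hs
    have hx' : 0 ≤ x (nrm n) := hx
    change 0 ≤ (s • x) (nrm n)
    simpa using mul_nonneg hs.1 hx'
  have htx : t • x ∈ half n ∩ Metric.ball 0 ρ := by
    refine ⟨hmem t ht, ?_⟩
    rw [mem_ball_zero_iff, norm_smul, Real.norm_of_nonneg ht.1]
    exact (mul_le_mul_of_nonneg_right ht.2 (norm_nonneg x)).trans_lt hτ
  have h1 : HasFDerivWithinAt (fun y => jet f y p)
      (fderivWithin ℝ (fun y => jet f y p) (half n) (t • x)) (half n) (t • x) :=
    (SmoothAt.differentiable (smoothAt_jet h p _ htx)).hasFDerivWithinAt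
  have h2 : HasDerivWithinAt (fun s : ℝ => s • x) x (Set.Icc 0 τ) t := by
    simpa using ((hasDerivAt_id t).smul_const x).hasDerivWithinAt
  have h3 := h1.comp_hasDerivWithinAt t h2 hmem
  convert! h3 using 1
  have hxs : x = ∑ i, x i • EuclideanSpace.single i (1 : ℝ) := by
    ext j
    simp [Finset.sum_apply, Pi.single_apply]
  set L := fderivWithin ℝ (fun y => jet f y p) (half n) (t • x) with hL
  rw [show L x = ∑ i, x i * L (EuclideanSpace.single i 1) by
    conv_lhs => rw [hxs]
    simp]
  rw [Finset.sum_mul, map_sum]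
  refine Finset.sum_congr rfl fun i _ => ?_
  rw [mul_assoc, C_mul', map_smul, jet_X_mul h i p _ htx]
  rfl

-- The multinomial theorem: $(x\cdot\partial)^kf$ is $k!$ times the degree-$k$ part of the Taylor
-- expansion. This is how conditions along rays become conditions on coefficients.
open MvPolynomial in
theorem jet_linear_pow (f : E n → ℝ) (y : E n) (x : Fin n → ℝ) (k : ℕ) :
    jet f y ((∑ i, C (x i) * X i) ^ k) = k.factorial *
      ∑ α ∈ Finset.piAntidiag Finset.univ k,
        multiPd α f y / ((∏ i, (α i).factorial : ℕ) : ℝ) * ∏ i, x i ^ α i := by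
  rw [Finset.sum_pow_eq_sum_piAntidiag, map_sum, Finset.mul_sum]
  refine Finset.sum_congr rfl fun α hα => ?_
  have h1 : ((Nat.multinomial Finset.univ α : MvPolynomial (Fin n) ℝ) *
      ∏ i, (C (x i) * X i) ^ α i) = monomial (Finsupp.equivFunOnFinite.symm α)
        (Nat.multinomial Finset.univ α * ∏ i, x i ^ α i) := by
    rw [monomial_eq, Finsupp.prod_fintype _ _ (fun _ => pow_zero _)]
    simp only [mul_pow, Finset.prod_mul_distrib, C_mul, map_natCast, map_prod, C_pow]
    rw [mul_assoc]; rfl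
  have h2 := Nat.multinomial_spec Finset.univ α
  rw [(Finset.mem_piAntidiag.1 hα).1] at h2
  have h3 : ((∏ i, (α i).factorial : ℕ) : ℝ) ≠ 0 := by
    exact_mod_cast (Finset.prod_pos fun i _ => (α i).factorial_pos).ne'
  rw [h1, jet_monomial, ← h2]
  push_cast at h3 ⊢
  field_simp
  rfl

end jet

end HalfSpace

/-! ### Algebraic constraints on the Taylor coefficients. -/

namespace HalfSpace

variable {n : ℕ}

/-- The polynomial with coefficients `c α`, `α ∈ S`. -/
noncomputable def polyOf (S : Finset (Fin n → ℕ)) (c : (Fin n → ℕ) → ℝ) : MvPolynomial (Fin n) ℝ :=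
  ∑ α ∈ S, MvPolynomial.monomial (Finsupp.equivFunOnFinite.symm α) (c α)

theorem coeff_polyOf (S : Finset (Fin n → ℕ)) (c : (Fin n → ℕ) → ℝ) (β : Fin n →₀ ℕ) :
    MvPolynomial.coeff β (polyOf S c) = if ⇑β ∈ S then c β else 0 := by
  simp only [polyOf, MvPolynomial.coeff_sum, MvPolynomial.coeff_monomial]
  have : ∀ α : Fin n → ℕ, Finsupp.equivFunOnFinite.symm α = β ↔ α = ⇑β := fun α =>
    Equiv.symm_apply_eq _
  simp only [this]
  rw [Finset.sum_ite_eq']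

theorem eval_polyOf (S : Finset (Fin n → ℕ)) (c : (Fin n → ℕ) → ℝ) (x : Fin n → ℝ) :
    MvPolynomial.eval x (polyOf S c) = ∑ α ∈ S, c α * ∏ k, x k ^ α k := by
  simp only [polyOf, map_sum, MvPolynomial.eval_monomial]
  refine Finset.sum_congr rfl fun α _ => ?_
  rw [Finsupp.prod_fintype _ _ (fun _ => pow_zero _)]
  rfl

theorem piAntidiag_subset_multiIdx {k : ℕ} (hk : k ∈ Finset.Icc 2 (dOrd n)) :
    Finset.piAntidiag Finset.univ k ⊆ multiIdx n := fun _ hα =>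
  Finset.mem_biUnion.2 ⟨k, hk, hα⟩

theorem exists_pos_mul_norm_lt {ρ : ℝ} (hρ : 0 < ρ) (x : E n) : ∃ τ : ℝ, 0 < τ ∧ τ * ‖x‖ < ρ := by
  refine ⟨ρ / (‖x‖ + 1), by positivity, ?_⟩
  rw [div_mul_eq_mul_div, div_lt_iff₀ (by positivity)]
  nlinarith [norm_nonneg x]

variable [NeZero n]

/-- The algebraic conditions satisfied by the Taylor coefficients of a tensor in conformal
Fermi coordinates. -/
structure Admissible (c : Fin n → Fin n → (Fin n → ℕ) → ℝ) : Prop where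
  symm : ∀ i j, ∀ α ∈ multiIdx n, c i j α = c j i α
  normal : ∀ i, ∀ α ∈ multiIdx n, c i (nrm n) α = 0
  trace : ∀ α ∈ multiIdx n, ∑ i, c i i α = 0
  geodesic : ∀ i j, ∀ α ∈ multiIdx n, α (nrm n) = 1 → c i j α = 0
  boundary : ∀ k ∈ Finset.Icc 2 (dOrd n), ∀ x : E n, x (nrm n) = 0 → ∀ a,
    ∑ i, (∑ α ∈ Finset.piAntidiag Finset.univ k, c a i α * ∏ l, x l ^ α l) * x i = 0

theorem pd_eq_zero_of_eqOn_boundary {f : E n → ℝ} {ρ : ℝ}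
    (hf : ∀ x ∈ half n ∩ Metric.ball 0 ρ, SmoothAt f x)
    (h0 : ∀ x ∈ half n ∩ Metric.ball 0 ρ, x (nrm n) = 0 → f x = 0) {a : Fin n} (ha : a ≠ nrm n) :
    ∀ x ∈ half n ∩ Metric.ball 0 ρ, x (nrm n) = 0 → pd a f x = 0 := by
  intro x hx hx0
  have hcoord : ∀ t : ℝ, (x + t • EuclideanSpace.single a (1 : ℝ)) (nrm n) = 0 := by
    intro t
    simp [hx0, Ne.symm ha]
  have hmem : ∀ t : ℝ, x + t • EuclideanSpace.single a (1 : ℝ) ∈ half n := fun t => (hcoord t).ge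
  have h1 : HasDerivAt (fun t : ℝ => x + t • EuclideanSpace.single a (1 : ℝ))
      (EuclideanSpace.single a 1) 0 := by
    simpa using ((hasDerivAt_id (0 : ℝ)).smul_const (EuclideanSpace.single a (1 : ℝ))).const_add x
  have h2 : HasFDerivWithinAt f (fderivWithin ℝ f (half n) x) (half n)
      (x + (0 : ℝ) • EuclideanSpace.single a (1 : ℝ)) := by
    simpa using (SmoothAt.differentiable (hf x hx)).hasFDerivWithinAt
  have h3 := h2.comp_hasDerivWithinAt (0 : ℝ) (h1.hasDerivWithinAt (s := Set.univ)) fun t _ => hmem t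
  rw [hasDerivWithinAt_univ] at h3
  have h4 : (f ∘ fun t : ℝ => x + t • EuclideanSpace.single a (1 : ℝ)) =ᶠ[𝓝 0] fun _ => 0 := by
    have hc : ContinuousAt (fun t : ℝ => x + t • EuclideanSpace.single a (1 : ℝ)) 0 :=
      h1.continuousAt
    have : ∀ᶠ t in 𝓝 (0 : ℝ), x + t • EuclideanSpace.single a (1 : ℝ) ∈ Metric.ball (0 : E n) ρ :=
      hc.eventually_mem (Metric.isOpen_ball.mem_nhds (by simpa using hx.2))
    filter_upwards [this] with t ht using h0 _ ⟨hmem t, ht⟩ (hcoord t)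
  exact h3.unique ((hasDerivAt_const (0 : ℝ) (0 : ℝ)).congr_of_eventuallyEq h4)

theorem listPd_eq_zero_of_eqOn_boundary {f : E n → ℝ} {ρ : ℝ}
    (hf : ∀ x ∈ half n ∩ Metric.ball 0 ρ, SmoothAt f x)
    (h0 : ∀ x ∈ half n ∩ Metric.ball 0 ρ, x (nrm n) = 0 → f x = 0) (α : Fin n → ℕ)
    (l : List (Fin n)) (hl : nrm n ∉ l) :
    ∀ x ∈ half n ∩ Metric.ball 0 ρ, x (nrm n) = 0 → listPd l α f x = 0 := by
  induction l with
  | nil => exact h0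
  | cons i l ih =>
    rw [List.mem_cons, not_or] at hl
    change ∀ x ∈ half n ∩ Metric.ball 0 ρ, x (nrm n) = 0 → (pd i)^[α i] (listPd l α f) x = 0
    induction α i with
    | zero => exact ih hl.2
    | succ k ihk =>
      rw [Function.iterate_succ_apply']
      exact pd_eq_zero_of_eqOn_boundary (smoothAt_iterate_pd (smoothAt_listPd hf l α) i k) ihk
        (Ne.symm hl.1)

theorem multiPd_eq_zero_of_geodesic {f : E n → ℝ} {ρ : ℝ} (hρ : 0 < ρ)
    (hf : ∀ x ∈ half n ∩ Metric.ball 0 ρ, SmoothAt f x)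
    (h0 : ∀ x ∈ half n ∩ Metric.ball 0 ρ, x (nrm n) = 0 → pd (nrm n) f x = 0) (α : Fin n → ℕ)
    (hα : α (nrm n) = 1) : multiPd α f 0 = 0 := by
  obtain ⟨m, rfl⟩ : ∃ m, n = m + 1 := ⟨n - 1, (Nat.succ_pred_eq_of_pos (NeZero.pos n)).symm⟩
  have hlast : nrm (m + 1) = Fin.last m := rfl
  -- The last index is applied first, so the single normal derivative acts directly on $f$. The
  -- remaining tangential derivatives act on a function that vanishes on the boundary.
  rw [multiPd_eq_listPd, List.finRange_succ_last]
  unfold listPd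
  rw [List.foldr_append]
  change listPd _ α ((pd (Fin.last m))^[α (Fin.last m)] f) 0 = 0
  rw [← hlast, hα, Function.iterate_one]
  refine listPd_eq_zero_of_eqOn_boundary (fun x hx => (hf x hx).pd hx.1) h0 α _ ?_ 0
    ⟨zero_mem_half, Metric.mem_ball_self hρ⟩ rfl
  simp [hlast]

/-- Coefficients of a form vanishing on the half space vanish. -/
theorem eq_zero_of_forall_half {k : ℕ} {c : (Fin n → ℕ) → ℝ}
    (h : ∀ x ∈ half n, ∑ α ∈ Finset.piAntidiag Finset.univ k, c α * ∏ l, x l ^ α l = 0)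
    {α : Fin n → ℕ} (hα : α ∈ Finset.piAntidiag Finset.univ k) : c α = 0 := by
  have h0 : polyOf (Finset.piAntidiag Finset.univ k) c = 0 := by
    -- A product of half-lines lies in the half space and already determines a polynomial.
    refine MvPolynomial.funext_set (fun _ => Set.Ici (0 : ℝ)) (fun _ => Set.Ici_infinite 0) ?_
    intro x hx
    rw [eval_polyOf, map_zero]
    exact h (WithLp.toLp 2 x) (hx (nrm n) trivial)
  have := coeff_polyOf (Finset.piAntidiag Finset.univ k) c (Finsupp.equivFunOnFinite.symm α)
  rw [h0, MvPolynomial.coeff_zero] at this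
  simp only [Finsupp.coe_equivFunOnFinite_symm, hα, if_true] at this
  exact this.symm

-- Symmetry and $h_{in}=0$ pass to coefficients directly; the trace and boundary conditions are read
-- off along rays from the origin, one degree at a time.
open MvPolynomial in
theorem IsConformalFermi.admissible {ρ : ℝ} {g h : MatField n} (H : IsConformalFermi ρ g h) :
    Admissible (coef h) := by
  have hsm : ∀ i j, ∀ x ∈ half n ∩ Metric.ball 0 ρ, SmoothAt (fun y => h y i j) x :=
    fun i j x hx => smoothAt_of_contDiffOn (H.smooth i j) hx
  have h0mem : (0 : E n) ∈ half n ∩ Metric.ball 0 ρ :=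
    ⟨zero_mem_half, Metric.mem_ball_self H.radius_pos⟩
  have hsymm : ∀ i j α, coef h i j α = coef h j i α := by
    intro i j α
    unfold coef
    rw [multiPd_eq_listPd, multiPd_eq_listPd,
      eqOn_listPd (g := fun x => h x j i) (fun x hx => (H.symm x hx).apply j i) _ α h0mem]
  have hnormal : ∀ i α, coef h i (nrm n) α = 0 := by
    intro i α
    unfold coef
    rw [multiPd_eq_listPd, eqOn_listPd (g := fun _ => 0) (fun x hx => H.normal x hx i) _ α h0mem,
      listPd_zero, zero_div]
  have chain : ∀ (i j : Fin n) (x : E n), x ∈ half n → ∀ τ, τ * ‖x‖ < ρ → ∀ k,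
      ∀ t ∈ Set.Icc 0 τ, HasDerivWithinAt
        (fun s : ℝ => jet (fun y => h y i j) (s • x) ((∑ l, C (x l) * X l) ^ k))
        (jet (fun y => h y i j) (t • x) ((∑ l, C (x l) * X l) ^ (k + 1))) (Set.Icc 0 τ) t := by
    intro i j x hx τ hτ k t ht
    rw [pow_succ']
    exact hasDerivWithinAt_jet (hsm i j) hx hτ _ t ht
  have jet0 : ∀ (i j : Fin n) (x : E n) (k : ℕ),
      jet (fun y => h y i j) ((0 : ℝ) • x) ((∑ l, C (x l) * X l) ^ k) =
        k.factorial * ∑ α ∈ Finset.piAntidiag Finset.univ k, coef h i j α * ∏ l, x l ^ α l := by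
    intro i j x k
    rw [zero_smul, jet_linear_pow]; rfl
  have jetz : ∀ (i j : Fin n) (y : E n) (q : MvPolynomial (Fin n) ℝ),
      jet (fun y => h y i j) y (q ^ 0) = h y i j := by
    intro i j y q
    have : (q ^ 0 : MvPolynomial (Fin n) ℝ) = monomial 0 1 := by simp
    rw [this, jet_monomial, one_mul, multiPd_eq_listPd,
      listPd_congr (β := fun _ => 0) (by simp)]
    induction List.finRange n with
    | nil => rfl
    | cons _ l ih => exact ih
  have hfac : ∀ k : ℕ, (k.factorial : ℝ) ≠ 0 := fun k => by exact_mod_cast k.factorial_ne_zero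
  refine ⟨fun i j α _ => hsymm i j α, fun i α _ => hnormal i α, ?_, ?_, ?_⟩
  · intro α hα
    obtain ⟨k, hk, hαk⟩ := Finset.mem_biUnion.1 hα
    refine eq_zero_of_forall_half (c := fun α => ∑ i, coef h i i α) (fun x hx => ?_) hαk
    obtain ⟨K, hK⟩ := H.trace_isBigO.bound
    obtain ⟨r, hr, hball⟩ := Metric.mem_nhdsWithin_iff.1 hK
    obtain ⟨τ, hτ, hτρ⟩ := exists_pos_mul_norm_lt (lt_min hr H.radius_pos) x
    have hmem : ∀ t ∈ Set.Icc 0 τ, t • x ∈ Metric.ball (0 : E n) r ∩ half n := by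
      intro t ht
      refine ⟨?_, ?_⟩
      · rw [mem_ball_zero_iff, norm_smul, Real.norm_of_nonneg ht.1]
        exact (mul_le_mul_of_nonneg_right ht.2 (norm_nonneg x)).trans_lt
          (hτρ.trans_le (min_le_left _ _))
      · have hx' : 0 ≤ x (nrm n) := hx
        change 0 ≤ (t • x) (nrm n)
        simpa using mul_nonneg ht.1 hx'
    -- Along the ray $\operatorname{tr}h=O(t^{2d+2})$, so its derivatives up to order $2d+1$ vanish
    -- at $0$; only orders $k\le d$ are needed.
    have := hasDerivWithinAt_chain_eq_zero_of_le (m := 2 * dOrd n + 1)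
      (K := K * ‖x‖ ^ (2 * dOrd n + 2)) hτ
      (F := fun k t => ∑ i, jet (fun y => h y i i) (t • x) ((∑ l, C (x l) * X l) ^ k))
      (fun k t ht => HasDerivWithinAt.fun_sum fun i _ =>
        chain i i x hx τ (hτρ.trans_le (min_le_right _ _)) k t ht) ?_ k
      (by have := (Finset.mem_Icc.1 hk).2; omega)
    · simp only [jet0] at this
      rw [← Finset.mul_sum] at this
      have := (mul_eq_zero.1 this).resolve_left (hfac k)
      rw [Finset.sum_comm] at this
      simpa only [Finset.sum_mul] using this
    · intro t ht
      have h1 := hball (hmem t ht)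
      simp only [jetz]
      have h2 : ‖(h (t • x)).trace‖ ≤ K * ‖‖t • x‖ ^ (2 * dOrd n + 2)‖ := h1
      rw [Real.norm_eq_abs, norm_pow, norm_norm, norm_smul, Real.norm_of_nonneg ht.1] at h2
      calc _ ≤ _ := h2
        _ = _ := by ring
  · intro i j α _ hα
    by_cases hi : i = nrm n
    · rw [hi, hsymm, hnormal]
    by_cases hj : j = nrm n
    · rw [hj, hnormal]
    unfold coef
    rw [multiPd_eq_zero_of_geodesic H.radius_pos (hsm i j)
      (fun x hx hx0 => H.totally_geodesic x hx hx0 i j hi hj) α hα, zero_div]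
  · intro k hk x hx a
    by_cases ha : a = nrm n
    · refine Finset.sum_eq_zero fun i _ => ?_
      rw [Finset.sum_eq_zero fun α _ => by rw [ha, hsymm, hnormal, zero_mul], zero_mul]
    have hxh : x ∈ half n := hx.ge
    obtain ⟨τ, hτ, hτρ⟩ := exists_pos_mul_norm_lt H.radius_pos x
    -- Here $x$ is kept fixed as the weight: on a boundary ray $\sum_ih_{ai}(tx)\,tx_i=0$, and
    -- division by $t>0$ gives a function vanishing on the open interval.
    have := hasDerivWithinAt_chain_eq_zero hτ
      (F := fun k t => ∑ i, jet (fun y => h y a i) (t • x) ((∑ l, C (x l) * X l) ^ k) * x i)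
      (fun k t ht => HasDerivWithinAt.fun_sum fun i _ =>
        (chain a i x hxh τ hτρ k t ht).mul_const (x i)) ?_ k
    · simp only [jet0, mul_assoc] at this
      rw [← Finset.mul_sum] at this
      exact (mul_eq_zero.1 this).resolve_left (hfac k)
    · intro t ht
      simp only [jetz]
      have ht0 : (t • x) (nrm n) = 0 := by simp [hx]
      have h1 := H.boundary_normal (t • x) ⟨ht0.ge, ?_⟩ ht0 a ha
      · have h2 : ∑ i, h (t • x) a i * (t • x) i = t * ∑ i, h (t • x) a i * x i := by
          rw [Finset.mul_sum]
          refine Finset.sum_congr rfl fun i _ => ?_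
          simp only [PiLp.smul_apply, smul_eq_mul]; ring
        rw [h2] at h1
        exact (mul_eq_zero.1 h1).resolve_left ht.1.ne'
      · rw [mem_ball_zero_iff, norm_smul, Real.norm_of_nonneg ht.1.le]
        exact (mul_le_mul_of_nonneg_right ht.2.le (norm_nonneg x)).trans_lt hτρ

end HalfSpace

/-! ### Pointwise algebra of the linearised Weyl tensor. -/

namespace HalfSpace

section weyl

variable {n : ℕ}

/-- The linearised Riemann tensor of a tensor field with second derivatives
`M i j a b = ∂_i ∂_j H_{ab}`. -/
def curv (M : Fin n → Fin n → Fin n → Fin n → ℝ) (i j k l : Fin n) : ℝ :=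
  M i k j l + M j l i k - M j k i l - M i l j k

/-- The linearised Schouten tensor. -/
noncomputable def schouten (M : Fin n → Fin n → Fin n → Fin n → ℝ) (j l : Fin n) : ℝ :=
  1 / ((n : ℝ) - 2) * (∑ i, curv M i j i l
    - (∑ p, ∑ i, curv M i p i p) / (2 * ((n : ℝ) - 1)) * kron j l)

/-- The linearised Weyl tensor. -/
noncomputable def weyl (M : Fin n → Fin n → Fin n → Fin n → ℝ) (i j k l : Fin n) : ℝ :=
  curv M i j k l - (kron i k * schouten M j l + kron j l * schouten M i k
    - kron j k * schouten M i l - kron i l * schouten M j k)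

/-- Trace-free tensors antisymmetric in the first and in the last two indices. -/
structure IsWeylLike (Z : Fin n → Fin n → Fin n → Fin n → ℝ) : Prop where
  antisymm_left : ∀ i j k l, Z i j k l = - Z j i k l
  antisymm_right : ∀ i j k l, Z i j k l = - Z i j l k
  trace : ∀ j l, ∑ i, Z i j i l = 0

theorem kron_comm (i j : Fin n) : (kron i j : ℝ) = kron j i := by simp [kron, eq_comm]

section sums

variable {Z : Fin n → Fin n → Fin n → Fin n → ℝ} (hZ : IsWeylLike Z)
include hZ

theorem IsWeylLike.sum_swap_left (F : Fin n → Fin n → Fin n → Fin n → ℝ) :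
    ∑ i, ∑ j, ∑ k, ∑ l, Z i j k l * F j i k l = - ∑ i, ∑ j, ∑ k, ∑ l, Z i j k l * F i j k l := by
  rw [Finset.sum_comm]
  simp only [← Finset.sum_neg_distrib]
  refine Finset.sum_congr rfl fun i _ => Finset.sum_congr rfl fun j _ =>
    Finset.sum_congr rfl fun k _ => Finset.sum_congr rfl fun l _ => ?_
  rw [hZ.antisymm_left]; ring

theorem IsWeylLike.sum_swap_right (F : Fin n → Fin n → Fin n → Fin n → ℝ) :
    ∑ i, ∑ j, ∑ k, ∑ l, Z i j k l * F i j l k = - ∑ i, ∑ j, ∑ k, ∑ l, Z i j k l * F i j k l := by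
  simp only [← Finset.sum_neg_distrib]
  refine Finset.sum_congr rfl fun i _ => Finset.sum_congr rfl fun j _ => ?_
  rw [Finset.sum_comm]
  refine Finset.sum_congr rfl fun k _ => Finset.sum_congr rfl fun l _ => ?_
  rw [hZ.antisymm_right]; ring

theorem IsWeylLike.sum_symm_left {F : Fin n → Fin n → Fin n → Fin n → ℝ}
    (hF : ∀ i j k l, F i j k l = F j i k l) :
    ∑ i, ∑ j, ∑ k, ∑ l, Z i j k l * F i j k l = 0 := by
  have h := hZ.sum_swap_left F
  simp only [hF _ _ _ _] at h
  have h' : ∑ i, ∑ j, ∑ k, ∑ l, Z i j k l * F j i k l =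
      ∑ i, ∑ j, ∑ k, ∑ l, Z i j k l * F i j k l := by simp only [fun i j k l => hF j i k l]
  linarith

theorem IsWeylLike.sum_symm_right {F : Fin n → Fin n → Fin n → Fin n → ℝ}
    (hF : ∀ i j k l, F i j k l = F i j l k) :
    ∑ i, ∑ j, ∑ k, ∑ l, Z i j k l * F i j k l = 0 := by
  have h := hZ.sum_swap_right F
  have h' : ∑ i, ∑ j, ∑ k, ∑ l, Z i j k l * F i j l k =
      ∑ i, ∑ j, ∑ k, ∑ l, Z i j k l * F i j k l := by simp only [fun i j k l => hF i j l k]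
  linarith

theorem IsWeylLike.sum_kron_ik (X : Fin n → Fin n → ℝ) :
    ∑ i, ∑ j, ∑ k, ∑ l, Z i j k l * (kron i k * X j l) = 0 := by
  have : ∀ i j, ∑ k, ∑ l, Z i j k l * (kron i k * X j l) = ∑ l, Z i j i l * X j l := by
    intro i j
    rw [Finset.sum_comm]
    simp [kron]
  simp only [this]
  rw [Finset.sum_comm]
  refine Finset.sum_eq_zero fun j _ => ?_
  rw [Finset.sum_comm]
  simp only [← Finset.sum_mul, hZ.trace, zero_mul, Finset.sum_const_zero]

/-- Antisymmetry transports the one assumed trace condition to the other three mixed pairs of slots.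
-/
theorem IsWeylLike.sum_kron_jk (X : Fin n → Fin n → ℝ) :
    ∑ i, ∑ j, ∑ k, ∑ l, Z i j k l * (kron j k * X i l) = 0 := by
  have := hZ.sum_swap_left fun i j k l => kron i k * X j l
  rw [hZ.sum_kron_ik] at this
  simpa using this

theorem IsWeylLike.sum_kron_il (X : Fin n → Fin n → ℝ) :
    ∑ i, ∑ j, ∑ k, ∑ l, Z i j k l * (kron i l * X j k) = 0 := by
  have := hZ.sum_swap_right fun i j k l => kron i k * X j l
  rw [hZ.sum_kron_ik] at this
  simpa using this

theorem IsWeylLike.sum_kron_jl (X : Fin n → Fin n → ℝ) :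
    ∑ i, ∑ j, ∑ k, ∑ l, Z i j k l * (kron j l * X i k) = 0 := by
  have := hZ.sum_swap_left fun i j k l => kron i l * X j k
  rw [hZ.sum_kron_il] at this
  simpa using this

end sums

section symm

variable {M : Fin n → Fin n → Fin n → Fin n → ℝ}
  (h1 : ∀ i j a b, M i j a b = M j i a b) (h2 : ∀ i j a b, M i j a b = M i j b a)
include h1 h2

theorem schouten_symm (j l : Fin n) : schouten M j l = schouten M l j := by
  have : ∀ i, curv M i j i l = curv M i l i j := fun i => by
    rw [curv, curv, h2 i i j l, h1 j l, h1 j i, h2 i j, h1 i l, h2 l i]; ring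
  simp only [schouten, this, kron_comm j l]

theorem isWeylLike_weyl (hn : 3 ≤ n) : IsWeylLike (weyl M) := by
  have hs := schouten_symm h1 h2
  refine ⟨fun i j k l => ?_, fun i j k l => ?_, fun j l => ?_⟩
  · simp only [weyl, curv]; ring
  · simp only [weyl, curv]
    ring
  · have hn' : (3 : ℝ) ≤ n := by exact_mod_cast hn
    have e0 : ∑ i : Fin n, (kron i i : ℝ) = n := by simp [kron]
    have e1 : ∀ f : Fin n → ℝ, ∑ i, kron j i * f i = f j := fun f => by simp [kron]
    have e2 : ∀ f : Fin n → ℝ, ∑ i, kron i l * f i = f l := fun f => by simp [kron]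
    have h1n : (n : ℝ) - 1 ≠ 0 := by linarith
    have h2n : (n : ℝ) - 2 ≠ 0 := by linarith
    have tr : ∑ i, schouten M i i = (∑ p, ∑ i, curv M i p i p) / (2 * ((n : ℝ) - 1)) := by
      simp only [schouten, ← Finset.mul_sum, Finset.sum_sub_distrib, e0]
      field_simp
      ring
    simp only [weyl, Finset.sum_sub_distrib, Finset.sum_add_distrib, ← Finset.mul_sum,
      ← Finset.sum_mul, e0, e1, e2, tr]
    simp only [schouten]
    field_simp
    ring

/-- The squared length of the Weyl tensor as a pairing with second derivatives. -/
theorem sum_weyl_sq (hn : 3 ≤ n) : ∑ i, ∑ j, ∑ k, ∑ l, weyl M i j k l ^ 2 =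
    4 * ∑ i, ∑ j, ∑ k, ∑ l, weyl M i j k l * M j l i k := by
  have hW := isWeylLike_weyl h1 h2 hn
  set W := weyl M with hWdef
  -- One factor is expanded. Its Schouten part is pure trace and pairs to zero; the four
  -- second-derivative terms contribute equally by antisymmetry, whence the factor $4$.
  have e : ∀ i j k l, W i j k l ^ 2 = W i j k l * M i k j l + W i j k l * M j l i k
      - W i j k l * M j k i l - W i j k l * M i l j k
      - W i j k l * (kron i k * schouten M j l) - W i j k l * (kron j l * schouten M i k)
      + W i j k l * (kron j k * schouten M i l) + W i j k l * (kron i l * schouten M j k) := by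
    intro i j k l
    rw [pow_two]
    nth_rewrite 2 [hWdef]
    simp only [weyl, curv]
    ring
  simp only [e, Finset.sum_add_distrib, Finset.sum_sub_distrib, hW.sum_kron_ik, hW.sum_kron_jk,
    hW.sum_kron_il, hW.sum_kron_jl]
  have s1 := hW.sum_swap_left fun i j k l => M j l i k
  have s2 := hW.sum_swap_right fun i j k l => M j l i k
  have s3 := hW.sum_swap_right fun i j k l => M i l j k
  linarith

end symm

end weyl

end HalfSpace

/-! ### Linearity and scaling in the coefficients. -/

namespace HalfSpace

open MvPolynomial

/-- Coefficients of polynomial tensor fields with terms of order in `[2, d]`. -/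
abbrev Coefs (n : ℕ) : Type := Fin n → Fin n → multiIdx n → ℝ

variable {n : ℕ}

/-- The entries of the polynomial tensor field with coefficients `c`. -/
noncomputable def polyEntry (a b : Fin n) : Coefs n →ₗ[ℝ] MvPolynomial (Fin n) ℝ where
  toFun c := ∑ α : multiIdx n, c a b α • monomial (Finsupp.equivFunOnFinite.symm α.1) 1
  map_add' c d := by simp [add_smul, Finset.sum_add_distrib]
  map_smul' r c := by simp [mul_smul, Finset.smul_sum]

theorem polyEntry_apply (a b : Fin n) (c : Coefs n) : polyEntry a b c =
    ∑ α : multiIdx n, c a b α • monomial (Finsupp.equivFunOnFinite.symm α.1) 1 := rfl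

/-- The second derivatives of the polynomial tensor field with coefficients `c`. -/
noncomputable def hess (c : Coefs n) (x : Fin n → ℝ) (i j a b : Fin n) : ℝ :=
  eval x (pderiv i (pderiv j (polyEntry a b c)))

theorem hess_eq (c : Coefs n) (x : Fin n → ℝ) (i j a b : Fin n) :
    hess c x i j a b = ∑ α : multiIdx n, c a b α *
      eval x (pderiv i (pderiv j (monomial (Finsupp.equivFunOnFinite.symm α.1) 1))) := by
  simp only [hess, polyEntry_apply, map_sum, Derivation.map_smul, smul_eval]

theorem hess_comm (c : Coefs n) (x : Fin n → ℝ) (i j a b : Fin n) :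
    hess c x i j a b = hess c x j i a b := by
  rw [hess, hess, pderiv_pderiv_comm]

theorem hess_add (c c' : Coefs n) (x : Fin n → ℝ) : hess (c + c') x = hess c x + hess c' x := by
  funext i j a b
  simp [hess]

theorem hess_smul (r : ℝ) (c : Coefs n) (x : Fin n → ℝ) : hess (r • c) x = r • hess c x := by
  funext i j a b
  simp [hess, smul_eval]

theorem curv_add (M N : Fin n → Fin n → Fin n → Fin n → ℝ) : curv (M + N) = curv M + curv N := by
  funext i j k l
  simp only [curv, Pi.add_apply]; ring

theorem curv_smul (r : ℝ) (M : Fin n → Fin n → Fin n → Fin n → ℝ) :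
    curv (r • M) = r • curv M := by
  funext i j k l
  simp only [curv, Pi.smul_apply, smul_eq_mul]; ring

theorem schouten_add (M N : Fin n → Fin n → Fin n → Fin n → ℝ) :
    schouten (M + N) = schouten M + schouten N := by
  funext j l
  simp only [schouten, curv_add, Pi.add_apply, Finset.sum_add_distrib]; ring

theorem schouten_smul (r : ℝ) (M : Fin n → Fin n → Fin n → Fin n → ℝ) :
    schouten (r • M) = r • schouten M := by
  funext j l
  simp only [schouten, curv_smul, Pi.smul_apply, smul_eq_mul, ← Finset.mul_sum]; ring

theorem weyl_add (M N : Fin n → Fin n → Fin n → Fin n → ℝ) :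
    weyl (M + N) = weyl M + weyl N := by
  funext i j k l
  simp only [weyl, curv_add, schouten_add, Pi.add_apply]; ring

theorem weyl_smul (r : ℝ) (M : Fin n → Fin n → Fin n → Fin n → ℝ) :
    weyl (r • M) = r • weyl M := by
  funext i j k l
  simp only [weyl, curv_smul, schouten_smul, Pi.smul_apply, smul_eq_mul]; ring

theorem continuous_weyl_hess (i j k l : Fin n) :
    Continuous fun z : Coefs n × E n => weyl (hess z.1 z.2.ofLp) i j k l := by
  have h : ∀ i j a b, Continuous fun z : Coefs n × E n => hess z.1 z.2.ofLp i j a b := by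
    intro i j a b
    simp only [hess_eq]
    refine continuous_finsetSum _ fun α _ => ?_
    refine Continuous.mul (by fun_prop) ?_
    exact (contDiff_eval _).continuous.comp continuous_snd
  simp only [weyl, schouten, curv]
  fun_prop

theorem contDiff_weyl_hess (c : Coefs n) (i j k l : Fin n) :
    ContDiff ℝ ∞ fun x : E n => weyl (hess c x.ofLp) i j k l := by
  have h : ∀ i j a b, ContDiff ℝ ∞ fun x : E n => hess c x.ofLp i j a b := fun i j a b =>
    contDiff_eval _
  simp only [weyl, schouten, curv]
  fun_prop

theorem homogeneous_eval_smul {q : ℕ} {p : MvPolynomial (Fin n) ℝ} (hp : p.IsHomogeneous q)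
    (r : ℝ) (x : Fin n → ℝ) : eval (r • x) p = r ^ q * eval x p := by
  simp only [eval_eq, Finset.mul_sum]
  refine Finset.sum_congr rfl fun d hd => ?_
  have : d.degree = q := by
    by_contra h
    exact (mem_support_iff.1 hd) (hp.coeff_eq_zero h)
  rw [← this, Finsupp.degree_apply]
  simp only [Pi.smul_apply, smul_eq_mul, mul_pow, Finset.prod_mul_distrib, Finset.prod_pow_eq_pow_sum]
  ring

/-- Rescaling of the coefficients, corresponding to `H(r x)`. -/
def rescale (r : ℝ) (c : Fin n → Fin n → (Fin n → ℕ) → ℝ) : Coefs n :=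
  fun a b α => r ^ order α.1 * c a b α

theorem degree_equivFunOnFinite_symm (α : Fin n → ℕ) :
    (Finsupp.equivFunOnFinite.symm α).degree = order α := by
  rw [Finsupp.degree_eq_sum]; rfl

/-- The chain rule for $H(r\,\cdot)$. The factor `rescale 1` only restricts coefficients to the
admitted orders. -/
theorem hess_rescale (c : Fin n → Fin n → (Fin n → ℕ) → ℝ) {r : ℝ} (hr : r ≠ 0)
    (x : Fin n → ℝ) (i j a b : Fin n) :
    hess (rescale r c) (r⁻¹ • x) i j a b = r ^ 2 * hess (rescale 1 c) x i j a b := by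
  simp only [hess_eq, rescale, Finset.mul_sum]
  refine Finset.sum_congr rfl fun α _ => ?_
  obtain ⟨q, hq⟩ : ∃ q, order α.1 = q + 2 :=
    ⟨order α.1 - 2, by have := ((mem_multiIdx _).1 α.2).1; omega⟩
  have hm : (monomial (Finsupp.equivFunOnFinite.symm α.1) (1 : ℝ)).IsHomogeneous (q + 2) :=
    isHomogeneous_monomial _ (by rw [degree_equivFunOnFinite_symm, hq])
  rw [homogeneous_eval_smul ((hm.pderiv (i := j)).pderiv (i := i)), hq]
  simp only [show q + 2 - 1 - 1 = q by omega, inv_pow, one_pow]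
  field_simp
  ring

end HalfSpace

/-! ### Injectivity of the linearised Weyl map on admissible coefficients. -/

namespace MvPolynomial

theorem eval_restrictLast {m : ℕ} (p : MvPolynomial (Fin (m + 1)) ℝ) (y : Fin m → ℝ) :
    eval y (restrictLast m p) = eval (Fin.snoc y 0 : Fin (m + 1) → ℝ) p := by
  induction p using MvPolynomial.induction_on with
  | C r => simp [restrictLast]
  | add p q hp hq => simp [hp, hq]
  | mul_X p i hp =>
    rw [map_mul, map_mul, hp, map_mul, eval_X]
    congr 1
    refine Fin.lastCases ?_ (fun b => ?_) i <;> simp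

end MvPolynomial

namespace HalfSpace

open MvPolynomial

variable {n : ℕ}

/-- Extension of coefficients by zero. -/
def extend (c : Coefs n) : Fin n → Fin n → (Fin n → ℕ) → ℝ := fun a b α =>
  if h : α ∈ multiIdx n then c a b ⟨α, h⟩ else 0

theorem polyEntry_eq_polyOf (a b : Fin n) (c : Coefs n) :
    polyEntry a b c = polyOf (multiIdx n) (extend c a b) := by
  rw [polyEntry_apply, polyOf, ← Finset.sum_coe_sort (multiIdx n)]
  refine Finset.sum_congr rfl fun α _ => ?_
  rw [smul_monomial, smul_eq_mul, mul_one, extend, dif_pos α.2]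

theorem coeff_polyEntry (a b : Fin n) (c : Coefs n) (β : Fin n →₀ ℕ) :
    coeff β (polyEntry a b c) = extend c a b β := by
  rw [polyEntry_eq_polyOf, coeff_polyOf, extend]
  split_ifs <;> rfl

theorem homogeneousComponent_polyEntry (a b : Fin n) (c : Coefs n) (k : ℕ) :
    homogeneousComponent k (polyEntry a b c) = if k ∈ Finset.Icc 2 (dOrd n) then
      polyOf (Finset.piAntidiag Finset.univ k) (extend c a b) else 0 := by
  ext β
  have hβ : β.degree = order ⇑β := by rw [Finsupp.degree_eq_sum]; rfl
  rw [coeff_homogeneousComponent, coeff_polyEntry, hβ]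
  split_ifs with h1 h2 h2
  · rw [coeff_polyOf, if_pos (Finset.mem_piAntidiag.2 ⟨h1, by simp⟩)]
  · rw [coeff_zero, extend, dif_neg]
    rw [mem_multiIdx, h1, ← Finset.mem_Icc]
    exact h2
  · rw [coeff_polyOf, if_neg]
    exact fun h => h1 (Finset.mem_piAntidiag.1 h).1
  · rw [coeff_zero]

/-- Vanishing Weyl tensor says that the curvature is the Kulkarni–Nomizu product of the metric with
the Schouten tensor, which is again polynomial; `eq_zero_of_fermi` then applies. -/
theorem eq_zero_of_weyl_eq_zero [NeZero n] (hn : 6 ≤ n) {c : Coefs n} (hc : Admissible (extend c))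
    (x₀ : Fin n → ℝ) {s : ℝ} (hs : 0 < s)
    (hW : ∀ x ∈ Metric.ball x₀ s, ∀ i j k l, weyl (hess c x) i j k l = 0) : c = 0 := by
  obtain ⟨m, rfl⟩ : ∃ m, n = m + 1 := ⟨n - 1, by omega⟩
  have hlast : nrm (m + 1) = Fin.last m := rfl
  set R : Fin (m + 1) → Fin (m + 1) → Fin (m + 1) → Fin (m + 1) → MvPolynomial (Fin (m + 1)) ℝ :=
    fun i j k l => pderiv i (pderiv k (polyEntry j l c)) + pderiv j (pderiv l (polyEntry i k c))
      - pderiv j (pderiv k (polyEntry i l c)) - pderiv i (pderiv l (polyEntry j k c)) with hRdef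
  set A : Fin (m + 1) → Fin (m + 1) → MvPolynomial (Fin (m + 1)) ℝ := fun j l =>
    C (1 / (((m + 1 : ℕ) : ℝ) - 2)) * (∑ i, R i j i l -
      (∑ p, ∑ i, R i p i p) * C (1 / (2 * (((m + 1 : ℕ) : ℝ) - 1))) * kr j l) with hA
  have hRe : ∀ x i j k l, eval x (R i j k l) = curv (hess c x) i j k l := fun x i j k l => by
    simp only [hRdef, map_add, map_sub, curv, hess]
  have hkr : ∀ (x : Fin (m + 1) → ℝ) i j, eval x (kr i j) = kron i j := fun x i j => by
    simp [kr, kron, apply_ite (eval x)]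
  have hAe : ∀ x j l, eval x (A j l) = schouten (hess c x) j l := fun x j l => by
    simp only [hA, map_mul, map_sub, map_sum, hRe, hkr, eval_C, schouten]
    ring
  have hsymm : ∀ a b, polyEntry a b c = polyEntry b a c := by
    intro a b
    ext β
    rw [coeff_polyEntry, coeff_polyEntry]
    by_cases h : ⇑β ∈ multiIdx (m + 1)
    · exact hc.symm a b _ h
    · simp [extend, h]
  have hker := eq_zero_of_fermi (m := m) (by omega) (fun i j => polyEntry i j c) A ?_ hsymm ?_ ?_
    ?_ ?_ ?_ ?_
  · funext a b α
    have := congrArg (coeff (Finsupp.equivFunOnFinite.symm α.1)) (hker a b)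
    rw [coeff_polyEntry, coeff_zero] at this
    simpa [extend] using this
  · intro i j α hα
    rw [coeff_polyEntry, extend, dif_neg]
    intro h
    have := ((mem_multiIdx _).1 h).1
    rw [Finsupp.degree_eq_sum] at hα
    exact absurd hα (not_lt.2 this)
  · intro j l
    refine MvPolynomial.funext fun x => ?_
    rw [hAe, hAe]
    exact schouten_symm (fun i j a b => hess_comm c x i j a b)
      (fun i j a b => by rw [hess, hess, hsymm]) j l
  · intro i
    ext β
    rw [coeff_polyEntry, coeff_zero]
    by_cases h : ⇑β ∈ multiIdx (m + 1)
    · exact hc.normal i _ h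
    · simp [extend, h]
  · ext β
    rw [coeff_sum, coeff_zero]
    simp only [coeff_polyEntry]
    by_cases h : ⇑β ∈ multiIdx (m + 1)
    · exact hc.trace _ h
    · simp [extend, h]
  · intro i j α hα
    rw [coeff_polyEntry]
    by_cases h : ⇑α ∈ multiIdx (m + 1)
    · exact hc.geodesic i j _ h hα
    · simp [extend, h]
  · intro k a
    simp only [homogeneousComponent_polyEntry]
    split_ifs with hk
    · refine MvPolynomial.funext fun y => ?_
      have := hc.boundary k hk (WithLp.toLp 2 (Fin.snoc y 0)) (by simp [hlast]) a.castSucc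
      rw [Fin.sum_univ_castSucc] at this
      simp only [Fin.snoc_castSucc, Fin.snoc_last, mul_zero, add_zero] at this
      simp only [map_sum, map_mul, eval_X, map_zero, eval_restrictLast, eval_polyOf]
      refine Eq.trans ?_ this
      exact Finset.sum_congr rfl fun b _ => mul_comm _ _
    · simp
  · intro i j k l
    -- The ball is for the sup norm, hence a product of intervals, and equality on it is equality of
    -- polynomials.
    refine MvPolynomial.funext_set (fun i => Metric.ball (x₀ i) s) (fun i => ?_) fun x hx => ?_
    · rw [Real.ball_eq_Ioo]
      exact Set.Ioo_infinite (by linarith)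
    · rw [ball_pi _ hs] at hW
      have := hW x hx i j k l
      rw [weyl, ← hRe] at this
      simp only [map_add, map_sub, map_mul, hkr, hAe]
      simp only [hRdef, map_add, map_sub] at this
      linarith

theorem isClosed_admissible [NeZero n] : IsClosed {c : Coefs n | Admissible (extend c)} := by
  have hcont : ∀ a b α, Continuous fun c : Coefs n => extend c a b α := by
    intro a b α
    unfold extend
    split_ifs <;> fun_prop
  have : {c : Coefs n | Admissible (extend c)} =
      {c | (∀ i j, ∀ α ∈ multiIdx n, extend c i j α = extend c j i α) ∧
        (∀ i, ∀ α ∈ multiIdx n, extend c i (nrm n) α = 0) ∧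
        (∀ α ∈ multiIdx n, ∑ i, extend c i i α = 0) ∧
        (∀ i j, ∀ α ∈ multiIdx n, α (nrm n) = 1 → extend c i j α = 0) ∧
        (∀ k ∈ Finset.Icc 2 (dOrd n), ∀ x : E n, x (nrm n) = 0 → ∀ a,
          ∑ i, (∑ α ∈ Finset.piAntidiag Finset.univ k, extend c a i α * ∏ l, x l ^ α l) * x i
            = 0)} := by
    ext c
    exact ⟨fun h => ⟨h.1, h.2, h.3, h.4, h.5⟩, fun h => ⟨h.1, h.2.1, h.2.2.1, h.2.2.2.1, h.2.2.2.2⟩⟩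
  rw [this]
  simp only [Set.ofPred_and, Set.ofPred_forall]
  refine (isClosed_iInter fun i => isClosed_iInter fun j => isClosed_iInter fun α =>
    isClosed_iInter fun _ => isClosed_eq (hcont _ _ _) (hcont _ _ _)).inter
    ((isClosed_iInter fun i => isClosed_iInter fun α => isClosed_iInter fun _ =>
      isClosed_eq (hcont _ _ _) continuous_const).inter
    ((isClosed_iInter fun α => isClosed_iInter fun _ => isClosed_eq
      (continuous_finsetSum _ fun i _ => hcont _ _ _) continuous_const).inter
    ((isClosed_iInter fun i => isClosed_iInter fun j => isClosed_iInter fun α =>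
      isClosed_iInter fun _ => isClosed_iInter fun _ =>
        isClosed_eq (hcont _ _ _) continuous_const).inter
    (isClosed_iInter fun k => isClosed_iInter fun _ => isClosed_iInter fun x =>
      isClosed_iInter fun _ => isClosed_iInter fun a => isClosed_eq ?_ continuous_const))))
  fun_prop

/-- Each condition involves coefficients of a single order, so the weights $r^{|\alpha|}$ factor
out. -/
theorem Admissible.rescale [NeZero n] {c : Fin n → Fin n → (Fin n → ℕ) → ℝ} (hc : Admissible c)
    (r : ℝ) : Admissible (extend (rescale r c)) := by
  have e : ∀ a b, ∀ α ∈ multiIdx n,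
      extend (HalfSpace.rescale r c) a b α = r ^ order α * c a b α := fun a b α hα => by
    rw [extend, dif_pos hα]; rfl
  refine ⟨fun i j α hα => ?_, fun i α hα => ?_, fun α hα => ?_, fun i j α hα h => ?_,
    fun k hk x hx a => ?_⟩
  · rw [e _ _ _ hα, e _ _ _ hα, hc.symm i j α hα]
  · rw [e _ _ _ hα, hc.normal i α hα, mul_zero]
  · simp only [e _ _ _ hα]
    rw [← Finset.mul_sum, hc.trace α hα, mul_zero]
  · rw [e _ _ _ hα, hc.geodesic i j α hα h, mul_zero]
  · have := hc.boundary k hk x hx a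
    rw [← mul_zero (r ^ k), ← this, Finset.mul_sum]
    refine Finset.sum_congr rfl fun i _ => ?_
    rw [← mul_assoc, Finset.mul_sum]
    congr 1
    refine Finset.sum_congr rfl fun α hα => ?_
    rw [e _ _ _ (piAntidiag_subset_multiIdx hk hα), order, (Finset.mem_piAntidiag.1 hα).1]
    ring

theorem Admissible.smul [NeZero n] {c : Coefs n} (hc : Admissible (extend c)) (r : ℝ) :
    Admissible (extend (r • c)) := by
  have e : ∀ a b α, extend (r • c) a b α = r * extend c a b α := fun a b α => by
    simp only [extend]
    split_ifs <;> simp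
  refine ⟨fun i j α hα => ?_, fun i α hα => ?_, fun α hα => ?_, fun i j α hα h => ?_,
    fun k hk x hx a => ?_⟩
  · rw [e, e, hc.symm i j α hα]
  · rw [e, hc.normal i α hα, mul_zero]
  · simp only [e]
    rw [← Finset.mul_sum, hc.trace α hα, mul_zero]
  · rw [e, hc.geodesic i j α hα h, mul_zero]
  · have := hc.boundary k hk x hx a
    rw [← mul_zero r, ← this, Finset.mul_sum]
    refine Finset.sum_congr rfl fun i _ => ?_
    rw [← mul_assoc, Finset.mul_sum]
    congr 1
    exact Finset.sum_congr rfl fun α _ => by rw [e]; ring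

end HalfSpace

/-! ### Test fields and the lower bound by compactness. -/

namespace HalfSpace

open MeasureTheory

variable {n : ℕ} [NeZero n]

/-- A point of the open half space at distance `3 / 2` from the origin. -/
noncomputable def ctr (n : ℕ) [NeZero n] : E n := EuclideanSpace.single (nrm n) (3 / 2)

/-- A bump function supported in the ball of radius `1 / 4` around `ctr n`. -/
noncomputable def bump (n : ℕ) [NeZero n] : ContDiffBump (ctr n) where
  rIn := 1 / 8
  rOut := 1 / 4
  rIn_pos := by norm_num
  rIn_lt_rOut := by norm_num

/-- The Weyl tensor of a polynomial tensor field, localised around `ctr n`. -/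
noncomputable def testField (c : Coefs n) (i j k l : Fin n) (x : E n) : ℝ :=
  bump n x * weyl (hess c x.ofLp) i j k l

theorem contDiff_testField (c : Coefs n) (i j k l : Fin n) :
    ContDiff ℝ ∞ (testField c i j k l) :=
  (bump n).contDiff.mul (contDiff_weyl_hess c i j k l)

theorem tsupport_testField (c : Coefs n) (i j k l : Fin n) :
    tsupport (testField c i j k l) ⊆ Metric.closedBall (ctr n) (1 / 4) := by
  rw [show (1 / 4 : ℝ) = (bump n).rOut from rfl, ← (bump n).tsupport_eq]
  exact tsupport_mul_subset_left

theorem hasCompactSupport_testField (c : Coefs n) (i j k l : Fin n) :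
    HasCompactSupport (testField c i j k l) :=
  (isCompact_closedBall (ctr n) (1 / 4)).of_isClosed_subset (isClosed_tsupport _)
    (tsupport_testField c i j k l)

/-- The source is finite dimensional, so a linear map into bounded continuous functions is
automatically bounded. -/
theorem exists_bound_of_linear {n : ℕ} (L : Coefs n →ₗ[ℝ] (E n → ℝ)) (hc : ∀ c, Continuous (L c))
    (hs : ∀ c, HasCompactSupport (L c)) : ∃ M, 0 ≤ M ∧ ∀ c x, |L c x| ≤ M * ‖c‖ := by
  choose B hB using fun c => (hs c).exists_bound_of_continuous (hc c)
  let L' : Coefs n →ₗ[ℝ] BoundedContinuousFunction (E n) ℝ :=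
    { toFun := fun c => BoundedContinuousFunction.ofNormedAddCommGroup (L c) (hc c) (B c) (hB c)
      map_add' := fun c d => by ext x; simp
      map_smul' := fun r c => by ext x; simp }
  obtain ⟨M, hM0, hM⟩ := L'.toContinuousLinearMap.bound
  refine ⟨M, hM0.le, fun c x => ?_⟩
  calc |L c x| = ‖L' c x‖ := rfl
    _ ≤ ‖L' c‖ := BoundedContinuousFunction.norm_coe_le_norm _ _
    _ ≤ _ := hM c

theorem testField_add (c d : Coefs n) (i j k l : Fin n) :
    testField (c + d) i j k l = testField c i j k l + testField d i j k l := by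
  funext x
  simp only [testField, hess_add, weyl_add, Pi.add_apply]; ring

theorem testField_smul (r : ℝ) (c : Coefs n) (i j k l : Fin n) :
    testField (r • c) i j k l = r • testField c i j k l := by
  funext x
  simp only [testField, hess_smul, weyl_smul, Pi.smul_apply, smul_eq_mul]; ring

theorem exists_bound_testField (n : ℕ) [NeZero n] : ∃ M, 0 ≤ M ∧
    ∀ (c : Coefs n) (i j k l : Fin n) (x : E n), |testField c i j k l x| ≤ M * ‖c‖ ∧
      ∀ p, |fderiv ℝ (testField c i j k l) x (EuclideanSpace.single p 1)| ≤ M * ‖c‖ := by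
  have h1 : ∀ q : Fin n × Fin n × Fin n × Fin n, ∃ M, 0 ≤ M ∧ ∀ (c : Coefs n) (x : E n),
      |testField c q.1 q.2.1 q.2.2.1 q.2.2.2 x| ≤ M * ‖c‖ := fun q =>
    exists_bound_of_linear
      { toFun := fun c => testField c q.1 q.2.1 q.2.2.1 q.2.2.2
        map_add' := fun c d => testField_add c d _ _ _ _
        map_smul' := fun r c => testField_smul r c _ _ _ _ }
      (fun c => (contDiff_testField c _ _ _ _).continuous)
      (fun c => hasCompactSupport_testField c _ _ _ _)
  have hd : ∀ (c : Coefs n) (i j k l : Fin n), Differentiable ℝ (testField c i j k l) :=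
    fun c i j k l => (contDiff_testField c i j k l).differentiable (by simp)
  have h2 : ∀ q : Fin n × Fin n × Fin n × Fin n × Fin n, ∃ M, 0 ≤ M ∧ ∀ (c : Coefs n) (x : E n),
      |fderiv ℝ (testField c q.1 q.2.1 q.2.2.1 q.2.2.2.1) x
        (EuclideanSpace.single q.2.2.2.2 1)| ≤ M * ‖c‖ := fun q =>
    exists_bound_of_linear
      { toFun := fun c x => fderiv ℝ (testField c q.1 q.2.1 q.2.2.1 q.2.2.2.1) x
          (EuclideanSpace.single q.2.2.2.2 1)
        map_add' := fun c d => by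
          funext x
          rw [testField_add, fderiv_add (hd _ _ _ _ _ x) (hd _ _ _ _ _ x)]; rfl
        map_smul' := fun r c => by
          funext x
          rw [testField_smul, fderiv_const_smul (hd _ _ _ _ _ x)]; rfl }
      (fun c => ((contDiff_testField c _ _ _ _).continuous_fderiv (by simp)).clm_apply
        continuous_const)
      (fun c => (hasCompactSupport_testField c _ _ _ _).fderiv_apply ℝ _)
  choose M1 hM1 hM1' using h1
  choose M2 hM2 hM2' using h2
  refine ⟨∑ q, M1 q + ∑ q, M2 q, add_nonneg (Finset.sum_nonneg fun q _ => hM1 q)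
    (Finset.sum_nonneg fun q _ => hM2 q), fun c i j k l x => ⟨?_, fun p => ?_⟩⟩
  · refine (hM1' (i, j, k, l) c x).trans ?_
    gcongr
    have := Finset.single_le_sum (fun q _ => hM1 q) (Finset.mem_univ (i, j, k, l))
    have := Finset.sum_nonneg (s := Finset.univ) fun q _ => hM2 q
    linarith
  · refine (hM2' (i, j, k, l, p) c x).trans ?_
    gcongr
    have := Finset.single_le_sum (fun q _ => hM2 q) (Finset.mem_univ (i, j, k, l, p))
    have := Finset.sum_nonneg (s := Finset.univ) fun q _ => hM1 q
    linarith

/-- The pairing of the localised Weyl tensor with second derivatives. -/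
noncomputable def pairing (c : Coefs n) (x : E n) : ℝ :=
  ∑ i, ∑ j, ∑ k, ∑ l, testField c i j k l x * hess c x.ofLp j l i k

theorem hess_symm_of_admissible {c : Coefs n} (hc : Admissible (extend c)) (x : Fin n → ℝ)
    (i j a b : Fin n) : hess c x i j a b = hess c x i j b a := by
  have : polyEntry a b c = polyEntry b a c := by
    ext β
    rw [coeff_polyEntry, coeff_polyEntry]
    by_cases h : ⇑β ∈ multiIdx n
    · exact hc.symm a b _ h
    · simp [extend, h]
  rw [hess, hess, this]

theorem isWeylLike_testField (hn : 3 ≤ n) {c : Coefs n} (hc : Admissible (extend c)) (x : E n) :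
    IsWeylLike fun i j k l => testField c i j k l x := by
  have h := isWeylLike_weyl (fun i j a b => hess_comm c x.ofLp i j a b)
    (fun i j a b => hess_symm_of_admissible hc x.ofLp i j a b) hn
  refine ⟨fun i j k l => ?_, fun i j k l => ?_, fun j l => ?_⟩
  · simp only [testField]; rw [h.antisymm_left]; ring
  · simp only [testField]; rw [h.antisymm_right]; ring
  · simp only [testField, ← Finset.mul_sum, h.trace, mul_zero]

theorem pairing_eq (hn : 3 ≤ n) {c : Coefs n} (hc : Admissible (extend c)) (x : E n) :
    pairing c x = 1 / 4 * (bump n x * ∑ i, ∑ j, ∑ k, ∑ l, weyl (hess c x.ofLp) i j k l ^ 2) := by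
  rw [sum_weyl_sq (fun i j a b => hess_comm c x.ofLp i j a b)
    (fun i j a b => hess_symm_of_admissible hc x.ofLp i j a b) hn]
  simp only [pairing, testField, Finset.mul_sum]
  refine Finset.sum_congr rfl fun i _ => Finset.sum_congr rfl fun j _ =>
    Finset.sum_congr rfl fun k _ => Finset.sum_congr rfl fun l _ => by ring

/-- The integral is a continuous quadratic form in the coefficients, positive on nonzero admissible
ones by `eq_zero_of_weyl_eq_zero`. Its minimum on the admissible part of the unit sphere is the
constant, up to the factor $1/4$ from `pairing_eq`. -/
theorem exists_lower_bound_pairing (hn : 6 ≤ n) : ∃ c₀, 0 < c₀ ∧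
    ∀ c : Coefs n, Admissible (extend c) → c₀ * ‖c‖ ^ 2 ≤ ∫ x, pairing c x := by
  set F : Coefs n → E n → ℝ := fun c x =>
    bump n x * ∑ i, ∑ j, ∑ k, ∑ l, weyl (hess c x.ofLp) i j k l ^ 2 with hF
  have hpair : ∀ c : Coefs n, Admissible (extend c) → ∫ x, pairing c x = 1 / 4 * ∫ x, F c x := by
    intro c hc
    rw [← integral_const_mul]
    exact integral_congr_ae (Filter.Eventually.of_forall fun x => pairing_eq (by omega) hc x)
  have hFc : Continuous F.uncurry := by
    have h := fun i j k l => continuous_weyl_hess (n := n) i j k l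
    have hb : Continuous fun z : Coefs n × E n => bump n z.2 :=
      (bump n).continuous.comp continuous_snd
    simp only [hF, Function.uncurry_def]
    fun_prop
  have hFs : ∀ c, Function.support (F c) ⊆ Metric.ball (ctr n) (1 / 4) := by
    intro c
    rw [show (1 / 4 : ℝ) = (bump n).rOut from rfl, ← (bump n).support_eq]
    exact Function.support_mul_subset_left _ _
  have hFi : ∀ c, ∫ x, F c x = ∫ x in Metric.closedBall (ctr n) (1 / 4), F c x := by
    intro c
    rw [setIntegral_eq_integral_of_forall_compl_eq_zero]
    intro x hx
    by_contra h
    exact hx (Metric.ball_subset_closedBall (hFs c h))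
  have hq : Continuous fun c => ∫ x, F c x := by
    simp only [hFi]
    exact continuous_parametric_integral_of_continuous hFc (isCompact_closedBall _ _)
  have hF0 : ∀ c x, 0 ≤ F c x := fun c x => mul_nonneg (bump n).nonneg (by positivity)
  have hpos : ∀ c : Coefs n, Admissible (extend c) → c ≠ 0 → 0 < ∫ x, F c x := by
    intro c hc hc0
    have hcF : Continuous (F c) := hFc.comp (by fun_prop : Continuous fun x => (c, x))
    have hcs : HasCompactSupport (F c) :=
      HasCompactSupport.of_support_subset_isCompact (isCompact_closedBall (ctr n) (1 / 4))
        ((hFs c).trans Metric.ball_subset_closedBall)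
    by_contra hle
    have hz : ∀ x, F c x = 0 := by
      intro x
      by_contra hx
      exact hle (hcF.integral_pos_of_hasCompactSupport_nonneg_nonzero hcs (hF0 c) hx)
    -- The bump equals $1$ on the Euclidean ball of radius $1/8$; a smaller sup-norm ball inside it
    -- is what the injectivity statement needs.
    have hopen : IsOpen ((WithLp.toLp 2 : (Fin n → ℝ) → E n) ⁻¹' Metric.ball (ctr n) (1 / 8)) :=
      Metric.isOpen_ball.preimage (PiLp.continuous_toLp 2 _)
    obtain ⟨s, hs, hball⟩ := Metric.isOpen_iff.1 hopen (ctr n).ofLp (by simp)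
    refine hc0 (eq_zero_of_weyl_eq_zero hn hc (ctr n).ofLp hs fun x hx i j k l => ?_)
    have h1 : bump n (WithLp.toLp 2 x) = 1 :=
      (bump n).one_of_mem_closedBall (Metric.ball_subset_closedBall (hball hx))
    have h2 := hz (WithLp.toLp 2 x)
    simp only [hF, h1, one_mul] at h2
    rw [Finset.sum_eq_zero_iff_of_nonneg fun _ _ => by positivity] at h2
    have h3 := h2 i (Finset.mem_univ _)
    rw [Finset.sum_eq_zero_iff_of_nonneg fun _ _ => by positivity] at h3
    have h4 := h3 j (Finset.mem_univ _)
    rw [Finset.sum_eq_zero_iff_of_nonneg fun _ _ => by positivity] at h4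
    have h5 := h4 k (Finset.mem_univ _)
    rw [Finset.sum_eq_zero_iff_of_nonneg fun _ _ => by positivity] at h5
    exact pow_eq_zero_iff two_ne_zero |>.1 (h5 l (Finset.mem_univ _))
  have hcpt : IsCompact (Metric.sphere (0 : Coefs n) 1 ∩ {c | Admissible (extend c)}) :=
    (isCompact_sphere _ _).inter_right isClosed_admissible
  have hmin : ∃ c₀, 0 < c₀ ∧ ∀ c ∈ Metric.sphere (0 : Coefs n) 1 ∩ {c | Admissible (extend c)},
      c₀ ≤ ∫ x, F c x := by
    rcases (Metric.sphere (0 : Coefs n) 1 ∩ {c | Admissible (extend c)}).eq_empty_or_nonempty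
      with h | h
    · exact ⟨1, one_pos, by simp [h]⟩
    · obtain ⟨c₁, hc₁, hmin⟩ := hcpt.exists_isMinOn h hq.continuousOn
      refine ⟨_, hpos c₁ hc₁.2 ?_, fun c hc => hmin hc⟩
      rintro rfl
      simpa using hc₁.1
  obtain ⟨c₀, hc₀, hmin⟩ := hmin
  refine ⟨1 / 4 * c₀, by positivity, fun c hc => ?_⟩
  rw [hpair c hc, mul_assoc]
  gcongr
  by_cases h0 : c = 0
  · subst h0
    simpa using integral_nonneg (hF0 0)
  have hn0 : ‖c‖ ≠ 0 := norm_ne_zero_iff.2 h0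
  have h1 := hmin (‖c‖⁻¹ • c) ⟨by simp [norm_smul, hn0], hc.smul _⟩
  have h2 : ∀ x, F (‖c‖⁻¹ • c) x = (‖c‖⁻¹) ^ 2 * F c x := by
    intro x
    simp only [hF, hess_smul, weyl_smul, Pi.smul_apply, smul_eq_mul, mul_pow, ← Finset.mul_sum]
    ring
  simp only [h2] at h1
  rw [integral_const_mul, inv_pow, ← div_eq_inv_mul, le_div_iff₀ (by positivity)] at h1
  exact h1

end HalfSpace

/-! ### The conformal factor, and the Weyl tensor as a derivative of `reducedP`. -/

namespace HalfSpace

variable {n : ℕ} [NeZero n]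

/-- The coordinates centred at the point `-ε e_n`. -/
def shifted (ε : ℝ) (p : Fin n) (x : E n) : ℝ := x p + ε * kron p (nrm n)

/-- The squared distance to the point `-ε e_n`. -/
def shiftedSq (ε : ℝ) (x : E n) : ℝ := ∑ p, shifted ε p x ^ 2

/-- The partial derivatives of `2 / (n - 2) * log v_ε`. -/
noncomputable def logGrad (ε : ℝ) (i : Fin n) (x : E n) : ℝ := -2 * (shifted ε i x / shiftedSq ε x)

section shifted

variable {ε : ℝ} {x : E n}

theorem smoothAt_shifted (p : Fin n) : SmoothAt (shifted ε p) x := by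
  unfold shifted
  exact (smoothAt_coord p).add contDiffWithinAt_const

theorem pd_shifted (i p : Fin n) (hx : x ∈ half n) : pd i (shifted ε p) x = kron p i := by
  have := pd_add (i := i) (smoothAt_coord p (x := x)) (contDiffWithinAt_const (c := ε * kron p (nrm n))) hx
  rw [pd_coord p hx, pd_const, add_zero] at this
  exact this

theorem smoothAt_shiftedSq : SmoothAt (shiftedSq ε) x := by
  unfold shiftedSq
  exact SmoothAt.fun_sum fun p _ => (smoothAt_shifted p).pow 2

theorem pd_shiftedSq (i : Fin n) (hx : x ∈ half n) :
    pd i (shiftedSq ε) x = 2 * shifted ε i x := by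
  have : shiftedSq ε = fun x : E n => ∑ p, shifted ε p x * shifted ε p x := by
    funext x; simp only [shiftedSq, pow_two]
  rw [this, pd_sum (fun p _ => (smoothAt_shifted p).mul (smoothAt_shifted p)) hx]
  simp only [pd_mul (smoothAt_shifted _) (smoothAt_shifted _) hx, pd_shifted _ _ hx]
  simp [kron, Finset.sum_add_distrib, two_mul]

theorem shiftedSq_eq (ε : ℝ) (x : E n) : shiftedSq ε x =
    (ε + x (nrm n)) ^ 2 + ∑ a ∈ Finset.univ.erase (nrm n), x a ^ 2 := by
  rw [shiftedSq, ← Finset.add_sum_erase _ _ (Finset.mem_univ (nrm n))]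
  congr 1
  · simp [shifted, kron, add_comm]
  · refine Finset.sum_congr rfl fun a ha => ?_
    simp [shifted, kron, Finset.ne_of_mem_erase ha]

theorem shiftedSq_eq_norm (ε : ℝ) (x : E n) :
    shiftedSq ε x = ‖x‖ ^ 2 + 2 * ε * x (nrm n) + ε ^ 2 := by
  rw [shiftedSq_eq, EuclideanSpace.norm_sq_eq,
    ← Finset.add_sum_erase _ (fun i => ‖x i‖ ^ 2) (Finset.mem_univ (nrm n))]
  simp only [Real.norm_eq_abs, sq_abs]
  ring

theorem shiftedSq_pos (hε : 0 < ε) (hx : x ∈ half n) : 0 < shiftedSq ε x := by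
  have hx' : 0 ≤ x (nrm n) := hx
  rw [shiftedSq_eq_norm]
  positivity

theorem smoothAt_div {f g : E n → ℝ} (hf : SmoothAt f x) (hg : SmoothAt g x) (h : g x ≠ 0) :
    SmoothAt (fun y => f y / g y) x := by
  simp only [div_eq_mul_inv]
  exact hf.mul (hg.inv h)

theorem smoothAt_logGrad (hε : 0 < ε) (i : Fin n) (hx : x ∈ half n) :
    SmoothAt (logGrad ε i) x := by
  unfold logGrad
  exact contDiffWithinAt_const.mul
    (smoothAt_div (smoothAt_shifted i) smoothAt_shiftedSq (shiftedSq_pos hε hx).ne')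

/-- Since `logGrad` is $\nabla u$ with $u=\frac{2}{n-2}\log v_\epsilon$, this expresses flatness of
$e^{2u}\delta$: the Hessian of $u$ is $du\otimes du$ up to a multiple of $\delta$. -/
theorem pd_logGrad (hε : 0 < ε) (i l : Fin n) (hx : x ∈ half n) :
    pd l (logGrad ε i) x = logGrad ε i x * logGrad ε l x + -2 / shiftedSq ε x * kron i l := by
  have hs := shiftedSq_pos hε hx
  have e : ∀ y ∈ half n, logGrad ε i y * shiftedSq ε y = -2 * shifted ε i y := by
    intro y hy
    rw [logGrad, mul_assoc, div_mul_cancel₀ _ (shiftedSq_pos hε hy).ne']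
  have h1 : pd l (fun y => logGrad ε i y * shiftedSq ε y) x = pd l (fun y => -2 * shifted ε i y) x :=
    pd_congr (by filter_upwards [self_mem_nhdsWithin] with y hy using e y hy) hx
  rw [pd_mul (smoothAt_logGrad hε i hx) smoothAt_shiftedSq hx, pd_shiftedSq l hx,
    pd_const_mul _ (smoothAt_shifted i) hx, pd_shifted l i hx] at h1
  have h2 : shifted ε l x = logGrad ε l x * shiftedSq ε x / -2 := by
    rw [logGrad]; field_simp
  rw [h2] at h1
  field_simp
  linear_combination h1

theorem vEps_eq (ε : ℝ) (x : E n) : vEps ε x =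
    ε ^ (((n : ℝ) - 2) / 2) * shiftedSq ε x ^ (-(((n : ℝ) - 2) / 2)) := by
  rw [vEps, shiftedSq_eq]

theorem smoothAt_vEps (hε : 0 < ε) (hx : x ∈ half n) : SmoothAt (vEps ε) x := by
  have : vEps ε = fun x : E n => ε ^ (((n : ℝ) - 2) / 2) *
      shiftedSq ε x ^ (-(((n : ℝ) - 2) / 2)) := funext fun x => vEps_eq ε x
  rw [this]
  exact contDiffWithinAt_const.mul
    (ContDiffWithinAt.rpow_const_of_ne smoothAt_shiftedSq (shiftedSq_pos hε hx).ne')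

theorem pd_vEps (hε : 0 < ε) (i : Fin n) (hx : x ∈ half n) :
    pd i (vEps ε) x = ((n : ℝ) - 2) / 2 * logGrad ε i x * vEps ε x := by
  have hs := shiftedSq_pos hε hx
  have : vEps ε = fun x : E n => ε ^ (((n : ℝ) - 2) / 2) *
      shiftedSq ε x ^ (-(((n : ℝ) - 2) / 2)) := funext fun x => vEps_eq ε x
  rw [this, pd_const_mul _ (ContDiffWithinAt.rpow_const_of_ne smoothAt_shiftedSq hs.ne') hx]
  have h1 : HasFDerivWithinAt (shiftedSq ε) (fderivWithin ℝ (shiftedSq ε) (half n) x) (half n) x :=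
    (SmoothAt.differentiable smoothAt_shiftedSq).hasFDerivWithinAt
  have h2 := h1.rpow_const (p := -(((n : ℝ) - 2) / 2)) (Or.inl hs.ne')
  have h3 : pd i (fun y => shiftedSq ε y ^ (-(((n : ℝ) - 2) / 2))) x =
      (-(((n : ℝ) - 2) / 2) * shiftedSq ε x ^ (-(((n : ℝ) - 2) / 2) - 1)) *
        pd i (shiftedSq ε) x := by
    rw [pd, h2.fderivWithin (uniqueDiffOn_half x hx)]
    simp [pd]
  rw [h3, pd_shiftedSq i hx, Real.rpow_sub_one hs.ne', logGrad]
  ring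

end shifted

section tensors

variable {h : MatField n} {V : E n → E n} {ε : ℝ} {x : E n}

/-- The tensor `P` divided by `v_ε`. -/
noncomputable def reducedP (ε : ℝ) (h : MatField n) (V : E n → E n) (i k l : Fin n) (x : E n) : ℝ :=
  pd l (tensorT h V i k) x - logGrad ε i x * tensorT h V k l x - logGrad ε k x * tensorT h V i l x
    + (∑ p, logGrad ε p x * tensorT h V i p x) * kron k l
    + (∑ p, logGrad ε p x * tensorT h V k p x) * kron i l

/-- After division by $v_\epsilon$ only $\nabla u$ remains, and the result is $e^{-2u}$ times the
covariant derivative of $e^{2u}T$ for $e^{2u}\delta$. -/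
theorem tensorP_eq (hn : 3 ≤ n) (hε : 0 < ε) (hx : x ∈ half n) (i k l : Fin n) :
    tensorP ε h V i k l x = vEps ε x * reducedP ε h V i k l x := by
  have hn' : (n : ℝ) - 2 ≠ 0 := by
    have : (3 : ℝ) ≤ n := by exact_mod_cast hn
    linarith
  have e : ∀ j, ∑ p, ((n : ℝ) - 2) / 2 * logGrad ε p x * vEps ε x * tensorT h V j p x =
      ((n : ℝ) - 2) / 2 * vEps ε x * ∑ p, logGrad ε p x * tensorT h V j p x := by
    intro j
    rw [Finset.mul_sum]
    exact Finset.sum_congr rfl fun p _ => by ring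
  simp only [tensorP, reducedP, pd_vEps hε _ hx, e]
  field_simp

theorem smoothAt_taylorH (i k : Fin n) : SmoothAt (taylorH h i k) x := by
  have : taylorH h i k = fun x : E n =>
      MvPolynomial.eval (fun j => x j) (polyOf (multiIdx n) (coef h i k)) := by
    funext x
    rw [eval_polyOf]; rfl
  rw [this]
  exact (contDiff_eval _).contDiffWithinAt

theorem smoothAt_component (hV : ContDiffOn ℝ ∞ V (half n)) (i : Fin n) (hx : x ∈ half n) :
    SmoothAt (fun y => V y i) x :=
  contDiffWithinAt_piLp 2 |>.1 (hV x hx) i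

theorem smoothAt_divV (hV : ContDiffOn ℝ ∞ V (half n)) (hx : x ∈ half n) : SmoothAt (divV V) x := by
  unfold divV
  exact SmoothAt.fun_sum fun i _ => SmoothAt.pd (smoothAt_component hV i hx) hx

theorem smoothAt_tensorS (hV : ContDiffOn ℝ ∞ V (half n)) (i k : Fin n) (hx : x ∈ half n) :
    SmoothAt (tensorS V i k) x := by
  unfold tensorS
  exact ((SmoothAt.pd (smoothAt_component hV k hx) hx).add
    (SmoothAt.pd (smoothAt_component hV i hx) hx)).sub
      ((contDiffWithinAt_const.mul (smoothAt_divV hV hx)).mul contDiffWithinAt_const)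

theorem smoothAt_tensorT (hV : ContDiffOn ℝ ∞ V (half n)) (i k : Fin n) (hx : x ∈ half n) :
    SmoothAt (tensorT h V i k) x := by
  unfold tensorT
  exact (smoothAt_taylorH i k).sub (smoothAt_tensorS hV i k hx)

theorem smoothAt_contraction (hε : 0 < ε) (hV : ContDiffOn ℝ ∞ V (half n)) (i : Fin n)
    (hx : x ∈ half n) : SmoothAt (fun y => ∑ p, logGrad ε p y * tensorT h V i p y) x :=
  SmoothAt.fun_sum fun p _ => (smoothAt_logGrad hε p hx).mul (smoothAt_tensorT hV i p hx)

theorem smoothAt_reducedP (hε : 0 < ε) (hV : ContDiffOn ℝ ∞ V (half n)) (i k l : Fin n)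
    (hx : x ∈ half n) : SmoothAt (reducedP ε h V i k l) x := by
  unfold reducedP
  exact (((((smoothAt_tensorT hV i k hx).pd hx).sub
    ((smoothAt_logGrad hε i hx).mul (smoothAt_tensorT hV k l hx))).sub
    ((smoothAt_logGrad hε k hx).mul (smoothAt_tensorT hV i l hx))).add
    ((smoothAt_contraction hε hV i hx).mul contDiffWithinAt_const)).add
    ((smoothAt_contraction hε hV k hx).mul contDiffWithinAt_const)

theorem tensorS_symm (i k : Fin n) : tensorS V i k = tensorS V k i := by
  funext x
  simp only [tensorS, kron_comm i k]; ring

theorem tensorT_symm (hs : ∀ i k, taylorH h i k = taylorH h k i) (i k : Fin n) :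
    tensorT h V i k = tensorT h V k i := by
  funext x
  simp only [tensorT, hs i k, tensorS_symm i k]

/-- Conformal invariance of the linearised Weyl tensor, paired with a Weyl-like tensor. -/
theorem IsWeylLike.sum_pd_reducedP {Z : Fin n → Fin n → Fin n → Fin n → ℝ} (hZ : IsWeylLike Z)
    (hε : 0 < ε) (hV : ContDiffOn ℝ ∞ V (half n)) (hs : ∀ i k, taylorH h i k = taylorH h k i)
    (hx : x ∈ half n) :
    ∑ i, ∑ j, ∑ k, ∑ l, Z i j k l * (pd l (reducedP ε h V i k j) x
      + logGrad ε i x * reducedP ε h V j k l x) =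
    ∑ i, ∑ j, ∑ k, ∑ l, Z i j k l * pd j (pd l (taylorH h i k)) x := by
  set T := tensorT h V with hT
  set f := fun i => logGrad ε i x with hf
  set q : Fin n → E n → ℝ := fun i y => ∑ p, logGrad ε p y * tensorT h V i p y with hq
  have Ts : ∀ i k, T i k = T k i := tensorT_symm hs
  have sT : ∀ i k, ∀ y ∈ half n, SmoothAt (T i k) y := fun i k y hy => smoothAt_tensorT hV i k hy
  have sq : ∀ i, SmoothAt (q i) x := fun i => smoothAt_contraction hε hV i hx
  have sf : ∀ i, SmoothAt (logGrad ε i) x := fun i => smoothAt_logGrad hε i hx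
  have dP : ∀ i k j l, pd l (reducedP ε h V i k j) x = pd j (pd l (T i k)) x
      - (f i * pd l (T k j) x + T k j x * (f i * f l + -2 / shiftedSq ε x * kron i l))
      - (f k * pd l (T i j) x + T i j x * (f k * f l + -2 / shiftedSq ε x * kron k l))
      + pd l (q i) x * kron k j + pd l (q k) x * kron i j := by
    intro i k j l
    have a1 := (sT i k x hx).pd (i := j) hx
    have a2 := (sf i).mul (sT k j x hx)
    have a3 := (sf k).mul (sT i j x hx)
    have a4 := (sq i).mul (contDiffWithinAt_const (c := (kron k j : ℝ)))
    have a5 := (sq k).mul (contDiffWithinAt_const (c := (kron i j : ℝ)))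
    have : reducedP ε h V i k j = fun x => pd j (T i k) x - logGrad ε i x * T k j x
      - logGrad ε k x * T i j x + q i x * kron k j + q k x * kron i j := rfl
    rw [this, pd_add (((a1.sub a2).sub a3).add a4) a5 hx, pd_add ((a1.sub a2).sub a3) a4 hx,
      pd_sub (a1.sub a2) a3 hx, pd_sub a1 a2 hx, pd_mul (sf i) (sT k j x hx) hx,
      pd_mul (sf k) (sT i j x hx) hx, pd_mul_const _ (sq i) hx, pd_mul_const _ (sq k) hx,
      pd_logGrad hε i l hx, pd_logGrad hε k l hx, pd_comm (sT i k x hx) hx l j]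
  have dT : ∀ i k j l, pd j (pd l (T i k)) x = pd j (pd l (taylorH h i k)) x
      - (pd j (pd l (pd i fun y => V y k)) x + pd j (pd l (pd k fun y => V y i)) x
        - 2 / (n : ℝ) * pd j (pd l (divV V)) x * kron i k) := by
    intro i k j l
    have b1 : ∀ i k, ∀ y ∈ half n, SmoothAt (pd i fun z => V z k) y := fun i k y hy =>
      SmoothAt.pd (smoothAt_component hV k hy) hy
    have b2 : ∀ y ∈ half n, SmoothAt (divV V) y := fun y hy => smoothAt_divV hV hy
    have b3 : ∀ y ∈ half n, SmoothAt (fun y => 2 / (n : ℝ) * divV V y) y := fun y hy =>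
      contDiffWithinAt_const.mul (b2 y hy)
    have c1 : ∀ y ∈ half n, pd l (T i k) y = pd l (taylorH h i k) y
      - (pd l (pd i fun y => V y k) y + pd l (pd k fun y => V y i) y
        - 2 / (n : ℝ) * pd l (divV V) y * kron i k) := by
      intro y hy
      have e1 : pd l (T i k) y = _ := pd_sub (smoothAt_taylorH i k) (smoothAt_tensorS hV i k hy) hy
      have e2 : pd l (tensorS V i k) y = _ := pd_sub ((b1 i k y hy).add (b1 k i y hy))
        ((b3 y hy).mul (contDiffWithinAt_const (c := (kron i k : ℝ)))) hy
      rw [e1, e2, pd_add (b1 i k y hy) (b1 k i y hy) hy, pd_mul_const _ (b3 y hy) hy,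
        pd_const_mul _ (b2 y hy) hy]
    rw [pd_congr (g := fun y => pd l (taylorH h i k) y
      - (pd l (pd i fun y => V y k) y + pd l (pd k fun y => V y i) y
        - 2 / (n : ℝ) * pd l (divV V) y * kron i k))
      (by filter_upwards [self_mem_nhdsWithin] with y hy using c1 y hy) hx]
    have d1 := (smoothAt_taylorH (h := h) i k (x := x)).pd (i := l) hx
    have d2 := (b1 i k x hx).pd (i := l) hx
    have d3 := (b1 k i x hx).pd (i := l) hx
    have d4 := (b2 x hx).pd (i := l) hx
    have d5 : SmoothAt (fun y => 2 / (n : ℝ) * pd l (divV V) y) x := contDiffWithinAt_const.mul d4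
    have d6 := d5.mul (contDiffWithinAt_const (c := (kron i k : ℝ)))
    rw [pd_sub d1 ((d2.add d3).sub d6) hx, pd_sub (d2.add d3) d6 hx, pd_add d2 d3 hx,
      pd_mul_const _ d5 hx, pd_const_mul _ d4 hx]
  -- The correction $f_iP_{jk,l}/v_\epsilon$ cancels the term $f_i\partial_lT_{jk}$ and completes
  -- $f_if_lT_{jk}$ to an expression symmetric in $k,l$. Every summand but the first is now
  -- symmetric in $i,j$ or in $k,l$, or is a trace, and pairs to zero with $Z$.
  have e : ∀ i j k l, Z i j k l * (pd l (reducedP ε h V i k j) x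
      + logGrad ε i x * reducedP ε h V j k l x) =
      Z i j k l * pd j (pd l (taylorH h i k)) x
      - Z i j k l * pd j (pd l (pd i fun y => V y k)) x
      - Z i j k l * pd j (pd l (pd k fun y => V y i)) x
      + Z i j k l * (kron i k * (2 / (n : ℝ) * pd j (pd l (divV V)) x))
      - Z i j k l * (f i * (T j k x * f l + T j l x * f k))
      - Z i j k l * (kron i l * (T j k x * (-2 / shiftedSq ε x)))
      - Z i j k l * (f k * pd l (T i j) x)
      - Z i j k l * (T i j x * (f k * f l + -2 / shiftedSq ε x * kron k l))
      + Z i j k l * (kron j k * pd l (q i) x)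
      + Z i j k l * (pd l (q k) x * kron i j)
      - Z i j k l * (f i * f j * T k l x)
      + Z i j k l * (f i * q j x * kron k l)
      + Z i j k l * (kron j l * (f i * q k x)) := by
    intro i j k l
    have e1 : reducedP ε h V j k l x = pd l (T j k) x - f j * T k l x - f k * T j l x
      + q j x * kron k l + q k x * kron j l := rfl
    rw [dP, dT, e1, Ts k j, kron_comm k j]
    ring
  simp only [e, Finset.sum_add_distrib, Finset.sum_sub_distrib]
  -- Commuting third derivatives make the two $V$ terms symmetric in $i,j$ and in $k,l$
  -- respectively; the divergence term is a trace. This is how $V$ disappears.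
  have cV : ∀ i j l k, pd j (pd l (pd i fun y => V y k)) x = pd i (pd l (pd j fun y => V y k)) x := by
    intro i j l k
    have b : ∀ y ∈ half n, SmoothAt (fun z => V z k) y := fun y hy => smoothAt_component hV k hy
    have c : ∀ a b' : Fin n, ∀ m : Fin n, pd m (pd a (pd b' fun y => V y k)) x =
        pd m (pd b' (pd a fun y => V y k)) x := fun a b' m =>
      pd_congr (by filter_upwards [self_mem_nhdsWithin] with y hy using pd_comm (b y hy) hy a b') hx
    rw [c l i j, pd_comm (SmoothAt.pd (b x hx) hx) hx j i, c j l i]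
  have cV' : ∀ i j l k, pd j (pd l (pd k fun y => V y i)) x = pd j (pd k (pd l fun y => V y i)) x := by
    intro i j l k
    exact pd_congr (by
      filter_upwards [self_mem_nhdsWithin] with y hy using
        pd_comm (smoothAt_component hV i hy) hy l k) hx
  rw [hZ.sum_symm_left (F := fun i j k l => pd j (pd l (pd i fun y => V y k)) x)
      (fun i j k l => cV i j l k),
    hZ.sum_symm_right (F := fun i j k l => pd j (pd l (pd k fun y => V y i)) x)
      (fun i j k l => cV' i j l k),
    hZ.sum_kron_ik (fun j l => 2 / (n : ℝ) * pd j (pd l (divV V)) x),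
    hZ.sum_symm_right (F := fun i j k l => f i * (T j k x * f l + T j l x * f k))
      (fun i j k l => by ring),
    hZ.sum_kron_il (fun j k => T j k x * (-2 / shiftedSq ε x)),
    hZ.sum_symm_left (F := fun i j k l => f k * pd l (T i j) x) (fun i j k l => by rw [Ts]),
    hZ.sum_symm_right (F := fun i j k l => T i j x * (f k * f l + -2 / shiftedSq ε x * kron k l))
      (fun i j k l => by rw [kron_comm]; ring),
    hZ.sum_kron_jk (fun i l => pd l (q i) x),
    hZ.sum_symm_left (F := fun i j k l => pd l (q k) x * kron i j)
      (fun i j k l => by rw [kron_comm]),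
    hZ.sum_symm_left (F := fun i j k l => f i * f j * T k l x) (fun i j k l => by ring),
    hZ.sum_symm_right (F := fun i j k l => f i * q j x * kron k l)
      (fun i j k l => by rw [kron_comm]),
    hZ.sum_kron_jl (fun i k => f i * q k x)]
  ring

end tensors

end HalfSpace

/-! ### Localisation at scale $r$ and integration by parts. -/

namespace HalfSpace

open MeasureTheory

variable {n : ℕ} [NeZero n]

theorem taylorH_eq_eval (h : MatField n) (i k : Fin n) (x : E n) :
    taylorH h i k x = MvPolynomial.eval x.ofLp (polyEntry i k (rescale 1 (coef h))) := by
  rw [polyEntry_eq_polyOf, eval_polyOf, taylorH]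
  refine Finset.sum_congr rfl fun α hα => ?_
  rw [extend, dif_pos hα, rescale, one_pow, one_mul]

theorem pd_pd_taylorH (h : MatField n) (i k j l : Fin n) {x : E n} (hx : x ∈ half n) :
    pd j (pd l (taylorH h i k)) x = hess (rescale 1 (coef h)) x.ofLp j l i k := by
  have e : taylorH h i k = fun x : E n =>
      MvPolynomial.eval (fun j => x j) (polyEntry i k (rescale 1 (coef h))) :=
    funext fun x => taylorH_eq_eval h i k x
  rw [e, pd_congr (g := fun x : E n => MvPolynomial.eval (fun j => x j)
    (MvPolynomial.pderiv l (polyEntry i k (rescale 1 (coef h)))))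
    (by filter_upwards [self_mem_nhdsWithin] with y hy using pd_eval _ hy) hx, pd_eval _ hx]
  rfl

theorem taylorH_symm {h : MatField n} (hc : Admissible (coef h)) (i k : Fin n) :
    taylorH h i k = taylorH h k i := by
  funext x
  exact Finset.sum_congr rfl fun α hα => by rw [hc.symm i k α hα]

section core

/-- The support of the rescaled test fields. -/
def core (n : ℕ) [NeZero n] (r : ℝ) : Set (E n) := Metric.closedBall (r • ctr n) (r / 4)

variable {r ε : ℝ} {x : E n}

theorem mem_core_iff (hr : 0 < r) : x ∈ core n r ↔ r⁻¹ • x ∈ Metric.closedBall (ctr n) (1 / 4) := by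
  have : x - r • ctr n = r • (r⁻¹ • x - ctr n) := by
    rw [smul_sub, smul_smul, mul_inv_cancel₀ hr.ne', one_smul]
  rw [core, mem_closedBall_iff_norm, mem_closedBall_iff_norm, this, norm_smul,
    Real.norm_of_nonneg hr.le, div_eq_mul_one_div r 4]
  exact mul_le_mul_iff_right₀ hr

theorem norm_ctr : ‖ctr n‖ = 3 / 2 := by
  rw [ctr, PiLp.norm_single]; norm_num

theorem norm_mem_core (hr : 0 < r) (hx : x ∈ core n r) :
    5 / 4 * r ≤ ‖x‖ ∧ ‖x‖ ≤ 7 / 4 * r := by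
  have h1 : ‖x - r • ctr n‖ ≤ r / 4 := mem_closedBall_iff_norm.1 hx
  have h2 : ‖r • ctr n‖ = r * (3 / 2) := by rw [norm_smul, norm_ctr, Real.norm_of_nonneg hr.le]
  have h3 := norm_sub_norm_le (r • ctr n) x
  have h4 := norm_sub_norm_le x (r • ctr n)
  rw [norm_sub_rev] at h3
  constructor <;> linarith

theorem core_subset_openHalf (hr : 0 < r) : core n r ⊆ openHalf n := by
  intro x hx
  have h1 : ‖x - r • ctr n‖ ≤ r / 4 := mem_closedBall_iff_norm.1 hx
  have h2 := (PiLp.norm_apply_le (x - r • ctr n) (nrm n)).trans h1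
  have h3 : (x - r • ctr n) (nrm n) = x (nrm n) - r * (3 / 2) := by simp [ctr]
  rw [h3, Real.norm_eq_abs] at h2
  have := (abs_le.1 h2).1
  change 0 < x (nrm n)
  linarith

theorem core_subset_half (hr : 0 < r) : core n r ⊆ half n :=
  (core_subset_openHalf hr).trans openHalf_subset_half

theorem isCompact_core : IsCompact (core n r) := isCompact_closedBall _ _

/-- On the core $|x|$ is between $\frac54r$ and $\frac74r$; with $\epsilon\le r$ the distance to
$-\epsilon e_n$ is comparable to $r$, uniformly in $\epsilon$. -/
theorem shiftedSq_mem_core (hε : 0 < ε) (hεr : ε ≤ r) (hx : x ∈ core n r) :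
    r ^ 2 ≤ shiftedSq ε x ∧ shiftedSq ε x ≤ 9 * r ^ 2 := by
  have hr : 0 < r := hε.trans_le hεr
  obtain ⟨h1, h2⟩ := norm_mem_core hr hx
  have h3 : 0 ≤ x (nrm n) := core_subset_half hr hx
  have h4 : x (nrm n) ≤ 7 / 4 * r :=
    ((le_abs_self _).trans (PiLp.norm_apply_le x (nrm n))).trans h2
  rw [shiftedSq_eq_norm]
  constructor
  · nlinarith [mul_nonneg hε.le h3]
  · nlinarith [mul_le_mul hεr h4 h3 hr.le, norm_nonneg x]

theorem abs_logGrad_le (hε : 0 < ε) (hεr : ε ≤ r) (hx : x ∈ core n r) (i : Fin n) :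
    |logGrad ε i x| ≤ 2 / r := by
  have hr : 0 < r := hε.trans_le hεr
  have h1 := (shiftedSq_mem_core hε hεr hx).1
  have hs : 0 < shiftedSq ε x := lt_of_lt_of_le (by positivity) h1
  have h2 : shifted ε i x ^ 2 ≤ shiftedSq ε x :=
    Finset.single_le_sum (f := fun p => shifted ε p x ^ 2) (fun p _ => sq_nonneg _)
      (Finset.mem_univ i)
  refine abs_le_of_sq_le_sq ?_ (by positivity)
  have : logGrad ε i x ^ 2 = 4 * shifted ε i x ^ 2 / shiftedSq ε x ^ 2 := by
    rw [logGrad]; field_simp; ring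
  rw [this, div_pow, div_le_div_iff₀ (by positivity) (by positivity)]
  nlinarith [mul_le_mul h2 h1 (by positivity) hs.le]

theorem inv_vEps_sq_le (hn : 2 ≤ n) (hε : 0 < ε) (hεr : ε ≤ r) (hx : x ∈ core n r) :
    ε ^ (n - 2) ≤ (9 * r ^ 2) ^ (n - 2) * vEps ε x ^ 2 := by
  have hr : 0 < r := hε.trans_le hεr
  obtain ⟨h1, h2⟩ := shiftedSq_mem_core hε hεr hx
  have hs : 0 < shiftedSq ε x := lt_of_lt_of_le (by positivity) h1
  have hcast : ((n : ℝ) - 2) = ((n - 2 : ℕ) : ℝ) := by push_cast [hn]; ring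
  have e : vEps ε x ^ 2 = ε ^ (n - 2) * (shiftedSq ε x ^ (n - 2))⁻¹ := by
    rw [vEps_eq, mul_pow, ← Real.rpow_natCast, ← Real.rpow_mul hε.le, ← Real.rpow_natCast,
      ← Real.rpow_mul hs.le, ← Real.rpow_natCast, ← Real.rpow_natCast, ← Real.rpow_neg hs.le,
      ← hcast]
    congr 2 <;> push_cast <;> ring
  have h3 : shiftedSq ε x ^ (n - 2) ≤ (9 * r ^ 2) ^ (n - 2) := pow_le_pow_left₀ hs.le h2 _
  rw [e]
  have h4 : 0 < shiftedSq ε x ^ (n - 2) := pow_pos hs _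
  calc ε ^ (n - 2) = shiftedSq ε x ^ (n - 2) * (ε ^ (n - 2) * (shiftedSq ε x ^ (n - 2))⁻¹) := by
        field_simp
    _ ≤ _ := by gcongr

end core

section scaled

variable {r : ℝ}

/-- The test field at scale `r`. -/
noncomputable def scaledField (r : ℝ) (c : Coefs n) (i j k l : Fin n) (x : E n) : ℝ :=
  testField c i j k l (r⁻¹ • x)

theorem contDiff_scaledField (c : Coefs n) (i j k l : Fin n) :
    ContDiff ℝ ∞ (scaledField r c i j k l) :=
  (contDiff_testField c i j k l).comp (contDiff_const_smul r⁻¹)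

theorem scaledField_eq_zero (hr : 0 < r) (c : Coefs n) (i j k l : Fin n) {x : E n}
    (hx : x ∉ core n r) : scaledField r c i j k l x = 0 := by
  rw [mem_core_iff hr] at hx
  have h : r⁻¹ • x ∉ tsupport (testField c i j k l) := fun h => hx (tsupport_testField c i j k l h)
  exact (image_eq_zero_of_notMem_tsupport (f := testField c i j k l) h :)

theorem fderiv_scaledField (c : Coefs n) (i j k l p : Fin n) (x : E n) :
    fderiv ℝ (scaledField r c i j k l) x (EuclideanSpace.single p 1) =
      r⁻¹ * fderiv ℝ (testField c i j k l) (r⁻¹ • x) (EuclideanSpace.single p 1) := by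
  have h1 : HasFDerivAt (testField c i j k l) (fderiv ℝ (testField c i j k l) (r⁻¹ • x))
      (r⁻¹ • x) :=
    ((contDiff_testField c i j k l).differentiable (by simp) _).hasFDerivAt
  have h2 : HasFDerivAt (fun x : E n => r⁻¹ • x) (r⁻¹ • ContinuousLinearMap.id ℝ (E n)) x :=
    (hasFDerivAt_id x).const_smul r⁻¹
  have h3 : HasFDerivAt (scaledField r c i j k l) _ x := h1.comp x h2
  rw [h3.fderiv]
  simp

theorem fderiv_scaledField_eq_zero (hr : 0 < r) (c : Coefs n) (i j k l p : Fin n) {x : E n}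
    (hx : x ∉ core n r) :
    fderiv ℝ (scaledField r c i j k l) x (EuclideanSpace.single p 1) = 0 := by
  rw [mem_core_iff hr] at hx
  rw [fderiv_scaledField, fderiv_of_notMem_tsupport ℝ fun h => hx (tsupport_testField c i j k l h)]
  simp

theorem integrable_mul_of_core (hr : 0 < r) {φ g : E n → ℝ} (hφ : Continuous φ)
    (h0 : ∀ x, x ∉ core n r → φ x = 0) (hg : ContinuousOn g (half n)) :
    Integrable fun x => φ x * g x := by
  rw [← integrableOn_iff_integrable_of_support_subset (s := core n r)]
  · exact ((hφ.continuousOn).mul (hg.mono (core_subset_half hr))).integrableOn_compact isCompact_core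
  · intro x hx
    by_contra h
    exact hx (by simp [h0 x h])

theorem tsupport_scaledField (hr : 0 < r) (c : Coefs n) (i j k l : Fin n) :
    tsupport (scaledField r c i j k l) ⊆ core n r :=
  closure_minimal (fun x hx => by
    by_contra h
    exact hx (scaledField_eq_zero hr c i j k l h)) isCompact_core.isClosed

/-- The test field is supported in the open half space, so there is no boundary term. -/
theorem integral_scaledField_mul_pd (hr : 0 < r) (c : Coefs n) (i j k l p : Fin n) {g : E n → ℝ}
    (hg : ∀ x ∈ half n, SmoothAt g x) :
    ∫ x, scaledField r c i j k l x * pd p g x =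
      - ∫ x, fderiv ℝ (scaledField r c i j k l) x (EuclideanSpace.single p 1) * g x := by
  have hgc : ContinuousOn g (half n) := fun x hx => (hg x hx).continuousWithinAt
  have hpc : ContinuousOn (pd p g) (half n) := fun x hx =>
    ((hg x hx).pd (i := p) hx).continuousWithinAt
  have hZ := contDiff_scaledField (r := r) c i j k l
  have e : ∀ x, scaledField r c i j k l x * pd p g x =
      scaledField r c i j k l x * fderiv ℝ g x (EuclideanSpace.single p 1) := by
    intro x
    by_cases hx : x ∈ core n r
    · rw [pd_eq_fderiv (core_subset_openHalf hr hx)]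
    · rw [scaledField_eq_zero hr c i j k l hx, zero_mul, zero_mul]
  have hi := integrable_mul_of_core hr hZ.continuous
    (fun x hx => scaledField_eq_zero hr c i j k l hx) hpc
  simp only [e] at hi ⊢
  refine integral_mul_fderiv_eq_neg_fderiv_mul_of_integrable ?_ hi ?_ ?_ ?_
  · exact integrable_mul_of_core hr ((hZ.continuous_fderiv (by simp)).clm_apply continuous_const)
      (fun x hx => fderiv_scaledField_eq_zero hr c i j k l p hx) hgc
  · exact integrable_mul_of_core hr hZ.continuous
      (fun x hx => scaledField_eq_zero hr c i j k l hx) hgc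
  · exact fun x _ => hZ.differentiable (by simp) x
  · intro x hx
    have hx' := core_subset_openHalf hr (tsupport_scaledField hr c i j k l hx)
    exact (SmoothAt.differentiable (hg x (openHalf_subset_half hx'))).differentiableAt
      (half_mem_nhds hx')

end scaled

end HalfSpace

/-! ### The estimate at a single scale. -/

namespace HalfSpace

open MeasureTheory
open scoped Pointwise

variable {n : ℕ} [NeZero n]

theorem continuousOn_normSqP (hn : 3 ≤ n) {h : MatField n} {V : E n → E n} {ε : ℝ} (hε : 0 < ε)
    (hV : ContDiffOn ℝ ∞ V (half n)) : ContinuousOn (normSqP ε h V) (half n) := by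
  intro x hx
  have : ∀ i k l, ContinuousWithinAt (tensorP ε h V i k l) (half n) x := by
    intro i k l
    refine ContinuousWithinAt.congr (f := fun x => vEps ε x * reducedP ε h V i k l x) ?_
      (fun y hy => tensorP_eq hn hε hy i k l) (tensorP_eq hn hε hx i k l)
    exact ((smoothAt_vEps hε hx).mul (smoothAt_reducedP hε hV i k l hx)).continuousWithinAt
  exact tendsto_finsetSum _ fun i _ => tendsto_finsetSum _ fun k _ => tendsto_finsetSum _ fun l _ =>
    (this i k l).pow 2

/-- The density of the localised pairing after integration by parts. -/
noncomputable def density (r ε : ℝ) (h : MatField n) (V : E n → E n) (c : Coefs n) (x : E n) : ℝ :=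
  ∑ i, ∑ j, ∑ k, ∑ l, (scaledField r c i j k l x * logGrad ε i x * reducedP ε h V j k l x
    - fderiv ℝ (scaledField r c i j k l) x (EuclideanSpace.single l 1) * reducedP ε h V i k j x)

theorem density_eq_zero {r : ℝ} (hr : 0 < r) (ε : ℝ) (h : MatField n) (V : E n → E n) (c : Coefs n)
    {x : E n} (hx : x ∉ core n r) : density r ε h V c x = 0 := by
  refine Finset.sum_eq_zero fun i _ => Finset.sum_eq_zero fun j _ => Finset.sum_eq_zero fun k _ =>
    Finset.sum_eq_zero fun l _ => ?_
  rw [scaledField_eq_zero hr c i j k l hx, fderiv_scaledField_eq_zero hr c i j k l l hx]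
  ring

/-- Integration by parts undoes the shift of the derivative, and `IsWeylLike.sum_pd_reducedP`
replaces the result by the pairing with second derivatives of $H$. The power is $r^n$ from the
change of variables times $r^{-2}$ from `hess_rescale`. -/
theorem integral_density (hn : 3 ≤ n) {h : MatField n} (hc : Admissible (coef h)) {V : E n → E n}
    (hV : ContDiffOn ℝ ∞ V (half n)) {r ε : ℝ} (hr : 0 < r) (hε : 0 < ε) :
    Integrable (density r ε h V (rescale r (coef h))) ∧
    ∫ x, density r ε h V (rescale r (coef h)) x =
      r ^ (n - 2) * ∫ x, pairing (rescale r (coef h)) x := by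
  set c := rescale r (coef h) with hcdef
  have hca : Admissible (extend c) := hc.rescale r
  have sP : ∀ i k l, ∀ x ∈ half n, SmoothAt (reducedP ε h V i k l) x := fun i k l x hx =>
    smoothAt_reducedP hε hV i k l hx
  have cP : ∀ i k l, ContinuousOn (reducedP ε h V i k l) (half n) := fun i k l x hx =>
    (sP i k l x hx).continuousWithinAt
  have cPd : ∀ i k l p, ContinuousOn (pd p (reducedP ε h V i k l)) (half n) := fun i k l p x hx =>
    ((sP i k l x hx).pd (i := p) hx).continuousWithinAt
  have cf : ∀ i, ContinuousOn (logGrad ε i) (half n) := fun i x hx =>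
    (smoothAt_logGrad hε i hx).continuousWithinAt
  have cZ : ∀ i j k l, Continuous (scaledField r c i j k l) := fun i j k l =>
    (contDiff_scaledField c i j k l).continuous
  have zZ : ∀ i j k l, ∀ x, x ∉ core n r → scaledField r c i j k l x = 0 := fun i j k l x hx =>
    scaledField_eq_zero hr c i j k l hx
  have I1 : ∀ i j k l, Integrable fun x =>
      scaledField r c i j k l x * (logGrad ε i x * reducedP ε h V j k l x) := fun i j k l =>
    integrable_mul_of_core hr (cZ i j k l) (zZ i j k l) ((cf i).mul (cP j k l))
  have I2 : ∀ i j k l, Integrable fun x =>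
      fderiv ℝ (scaledField r c i j k l) x (EuclideanSpace.single l 1) * reducedP ε h V i k j x :=
    fun i j k l => integrable_mul_of_core hr
      (((contDiff_scaledField c i j k l).continuous_fderiv (by simp)).clm_apply continuous_const)
      (fun x hx => fderiv_scaledField_eq_zero hr c i j k l l hx) (cP i k j)
  have I3 : ∀ i j k l, Integrable fun x =>
      scaledField r c i j k l x * pd l (reducedP ε h V i k j) x := fun i j k l =>
    integrable_mul_of_core hr (cZ i j k l) (zZ i j k l) (cPd i k j l)
  have I4 : ∀ i j k l, Integrable fun x =>
      scaledField r c i j k l x * logGrad ε i x * reducedP ε h V j k l x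
    - fderiv ℝ (scaledField r c i j k l) x (EuclideanSpace.single l 1) * reducedP ε h V i k j x := by
    intro i j k l
    have := (I1 i j k l).sub (I2 i j k l)
    simp only [← mul_assoc] at this
    exact this
  have I5 : ∀ i j k l, Integrable fun x => scaledField r c i j k l x *
      (pd l (reducedP ε h V i k j) x + logGrad ε i x * reducedP ε h V j k l x) := by
    intro i j k l
    simp only [mul_add]
    exact (I3 i j k l).add (I1 i j k l)
  refine ⟨integrable_finsetSum _ fun i _ => integrable_finsetSum _ fun j _ =>
    integrable_finsetSum _ fun k _ => integrable_finsetSum _ fun l _ => I4 i j k l, ?_⟩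
  have e1 : ∫ x, density r ε h V c x = ∫ x, ∑ i, ∑ j, ∑ k, ∑ l, scaledField r c i j k l x *
      (pd l (reducedP ε h V i k j) x + logGrad ε i x * reducedP ε h V j k l x) := by
    simp only [density]
    rw [integral_finsetSum _ fun i _ => integrable_finsetSum _ fun j _ =>
        integrable_finsetSum _ fun k _ => integrable_finsetSum _ fun l _ => I4 i j k l,
      integral_finsetSum _ fun i _ => integrable_finsetSum _ fun j _ =>
        integrable_finsetSum _ fun k _ => integrable_finsetSum _ fun l _ => I5 i j k l]
    refine Finset.sum_congr rfl fun i _ => ?_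
    rw [integral_finsetSum _ fun j _ =>
        integrable_finsetSum _ fun k _ => integrable_finsetSum _ fun l _ => I4 i j k l,
      integral_finsetSum _ fun j _ =>
        integrable_finsetSum _ fun k _ => integrable_finsetSum _ fun l _ => I5 i j k l]
    refine Finset.sum_congr rfl fun j _ => ?_
    rw [integral_finsetSum _ fun k _ => integrable_finsetSum _ fun l _ => I4 i j k l,
      integral_finsetSum _ fun k _ => integrable_finsetSum _ fun l _ => I5 i j k l]
    refine Finset.sum_congr rfl fun k _ => ?_
    rw [integral_finsetSum _ fun l _ => I4 i j k l, integral_finsetSum _ fun l _ => I5 i j k l]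
    refine Finset.sum_congr rfl fun l _ => ?_
    simp only [mul_add, mul_assoc]
    rw [integral_sub (I1 i j k l) (I2 i j k l), integral_add (I3 i j k l) (I1 i j k l),
      integral_scaledField_mul_pd hr c i j k l l (sP i k j)]
    ring
  have e2 : ∀ x, (∑ i, ∑ j, ∑ k, ∑ l, scaledField r c i j k l x *
      (pd l (reducedP ε h V i k j) x + logGrad ε i x * reducedP ε h V j k l x)) =
      (r ^ 2)⁻¹ * pairing c (r⁻¹ • x) := by
    intro x
    by_cases hx : x ∈ core n r
    · have hx' := core_subset_half hr hx
      rw [show (∑ i, ∑ j, ∑ k, ∑ l, scaledField r c i j k l x *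
          (pd l (reducedP ε h V i k j) x + logGrad ε i x * reducedP ε h V j k l x)) = _ from
        (isWeylLike_testField hn hca (r⁻¹ • x)).sum_pd_reducedP hε hV (taylorH_symm hc) hx']
      simp only [pairing, Finset.mul_sum]
      refine Finset.sum_congr rfl fun i _ => Finset.sum_congr rfl fun j _ =>
        Finset.sum_congr rfl fun k _ => Finset.sum_congr rfl fun l _ => ?_
      rw [pd_pd_taylorH h i k j l hx', WithLp.ofLp_smul, hess_rescale _ hr.ne']
      field_simp
    · have h0 : ∀ i j k l, testField c i j k l (r⁻¹ • x) = 0 := fun i j k l => zZ i j k l x hx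
      simp only [pairing, h0, zZ _ _ _ _ x hx, zero_mul, Finset.sum_const_zero, mul_zero]
  rw [e1]
  simp only [e2]
  rw [integral_const_mul, Measure.integral_comp_inv_smul_of_nonneg _ _ hr.le, finrank_euclideanSpace,
    Fintype.card_fin, smul_eq_mul, ← mul_assoc]
  congr 1
  rw [show r ^ n = r ^ 2 * r ^ (n - 2) by rw [← pow_add]; congr 1; omega]
  field_simp

theorem young {θ a b : ℝ} (hθ : 0 < θ) : a * b ≤ θ * a ^ 2 + 1 / (4 * θ) * b ^ 2 := by
  have : θ * a ^ 2 + 1 / (4 * θ) * b ^ 2 - a * b = 1 / (4 * θ) * (2 * θ * a - b) ^ 2 := by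
    field_simp; ring
  have h2 : 0 ≤ 1 / (4 * θ) * (2 * θ * a - b) ^ 2 := by positivity
  linarith

theorem normSqP_eq (hn : 3 ≤ n) {ε : ℝ} (hε : 0 < ε) (h : MatField n) (V : E n → E n) {x : E n}
    (hx : x ∈ half n) :
    normSqP ε h V x = vEps ε x ^ 2 * ∑ i, ∑ k, ∑ l, reducedP ε h V i k l x ^ 2 := by
  simp only [normSqP, Finset.mul_sum]
  refine Finset.sum_congr rfl fun i _ => Finset.sum_congr rfl fun k _ =>
    Finset.sum_congr rfl fun l _ => ?_
  rw [tensorP_eq hn hε hx, mul_pow]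

theorem normSqP_nonneg (ε : ℝ) (h : MatField n) (V : E n → E n) (x : E n) :
    0 ≤ normSqP ε h V x :=
  Finset.sum_nonneg fun _ _ => Finset.sum_nonneg fun _ _ => Finset.sum_nonneg fun _ _ =>
    sq_nonneg _

/-- A derivative of the test field and a factor `logGrad` both cost $1/r$. Young's inequality with
free $\theta$ splits each product, so that the coefficient part can later be absorbed. -/
theorem density_le {M : ℝ} (hup : ∀ (c : Coefs n) (i j k l : Fin n) (x : E n),
      |testField c i j k l x| ≤ M * ‖c‖ ∧
      ∀ p, |fderiv ℝ (testField c i j k l) x (EuclideanSpace.single p 1)| ≤ M * ‖c‖)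
    (hM : 0 ≤ M) {θ ε r : ℝ} (hθ0 : 0 < θ) (hε : 0 < ε) (hεr : ε ≤ r) (h : MatField n)
    (V : E n → E n) (c : Coefs n) {x : E n} (hx : x ∈ core n r) :
    density r ε h V c x ≤ 2 * (n : ℝ) ^ 4 * θ * (‖c‖ ^ 2 / r ^ 2) +
      1 / (4 * θ) * (5 * M ^ 2) * n * ∑ i, ∑ k, ∑ l, reducedP ε h V i k l x ^ 2 := by
  have hr : 0 < r := hε.trans_le hεr
  set N := ‖c‖ with hN
  have hNn : 0 ≤ N := norm_nonneg c
  have t : ∀ i j k l, scaledField r c i j k l x * logGrad ε i x * reducedP ε h V j k l x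
    - fderiv ℝ (scaledField r c i j k l) x (EuclideanSpace.single l 1) * reducedP ε h V i k j x
      ≤ 2 * θ * (N ^ 2 / r ^ 2) + 1 / (4 * θ) * (4 * M ^ 2) * reducedP ε h V j k l x ^ 2
        + 1 / (4 * θ) * M ^ 2 * reducedP ε h V i k j x ^ 2 := by
    intro i j k l
    obtain ⟨b1, b2⟩ := hup c i j k l (r⁻¹ • x)
    have b3 := b2 l
    have b4 := abs_logGrad_le hε hεr hx i
    have u1 : scaledField r c i j k l x * logGrad ε i x * reducedP ε h V j k l x ≤
        N / r * (2 * M * |reducedP ε h V j k l x|) := by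
      calc _ ≤ |scaledField r c i j k l x * logGrad ε i x * reducedP ε h V j k l x| := le_abs_self _
        _ = |testField c i j k l (r⁻¹ • x)| * |logGrad ε i x| * |reducedP ε h V j k l x| := by
            rw [abs_mul, abs_mul]; rfl
        _ ≤ M * N * (2 / r) * |reducedP ε h V j k l x| := by gcongr
        _ = _ := by ring
    have u2 : - (fderiv ℝ (scaledField r c i j k l) x (EuclideanSpace.single l 1) *
        reducedP ε h V i k j x) ≤ N / r * (M * |reducedP ε h V i k j x|) := by
      rw [fderiv_scaledField]
      calc _ ≤ |r⁻¹ * fderiv ℝ (testField c i j k l) (r⁻¹ • x) (EuclideanSpace.single l 1) *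
            reducedP ε h V i k j x| := neg_le_abs _
        _ = r⁻¹ * |fderiv ℝ (testField c i j k l) (r⁻¹ • x) (EuclideanSpace.single l 1)| *
            |reducedP ε h V i k j x| := by
            rw [abs_mul, abs_mul, abs_of_pos (inv_pos.2 hr)]
        _ ≤ r⁻¹ * (M * N) * |reducedP ε h V i k j x| := by gcongr
        _ = _ := by ring
    have y1 := young hθ0 (a := N / r) (b := 2 * M * |reducedP ε h V j k l x|)
    have y2 := young hθ0 (a := N / r) (b := M * |reducedP ε h V i k j x|)
    rw [mul_pow, div_pow, sq_abs] at y1 y2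
    rw [mul_pow] at y1
    linarith
  have t2 : density r ε h V c x ≤ ∑ i, ∑ j, ∑ k, ∑ l, (2 * θ * (N ^ 2 / r ^ 2)
      + 1 / (4 * θ) * (4 * M ^ 2) * reducedP ε h V j k l x ^ 2
        + 1 / (4 * θ) * M ^ 2 * reducedP ε h V i k j x ^ 2) :=
    Finset.sum_le_sum fun i _ => Finset.sum_le_sum fun j _ => Finset.sum_le_sum fun k _ =>
      Finset.sum_le_sum fun l _ => t i j k l
  set Q := ∑ i, ∑ k, ∑ l, reducedP ε h V i k l x ^ 2 with hQ
  have t3 : ∑ i : Fin n, ∑ j, ∑ k, ∑ l, (2 * θ * (N ^ 2 / r ^ 2)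
      + 1 / (4 * θ) * (4 * M ^ 2) * reducedP ε h V j k l x ^ 2
        + 1 / (4 * θ) * M ^ 2 * reducedP ε h V i k j x ^ 2) =
      2 * (n : ℝ) ^ 4 * θ * (N ^ 2 / r ^ 2) + 1 / (4 * θ) * (5 * M ^ 2) * n * Q := by
    have q2 : ∑ i, ∑ j, ∑ k, reducedP ε h V i k j x ^ 2 = Q :=
      Finset.sum_congr rfl fun i _ => Finset.sum_comm
    simp only [Finset.sum_add_distrib, ← Finset.mul_sum, Finset.sum_const, Finset.card_univ,
      Fintype.card_fin, nsmul_eq_mul, ← hQ, q2]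
    ring
  exact t2.trans_eq t3

/-- The estimate at a single scale. -/
theorem exists_scale_estimate (hn : 6 ≤ n) : ∃ C, 0 < C ∧ ∀ (h : MatField n), Admissible (coef h) →
    ∀ V : E n → E n, ContDiffOn ℝ ∞ V (half n) → ∀ ε r : ℝ, 0 < ε → ε ≤ r →
      ‖rescale r (coef h)‖ ^ 2 * ε ^ (n - 2) ≤
        C * r ^ (n - 2) * ∫ x in core n r, normSqP ε h V x := by
  obtain ⟨c₀, hc₀, hlow⟩ := exists_lower_bound_pairing hn
  obtain ⟨M, hM, hup⟩ := exists_bound_testField n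
  set κ : ℝ := (volume (Metric.closedBall (ctr n) (1 / 4))).toReal with hκ
  have hκ0 : 0 < κ := ENNReal.toReal_pos (Metric.measure_closedBall_pos _ _ (by norm_num)).ne'
    (isCompact_closedBall _ _).measure_ne_top
  have hn0 : (0 : ℝ) < n := by exact_mod_cast (by omega : 0 < n)
  -- Chosen so that the coefficient term, integrated over the core of volume $r^n\kappa$, is exactly
  -- half of the lower bound $c_0\|c\|^2r^{n-2}$.
  set θ : ℝ := c₀ / (4 * (n : ℝ) ^ 4 * κ) with hθ
  have hθ0 : 0 < θ := by positivity
  set D : ℝ := 1 / (4 * θ) * (5 * M ^ 2) * n with hD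
  have hD0 : 0 ≤ D := by positivity
  refine ⟨2 / c₀ * (D * 9 ^ (n - 2)) + 1, by positivity, fun h hc V hV ε r hε hεr => ?_⟩
  have hr : 0 < r := hε.trans_le hεr
  set c := rescale r (coef h) with hcdef
  obtain ⟨hint, heq⟩ := integral_density (by omega) hc hV hr hε
  have hl := hlow c (hc.rescale r)
  set N := ‖c‖ with hN
  have hNn : 0 ≤ N := norm_nonneg c
  have hpt : ∀ x ∈ core n r, density r ε h V c x ≤ 2 * (n : ℝ) ^ 4 * θ * (N ^ 2 / r ^ 2) +
      D * (9 * r ^ 2) ^ (n - 2) / ε ^ (n - 2) * normSqP ε h V x := by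
    intro x hx
    have hx' := core_subset_half hr hx
    have h1 := density_le hup hM hθ0 hε hεr h V c hx
    rw [normSqP_eq (by omega) hε h V hx']
    set Q := ∑ i, ∑ k, ∑ l, reducedP ε h V i k l x ^ 2 with hQ
    have hQ0 : 0 ≤ Q := Finset.sum_nonneg fun _ _ => Finset.sum_nonneg fun _ _ =>
      Finset.sum_nonneg fun _ _ => sq_nonneg _
    -- Restores the factor $v_\epsilon^2$ of $|P|^2$, bounded below on the core.
    have h2 : Q ≤ (9 * r ^ 2) ^ (n - 2) / ε ^ (n - 2) * (vEps ε x ^ 2 * Q) := by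
      rw [div_mul_eq_mul_div, le_div_iff₀ (by positivity), mul_comm Q, ← mul_assoc]
      exact mul_le_mul_of_nonneg_right (inv_vEps_sq_le (by omega) hε hεr hx) hQ0
    refine h1.trans ?_
    rw [← hD, mul_div_assoc, mul_assoc D]
    exact add_le_add_right (mul_le_mul_of_nonneg_left h2 hD0) _
  have hvol : (volume (core n r)).toReal = r ^ n * κ := by
    have : core n r = r • Metric.closedBall (ctr n) (1 / 4) := by
      ext x
      rw [mem_core_iff hr, Set.mem_smul_set_iff_inv_smul_mem₀ hr.ne']
    rw [this, Measure.addHaar_smul, finrank_euclideanSpace, Fintype.card_fin, ENNReal.toReal_mul,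
      abs_of_pos (pow_pos hr n), ENNReal.toReal_ofReal (pow_pos hr n).le]
  have hIn : IntegrableOn (normSqP ε h V) (core n r) :=
    ((continuousOn_normSqP (by omega) hε hV).mono (core_subset_half hr)).integrableOn_compact
      isCompact_core
  set I := ∫ x in core n r, normSqP ε h V x with hI
  have hI0 : 0 ≤ I := setIntegral_nonneg isCompact_core.measurableSet fun x _ =>
    normSqP_nonneg ε h V x
  have hmain : ∫ x, density r ε h V c x ≤ 2 * (n : ℝ) ^ 4 * θ * (N ^ 2 / r ^ 2) * (r ^ n * κ) +
      D * (9 * r ^ 2) ^ (n - 2) / ε ^ (n - 2) * I := by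
    rw [← setIntegral_eq_integral_of_forall_compl_eq_zero (s := core n r)
      fun x hx => density_eq_zero hr ε h V c hx]
    have hcst : IntegrableOn (fun _ : E n => 2 * (n : ℝ) ^ 4 * θ * (N ^ 2 / r ^ 2)) (core n r) :=
      continuousOn_const.integrableOn_compact isCompact_core
    calc _ ≤ ∫ x in core n r, (2 * (n : ℝ) ^ 4 * θ * (N ^ 2 / r ^ 2) +
          D * (9 * r ^ 2) ^ (n - 2) / ε ^ (n - 2) * normSqP ε h V x) :=
        setIntegral_mono_on hint.integrableOn (hcst.add (hIn.const_mul _))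
          isCompact_core.measurableSet hpt
      _ = _ := by
        rw [integral_add hcst (hIn.const_mul _), setIntegral_const, integral_const_mul,
          Measure.real, hvol, smul_eq_mul, mul_comm (r ^ n * κ)]
  rw [heq] at hmain
  have hrn : r ^ n = r ^ 2 * r ^ (n - 2) := by rw [← pow_add]; congr 1; omega
  have h1 : r ^ (n - 2) * (c₀ * N ^ 2) ≤ c₀ / 2 * N ^ 2 * r ^ (n - 2) +
      D * 9 ^ (n - 2) * (r ^ (n - 2)) ^ 2 / ε ^ (n - 2) * I := by
    have e1 : 2 * (n : ℝ) ^ 4 * θ * (N ^ 2 / r ^ 2) * (r ^ n * κ) =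
        c₀ / 2 * N ^ 2 * r ^ (n - 2) := by
      rw [hθ, hrn]; field_simp; ring
    have e2 : (9 * r ^ 2) ^ (n - 2) = 9 ^ (n - 2) * (r ^ (n - 2)) ^ 2 := by
      rw [mul_pow, ← pow_mul, ← pow_mul, mul_comm 2]
    rw [e1, e2, ← mul_assoc] at hmain
    refine le_trans ?_ hmain
    gcongr
  have hp := pow_pos hr (n - 2)
  have hpe := pow_pos hε (n - 2)
  have h2 : c₀ / 2 * N ^ 2 * ε ^ (n - 2) ≤ D * 9 ^ (n - 2) * r ^ (n - 2) * I := by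
    have h3 : r ^ (n - 2) * (c₀ / 2 * N ^ 2) ≤
        D * 9 ^ (n - 2) * (r ^ (n - 2)) ^ 2 / ε ^ (n - 2) * I := by linarith
    rw [div_mul_eq_mul_div (D * 9 ^ (n - 2) * (r ^ (n - 2)) ^ 2), le_div_iff₀ hpe] at h3
    refine le_of_mul_le_mul_left ?_ hp
    linarith
  calc N ^ 2 * ε ^ (n - 2) = 2 / c₀ * (c₀ / 2 * N ^ 2 * ε ^ (n - 2)) := by field_simp
    _ ≤ 2 / c₀ * (D * 9 ^ (n - 2) * r ^ (n - 2) * I) := by gcongr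
    _ = 2 / c₀ * (D * 9 ^ (n - 2)) * r ^ (n - 2) * I := by ring
    _ ≤ _ := by
      gcongr
      linarith

end HalfSpace

/-! ### Weighted sums over regions of size comparable to $r$. -/

namespace HalfSpace

open MeasureTheory

variable {n : ℕ} [NeZero n]

/-- The weighted sum of squares of the Taylor coefficients over the region `s`. -/
noncomputable def weightedSum (ε : ℝ) (h : MatField n) (s : Set (E n)) : ℝ :=
  ∑ i, ∑ j, ∑ α ∈ multiIdx n, |coef h i j α| ^ 2 * ε ^ (n - 2) *
    ∫ x in s, (ε + ‖x‖) ^ (2 * (order α : ℤ) + 2 - 2 * (n : ℤ))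

theorem measurableSet_half : MeasurableSet (half n) := isClosed_half.measurableSet

theorem integrableOn_weight {n : ℕ} {ε : ℝ} (hε : 0 < ε) (p : ℤ) {s : Set (E n)} {δ : ℝ}
    (hs : s ⊆ Metric.ball 0 δ) : IntegrableOn (fun x : E n => (ε + ‖x‖) ^ p) s := by
  refine IntegrableOn.mono_set ?_ (hs.trans Metric.ball_subset_closedBall)
  refine Continuous.continuousOn ?_ |>.integrableOn_compact (isCompact_closedBall _ _)
  exact (continuous_const.add continuous_norm).zpow₀ p fun x =>
    Or.inl (add_pos_of_pos_of_nonneg hε (norm_nonneg x)).ne'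

theorem weightedSum_union {ε : ℝ} (hε : 0 < ε) (h : MatField n) {s t : Set (E n)} {δ : ℝ}
    (hs : s ⊆ Metric.ball 0 δ) (ht : t ⊆ Metric.ball 0 δ) (hst : Disjoint s t)
    (hm : MeasurableSet t) :
    weightedSum ε h (s ∪ t) = weightedSum ε h s + weightedSum ε h t := by
  simp only [weightedSum, ← Finset.sum_add_distrib]
  refine Finset.sum_congr rfl fun i _ => Finset.sum_congr rfl fun j _ =>
    Finset.sum_congr rfl fun α _ => ?_
  rw [setIntegral_union hst hm (integrableOn_weight hε _ hs) (integrableOn_weight hε _ ht), mul_add]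

theorem integrableOn_normSqP (hn : 3 ≤ n) {h : MatField n} {V : E n → E n} {ε : ℝ} (hε : 0 < ε)
    (hV : ContDiffOn ℝ ∞ V (half n)) {s : Set (E n)} {δ : ℝ} (hs : s ⊆ Metric.ball 0 δ ∩ half n) :
    IntegrableOn (normSqP ε h V) s := by
  have hc : IsCompact (Metric.closedBall (0 : E n) δ ∩ half n) :=
    (isCompact_closedBall _ _).inter_right isClosed_half
  exact (((continuousOn_normSqP hn hε hV).mono Set.inter_subset_right).integrableOn_compact
    hc).mono_set (hs.trans (Set.inter_subset_inter_left _ Metric.ball_subset_closedBall))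

/-- The weight is at most a multiple of $r^{2k+2-2n}$ and the volume at most a multiple of $r^n$.
Multiplied by $r^{n-2}$ they leave $r^{2k}$, the square of the weight in `rescale`. -/
theorem setIntegral_weight_le {ε r : ℝ} (hε : 0 < ε) (hr : 0 < r) (hn : 2 ≤ n) {k : ℕ}
    (hk : k + 1 ≤ n) {s : Set (E n)} (hs : s ⊆ Metric.ball 0 (2 * r))
    (hlow : ∀ x ∈ s, r / 2 ≤ ε + ‖x‖) :
    r ^ (n - 2) * ∫ x in s, (ε + ‖x‖) ^ (2 * (k : ℤ) + 2 - 2 * (n : ℤ)) ≤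
      8 ^ n * (volume (Metric.ball (0 : E n) 1)).toReal * r ^ (2 * k) := by
  obtain ⟨q, hq⟩ : ∃ q, q + 2 * k + 2 = 2 * n := ⟨2 * n - 2 - 2 * k, by omega⟩
  have hp : 2 * (k : ℤ) + 2 - 2 * (n : ℤ) = -(q : ℤ) := by omega
  set κ := (volume (Metric.ball (0 : E n) 1)).toReal with hκ
  have hκ0 : 0 ≤ κ := ENNReal.toReal_nonneg
  have hball : (volume (Metric.ball (0 : E n) (2 * r))).toReal = (2 * r) ^ n * κ := by
    rw [Measure.addHaar_ball _ _ (by positivity), finrank_euclideanSpace, Fintype.card_fin,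
      ENNReal.toReal_mul, ENNReal.toReal_ofReal (by positivity)]
  have hfin : volume (Metric.ball (0 : E n) (2 * r)) ≠ ⊤ := measure_ball_lt_top.ne
  have hvol : volume.real s ≤ (2 * r) ^ n * κ := by
    rw [← hball]
    exact ENNReal.toReal_mono hfin (measure_mono hs)
  have hbound : ∀ x ∈ s, ‖(ε + ‖x‖) ^ (2 * (k : ℤ) + 2 - 2 * (n : ℤ))‖ ≤ ((r / 2) ^ q)⁻¹ := by
    intro x hx
    have h0 : 0 < ε + ‖x‖ := by positivity
    rw [hp, zpow_neg, zpow_natCast, Real.norm_of_nonneg (by positivity)]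
    gcongr
    exact hlow x hx
  have h1 := (Real.le_norm_self _).trans (norm_setIntegral_le_of_norm_le_const
    ((measure_mono hs).trans_lt hfin.lt_top) hbound)
  calc _ ≤ r ^ (n - 2) * (((r / 2) ^ q)⁻¹ * ((2 * r) ^ n * κ)) := by
        gcongr
        exact h1.trans (by gcongr)
    _ = 2 ^ (q + n) * κ * (r ^ (n - 2) * r ^ n / r ^ q) := by
        rw [div_pow, mul_pow, pow_add]
        field_simp
    _ = 2 ^ (q + n) * κ * r ^ (2 * k) := by
        congr 1
        rw [div_eq_iff (by positivity), ← pow_add, ← pow_add]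
        congr 1
        omega
    -- The exponent is $q+n$ with $q=2n-2-2k\le2n$, which gives $8^n$.
    _ ≤ 2 ^ (3 * n) * κ * r ^ (2 * k) := by
        gcongr
        · norm_num
        · omega
    _ = _ := by
        rw [pow_mul]
        norm_num

theorem weightedSum_le {ε r : ℝ} (hε : 0 < ε) (hr : 0 < r) (hn : 3 ≤ n) (h : MatField n)
    {s : Set (E n)} (hs : s ⊆ Metric.ball 0 (2 * r))
    (hlow : ∀ x ∈ s, r / 2 ≤ ε + ‖x‖) :
    r ^ (n - 2) * weightedSum ε h s ≤
      (n * (n * (multiIdx n).card)) * (8 ^ n * (volume (Metric.ball (0 : E n) 1)).toReal) *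
        (‖rescale r (coef h)‖ ^ 2 * ε ^ (n - 2)) := by
  set κ := 8 ^ n * (volume (Metric.ball (0 : E n) 1)).toReal with hκ
  set N := ‖rescale r (coef h)‖ with hN
  have hterm : ∀ i j, ∀ α ∈ multiIdx n, r ^ (n - 2) * (|coef h i j α| ^ 2 * ε ^ (n - 2) *
      ∫ x in s, (ε + ‖x‖) ^ (2 * (order α : ℤ) + 2 - 2 * (n : ℤ))) ≤ κ * (N ^ 2 * ε ^ (n - 2)) := by
    intro i j α hα
    have h1 : order α + 1 ≤ n := by
      have := ((mem_multiIdx α).1 hα).2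
      unfold dOrd at this
      omega
    have h2 := setIntegral_weight_le hε hr (by omega) h1 hs hlow
    have h3 : |r ^ order α * coef h i j α| ≤ N :=
      calc _ = ‖rescale r (coef h) i j ⟨α, hα⟩‖ := rfl
        _ ≤ N := ((norm_le_pi_norm _ _).trans (norm_le_pi_norm _ _)).trans (norm_le_pi_norm _ _)
    have h4 : r ^ (2 * order α) * |coef h i j α| ^ 2 ≤ N ^ 2 := by
      calc _ = |r ^ order α * coef h i j α| ^ 2 := by
            rw [abs_mul, abs_of_pos (pow_pos hr _), mul_pow, ← pow_mul, mul_comm 2]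
        _ ≤ _ := by gcongr
    have hκ0 : 0 ≤ κ := by positivity
    calc _ = |coef h i j α| ^ 2 * ε ^ (n - 2) * (r ^ (n - 2) *
          ∫ x in s, (ε + ‖x‖) ^ (2 * (order α : ℤ) + 2 - 2 * (n : ℤ))) := by ring
      _ ≤ |coef h i j α| ^ 2 * ε ^ (n - 2) * (κ * r ^ (2 * order α)) := by gcongr
      _ = κ * (r ^ (2 * order α) * |coef h i j α| ^ 2 * ε ^ (n - 2)) := by ring
      _ ≤ _ := by gcongr
  calc _ = ∑ i, ∑ j, ∑ α ∈ multiIdx n, r ^ (n - 2) * (|coef h i j α| ^ 2 * ε ^ (n - 2) *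
        ∫ x in s, (ε + ‖x‖) ^ (2 * (order α : ℤ) + 2 - 2 * (n : ℤ))) := by
        simp only [weightedSum, Finset.mul_sum]
    _ ≤ ∑ _i : Fin n, ∑ _j : Fin n, ∑ _α ∈ multiIdx n, κ * (N ^ 2 * ε ^ (n - 2)) :=
        Finset.sum_le_sum fun i _ => Finset.sum_le_sum fun j _ => Finset.sum_le_sum (hterm i j)
    _ = _ := by
        simp only [Finset.sum_const, Finset.card_univ, Fintype.card_fin, nsmul_eq_mul]
        ring

/-- The estimate on regions of size comparable to `r`. -/
theorem exists_region_estimate (hn : 6 ≤ n) : ∃ C, 0 < C ∧ ∀ (h : MatField n),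
    Admissible (coef h) → ∀ V : E n → E n, ContDiffOn ℝ ∞ V (half n) → ∀ ε r : ℝ, 0 < ε → ε ≤ r →
      ∀ s : Set (E n), MeasurableSet s → core n r ⊆ s → s ⊆ Metric.ball 0 (2 * r) ∩ half n →
      (∀ x ∈ s, r / 2 ≤ ε + ‖x‖) → weightedSum ε h s ≤ C * ∫ x in s, normSqP ε h V x := by
  obtain ⟨C, hC, hest⟩ := exists_scale_estimate hn
  set K : ℝ := (n * (n * (multiIdx n).card)) * (8 ^ n * (volume (Metric.ball (0 : E n) 1)).toReal)
    with hK
  have hK0 : 0 ≤ K := by positivity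
  -- Adding $1$ only secures positivity of the constant.
  refine ⟨K * C + 1, by positivity, fun h hc V hV ε r hε hεr s hm hcs hs hlow => ?_⟩
  have hr : 0 < r := hε.trans_le hεr
  have h1 := weightedSum_le hε hr (by omega) h (hs.trans Set.inter_subset_left) hlow
  have h2 := hest h hc V hV ε r hε hεr
  have h3 : ∫ x in core n r, normSqP ε h V x ≤ ∫ x in s, normSqP ε h V x :=
    setIntegral_mono_set (integrableOn_normSqP (by omega) hε hV hs)
      (Filter.Eventually.of_forall fun x => normSqP_nonneg ε h V x) hcs.eventuallyLE
  have h4 : 0 ≤ ∫ x in s, normSqP ε h V x := integral_nonneg fun x => normSqP_nonneg ε h V x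
  have hp := pow_pos hr (n - 2)
  refine le_of_mul_le_mul_left ?_ hp
  calc _ ≤ K * (‖rescale r (coef h)‖ ^ 2 * ε ^ (n - 2)) := h1
    _ ≤ K * (C * r ^ (n - 2) * ∫ x in s, normSqP ε h V x) := by
        refine mul_le_mul_of_nonneg_left (h2.trans ?_) hK0
        exact mul_le_mul_of_nonneg_left h3 (by positivity)
    _ = r ^ (n - 2) * (K * C * ∫ x in s, normSqP ε h V x) := by ring
    _ ≤ _ := by
        refine mul_le_mul_of_nonneg_left (mul_le_mul_of_nonneg_right ?_ h4) hp.le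
        linarith

theorem core_subset_ball {r : ℝ} (hr : 0 < r) : core n r ⊆ Metric.ball 0 (2 * r) ∩ half n := by
  intro x hx
  refine ⟨?_, core_subset_half hr hx⟩
  rw [mem_ball_zero_iff]
  linarith [(norm_mem_core hr hx).2]

end HalfSpace

/-! ### Dyadic summation. -/

theorem mainTheorem7 (n : ℕ) [NeZero n] (hn : 6 ≤ n) :
    ∃ C : ℝ, 0 < C ∧
      ∀ (ρ : ℝ) (g h : MatField n), IsConformalFermi ρ g h →
      ∀ V : E n → E n, ContDiffOn ℝ ∞ V (half n) →
      ∀ ε δ : ℝ, 0 < ε → 2 * ε ≤ δ →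
        (∑ i, ∑ j, ∑ α ∈ multiIdx n, |coef h i j α| ^ 2 * ε ^ (n - 2) *
            ∫ x in Metric.ball (0 : E n) δ ∩ half n,
              (ε + ‖x‖) ^ (2 * (order α : ℤ) + 2 - 2 * (n : ℤ)))
          ≤ C * ∫ x in Metric.ball (0 : E n) δ ∩ half n, normSqP ε h V x := by
  obtain ⟨C, hC, hest⟩ := exists_region_estimate hn
  refine ⟨C, hC, fun ρ g h hh V hV ε δ hε hδ => ?_⟩
  have hc := hh.admissible
  -- Induction on the number of halvings. Both sides are additive over disjoint regions, so the
  -- constant does not grow with $m$.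
  have key : ∀ (m : ℕ) (δ : ℝ), 2 * ε ≤ δ → δ < 2 ^ (m + 2) * ε →
      weightedSum ε h (Metric.ball (0 : E n) δ ∩ half n) ≤
        C * ∫ x in Metric.ball (0 : E n) δ ∩ half n, normSqP ε h V x := by
    intro m
    induction m with
    | zero =>
      intro δ h1 h2
      have e : 2 * (δ / 2) = δ := by ring
      have hc' := core_subset_ball (n := n) (r := δ / 2) (by linarith)
      rw [e] at hc'
      -- Here $2\epsilon\le\delta<4\epsilon$, so with $r=\delta/2$ both $\epsilon\le r$ and
      -- $r/2\le\epsilon$ hold, and the whole half ball is one region.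
      refine hest h hc V hV ε (δ / 2) hε (by linarith) _
        (Metric.isOpen_ball.measurableSet.inter measurableSet_half) hc' (by rw [e]) fun x _ => ?_
      have := norm_nonneg x
      norm_num at h2
      linarith
    | succ m ih =>
      intro δ h1 h2
      by_cases h3 : δ / 2 < 2 * ε
      · exact ih δ h1 (by
          have : (1 : ℝ) ≤ 2 ^ m := one_le_pow₀ (by norm_num)
          rw [pow_add]
          nlinarith)
      have h4 := ih (δ / 2) (by linarith) (by rw [pow_succ] at h2; linarith)
      set b := Metric.ball (0 : E n) (δ / 2) ∩ half n with hb
      set s := (Metric.ball (0 : E n) δ ∩ half n) \ Metric.ball (0 : E n) (δ / 2) with hs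
      have e : 2 * (δ / 2) = δ := by ring
      have hr : 0 < δ / 2 := by linarith
      have hbs : Metric.ball (0 : E n) δ ∩ half n = b ∪ s := by
        have := Metric.ball_subset_ball (x := (0 : E n)) (by linarith : δ / 2 ≤ δ)
        ext x
        have := @this x
        simp only [hb, hs, Set.mem_inter_iff, Set.mem_union, Set.mem_sdiff]
        tauto
      have hdisj : Disjoint b s := Set.disjoint_left.2 fun x hx hx' => hx'.2 hx.1
      have hsm : MeasurableSet s := (Metric.isOpen_ball.measurableSet.inter measurableSet_half).diff
        Metric.isOpen_ball.measurableSet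
      have hbδ : b ⊆ Metric.ball 0 δ ∩ half n := hbs ▸ Set.subset_union_left
      have hsδ : s ⊆ Metric.ball 0 δ ∩ half n := hbs ▸ Set.subset_union_right
      -- The outer half annulus contains the core of scale $r=\delta/2$, whose points have norm at
      -- least $\frac54r$.
      have h5 := hest h hc V hV ε (δ / 2) hε (by linarith) s hsm
        (fun x hx => ⟨e ▸ core_subset_ball hr hx, fun hx' => by
          rw [mem_ball_zero_iff] at hx'
          linarith [(norm_mem_core hr hx).1]⟩) (e.symm ▸ hsδ) fun x hx => by
          have := hx.2
          rw [mem_ball_zero_iff] at this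
          linarith
      rw [hbs, weightedSum_union hε h (hbδ.trans Set.inter_subset_left)
        (hsδ.trans Set.inter_subset_left) hdisj hsm,
        MeasureTheory.setIntegral_union hdisj hsm (integrableOn_normSqP (by omega) hε hV hbδ)
          (integrableOn_normSqP (by omega) hε hV hsδ), mul_add]
      exact add_le_add h4 h5
  obtain ⟨m, hm⟩ := pow_unbounded_of_one_lt (δ / ε) (one_lt_two (α := ℝ))
  refine key m δ hδ ?_
  rw [div_lt_iff₀ hε] at hm
  rw [pow_add]
  have := pow_pos (two_pos (α := ℝ)) m
  nlinarith
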